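/- **Setting.** Let $d\ge 2$, $N\ge 1$, let $D\subset\mathbb{R}^d$ be a bounded open set, $\Gamma_n=[\alpha_n,\beta_n]$ with $\alpha_n<\beta_n$, $|\Gamma_n|=\beta_n-\alpha_n$ and $\Gamma=\prod_{n=1}^N\Gamma_n$. Let $V=H^1_0(D)$ with $\|v\|_V=\|\nabla v\|_{L^2(D)}$, let $f\in L^2(D)$, and let $a(y,x)=a_0(x)+\sum_{n=1}^N a_n(x)y_n$ with measurable $a_0,\dots,a_N$ satisfy $0<a_{\min}\le a(y,x)\le a_{\max}$ for every $y\in\Gamma$ and a.e. $x\in D$. Let $u:\Gamma\to V$ be such that, for every $y\in\Gamma$, $$\int_D a(y,x)\,\nabla u(y)(x)\cdot\nabla v(x)\,dx=\int_D f(x)\,v(x)\,dx\qquad\forall v\in V .$$ For $\tau\in(0,\infty)^N$ put $\Sigma(\Gamma,\tau)=\{z\in\mathbb{C}^N:\operatorname{dist}(z_n,\Gamma_n)\le\tau_n\ \forall n\}$ and $$\sigma=\min_{1\le n\le N}\log\Big(\tfrac{2\tau_n}{|\Gamma_n|}+\sqrt{1+\tfrac{4\tau_n^2}{|\Gamma_n|^2}}\Big).$$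 **Sparse grid interpolation.** Let $m(0)=0$, $m(1)=1$ and $m(x)=2^{x-1}+1$ for $x>1$ (also for real $x$). Let $\mathcal{U}_n^{k}$ be Lagrange interpolation in $y_n$ on the $k$ Clenshaw–Curtis nodes $-\cos\frac{\pi(j-1)}{k-1}$, $1\le j\le k$ (the single node $0$ if $k=1$), transported affinely from $[-1,1]$ to $\Gamma_n$, and $\mathcal{U}_n^0=0$. For $i\in\{1,2,\dots\}^N$ let $\Delta^{m(i)}=\bigotimes_{n=1}^N\big(\mathcal{U}_n^{m(i_n)}-\mathcal{U}_n^{m(i_n-1)}\big)$, and for a finite set $I$ of multi-indices let $S_I=\sum_{i\in I}\Delta^{m(i)}$. **Algorithm (profit with work).** The margin of $I$ is $\mathcal{M}_I=\{i\notin I:\ i-e_n\in I\text{ for some }n\text{ with }i_n>1\}$. A set $I$ is downward-closed if $i\in I$, $i_n>1$ imply $i-e_n\in I$. For $i\in\mathcal{M}_I$ let $A_{i,I}$ be the smallest subset of $\mathcal{M}_I$ that contains $i$ and makes $I\cup A_{i,I}$ downward-closed. Put $$\zeta_{i,I}=\big\|\Delta^{m(i)}\big(a\nabla S_I[u]\big)\big\|_{L^\infty(\Gamma,L^2(D))},\qquad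 W_j=\prod_{n=1}^N\big(m(j_n)-m(j_n-1)\big),\qquad \mathcal{P}_{i,I}=\frac{\sum_{j\in A_{i,I}}\zeta_{j,I}}{\sum_{j\in A_{i,I}}W_j}.$$ Let $I_1=\{(1,\dots,1)\}$ and $I_{\ell+1}=I_\ell\cup A_{i_\ell,I_\ell}$ for $\ell\ge1$, where $i_\ell$ is the lexicographically first maximizer of $i\mapsto\mathcal{P}_{i,I_\ell}$ over $\mathcal{M}_{I_\ell}$. **Theorem.** There is $\tau\in(0,\infty)^N$ such that $u$ extends to a bounded holomorphic function on $\Sigma(\Gamma,\tau)$ with values in $H^1_0(D;\mathbb{C})$. For every $\tau\in(0,\infty)^N$ with this property, with $\sigma$ as above, there is a constant $C>0$, independent of $\ell$, such that $$\|u-S_{I_\ell}[u]\|_{L^\infty(\Gamma,V)}\ \le\ C\,\ell^5\Big(\frac{\ell}{N}\Big)^{4N}2^{\ell(1-\frac1N)}\,e^{-\frac{\sigma}{2}m(\ell^{1/N})}\qquad\text{for all integers }\ell>0 .$$ -/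

import Mathlib

open MeasureTheory

noncomputable section

namespace SparseGrid

/-! ### The spatial Sobolev space -/

/-- Functions in `L²(D; F)` for `D ⊆ ℝ^d`. -/
abbrev L2 {d : ℕ} (D : Set (EuclideanSpace ℝ (Fin d))) (F : Type) [NormedAddCommGroup F] :=
  Lp F 2 (volume.restrict D)

/-- The Hilbert space `L²(D; 𝕜) × L²(D; 𝕜^d)` in which pairs (function, gradient) live; its norm
on such pairs is the `H¹` norm. -/
abbrev PairSpace (𝕜 : Type) [RCLike 𝕜] {d : ℕ} (D : Set (EuclideanSpace ℝ (Fin d))) :=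
  WithLp 2 (L2 D 𝕜 × L2 D (EuclideanSpace 𝕜 (Fin d)))

/-- The classical gradient of a `𝕜`-valued function on `ℝ^d`. -/
def classicalGrad {𝕜 : Type} [RCLike 𝕜] {d : ℕ} (φ : EuclideanSpace ℝ (Fin d) → 𝕜)
    (x : EuclideanSpace ℝ (Fin d)) : EuclideanSpace 𝕜 (Fin d) :=
  WithLp.toLp 2 fun j => fderiv ℝ φ x (EuclideanSpace.single j 1)

/-- The test functions `C_c^∞(D; 𝕜)`. -/
structure IsTestFunction {𝕜 : Type} [RCLike 𝕜] {d : ℕ} (D : Set (EuclideanSpace ℝ (Fin d)))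
    (φ : EuclideanSpace ℝ (Fin d) → 𝕜) : Prop where
  smooth : ContDiff ℝ (⊤ : ℕ∞) φ
  compact : HasCompactSupport φ
  subset : tsupport φ ⊆ D

/-- The subspace `{(φ, ∇φ) : φ ∈ C_c^∞(D; 𝕜)}`. -/
def testPairs (𝕜 : Type) [RCLike 𝕜] {d : ℕ} (D : Set (EuclideanSpace ℝ (Fin d))) :
    Submodule 𝕜 (PairSpace 𝕜 D) where
  carrier := {p | ∃ φ : EuclideanSpace ℝ (Fin d) → 𝕜, IsTestFunction D φ ∧
    p.fst =ᵐ[volume.restrict D] φ ∧ p.snd =ᵐ[volume.restrict D] classicalGrad φ}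
  zero_mem' := by
    refine ⟨fun _ => 0, ⟨contDiff_const, HasCompactSupport.zero, ?_⟩, ?_, ?_⟩
    · have h : tsupport (fun _ : EuclideanSpace ℝ (Fin d) => (0 : 𝕜)) = ∅ :=
        tsupport_eq_empty_iff.2 rfl
      simp [h]
    · exact Lp.coeFn_zero _ _ _
    · refine (Lp.coeFn_zero _ _ _).trans (Filter.Eventually.of_forall fun x => ?_)
      ext j
      simp [classicalGrad]
  add_mem' := by
    rintro p q ⟨φ, hφ, hp1, hp2⟩ ⟨ψ, hψ, hq1, hq2⟩
    refine ⟨fun x => φ x + ψ x, ⟨hφ.smooth.add hψ.smooth, hφ.compact.add hψ.compact, ?_⟩, ?_, ?_⟩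
    · exact (tsupport_add φ ψ).trans (Set.union_subset hφ.subset hψ.subset)
    · filter_upwards [Lp.coeFn_add p.fst q.fst, hp1, hq1] with x h h1 h2
      have h' : ((p + q).fst : EuclideanSpace ℝ (Fin d) → 𝕜) x = (p.fst + q.fst : L2 D 𝕜) x := rfl
      rw [h', h, Pi.add_apply, h1, h2]
    · filter_upwards [Lp.coeFn_add p.snd q.snd, hp2, hq2] with x h h1 h2
      have h' : ((p + q).snd : EuclideanSpace ℝ (Fin d) → EuclideanSpace 𝕜 (Fin d)) x
        = (p.snd + q.snd : L2 D (EuclideanSpace 𝕜 (Fin d))) x := rfl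
      rw [h', h, Pi.add_apply, h1, h2]
      ext j
      have e : fderiv ℝ (fun x => φ x + ψ x) x = fderiv ℝ φ x + fderiv ℝ ψ x :=
        fderiv_fun_add (hφ.smooth.differentiable (by simp) x)
          (hψ.smooth.differentiable (by simp) x)
      simp [classicalGrad, e]
  smul_mem' := by
    rintro c p ⟨φ, hφ, hp1, hp2⟩
    refine ⟨fun x => c • φ x, ⟨hφ.smooth.const_smul c, hφ.compact.smul_left (f := fun _ => c), ?_⟩,
      ?_, ?_⟩
    · exact (closure_mono (Function.support_const_smul_subset c φ)).trans hφ.subset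
    · filter_upwards [Lp.coeFn_smul c p.fst, hp1] with x h h1
      have h' : ((c • p).fst : EuclideanSpace ℝ (Fin d) → 𝕜) x = (c • p.fst : L2 D 𝕜) x := rfl
      rw [h', h, Pi.smul_apply, h1]
    · filter_upwards [Lp.coeFn_smul c p.snd, hp2] with x h h1
      have h' : ((c • p).snd : EuclideanSpace ℝ (Fin d) → EuclideanSpace 𝕜 (Fin d)) x
        = (c • p.snd : L2 D (EuclideanSpace 𝕜 (Fin d))) x := rfl
      rw [h', h, Pi.smul_apply, h1]
      ext j
      have e : fderiv ℝ (fun x => c • φ x) x = c • fderiv ℝ φ x :=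
        fderiv_fun_const_smul (hφ.smooth.differentiable (by simp) x) c
      have e' := congrArg (fun L => L (EuclideanSpace.single j 1)) e
      simpa [classicalGrad] using e'.symm

/-- `H¹₀(D; 𝕜)`: the closure of `C_c^∞(D; 𝕜)` in `H¹(D; 𝕜)`, an element being recorded together
with its weak gradient. -/
def H10 (𝕜 : Type) [RCLike 𝕜] {d : ℕ} (D : Set (EuclideanSpace ℝ (Fin d))) :
    Submodule 𝕜 (PairSpace 𝕜 D) :=
  (testPairs 𝕜 D).topologicalClosure

/-- The `L²` function underlying an element of `H¹₀(D; 𝕜)`. -/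
def toL2 {𝕜 : Type} [RCLike 𝕜] {d : ℕ} {D : Set (EuclideanSpace ℝ (Fin d))} (v : H10 𝕜 D) :
    L2 D 𝕜 := v.1.fst

/-- The weak gradient of an element of `H¹₀(D; 𝕜)`. The norm of `V` is `‖grad v‖`. -/
def grad {𝕜 : Type} [RCLike 𝕜] {d : ℕ} {D : Set (EuclideanSpace ℝ (Fin d))} (v : H10 𝕜 D) :
    L2 D (EuclideanSpace 𝕜 (Fin d)) := v.1.snd

/-! ### The parametric diffusion problem -/

/-- The affine coefficient `a(y, x) = a₀(x) + ∑ₙ aₙ(x) yₙ`. -/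
def coef {d N : ℕ} (a₀ : EuclideanSpace ℝ (Fin d) → ℝ)
    (a : Fin N → EuclideanSpace ℝ (Fin d) → ℝ) (y : Fin N → ℝ)
    (x : EuclideanSpace ℝ (Fin d)) : ℝ :=
  a₀ x + ∑ n, a n x * y n

/-- `v ∈ H¹₀(D)` solves `-div (b ∇v) = f` weakly. -/
def IsWeakSolution {d : ℕ} {D : Set (EuclideanSpace ℝ (Fin d))}
    (b f : EuclideanSpace ℝ (Fin d) → ℝ) (v : H10 ℝ D) : Prop :=
  ∀ w : H10 ℝ D,
    ∫ x in D, b x * inner ℝ (grad v x) (grad w x) = ∫ x in D, f x * toL2 w x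

open Classical in
/-- The field `b g` for a bounded measurable `b` and `g ∈ L²(D; ℝ^d)`. (The value `0` is taken
only when `b g` is not in `L²`.) -/
def mulField {d : ℕ} {D : Set (EuclideanSpace ℝ (Fin d))} (b : EuclideanSpace ℝ (Fin d) → ℝ)
    (g : L2 D (EuclideanSpace ℝ (Fin d))) : L2 D (EuclideanSpace ℝ (Fin d)) :=
  if h : MemLp (fun x => b x • g x) 2 (volume.restrict D) then h.toLp _ else 0

/-- The set `Σ(Γ, τ)` of all `z ∈ ℂ^N` with `dist(zₙ, Γₙ) ≤ τₙ` for all `n`, for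
`Γₙ = [αₙ, βₙ]`. -/
def complexNhd {N : ℕ} (α β τ : Fin N → ℝ) : Set (Fin N → ℂ) :=
  {z | ∀ n, Metric.infDist (z n) (Complex.ofReal '' Set.Icc (α n) (β n)) ≤ τ n}

/-- `u : Γ → H¹₀(D)` extends to a bounded holomorphic function on `Σ(Γ, τ)` with values in the
complexification `H¹₀(D; ℂ)`. -/
def HasHolomorphicExtension {d N : ℕ} {D : Set (EuclideanSpace ℝ (Fin d))} (α β τ : Fin N → ℝ)
    (u : (Fin N → ℝ) → H10 ℝ D) : Prop :=
  ∃ U : (Fin N → ℂ) → H10 ℂ D,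
    DifferentiableOn ℂ U (complexNhd α β τ) ∧
    (∃ M : ℝ, ∀ z ∈ complexNhd α β τ, ‖grad (U z)‖ ≤ M) ∧
    ∀ y ∈ Set.Icc α β,
      toL2 (U fun n => (y n : ℂ)) =ᵐ[volume.restrict D] fun x => ((toL2 (u y) x : ℝ) : ℂ)

/-- `σ = minₙ σₙ`, `σₙ = log (2τₙ/|Γₙ| + √(1 + 4τₙ²/|Γₙ|²))`. -/
def sigma {N : ℕ} (α β τ : Fin N → ℝ) : ℝ :=
  ⨅ n, Real.log (2 * τ n / (β n - α n) + √(1 + 4 * τ n ^ 2 / (β n - α n) ^ 2))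

/-! ### Sparse grid interpolation on Clenshaw-Curtis nodes -/

/-- The doubling rule. -/
def m (i : ℕ) : ℕ := if i = 0 then 0 else if i = 1 then 1 else 2 ^ (i - 1) + 1

/-- The doubling rule at real arguments. -/
def mReal (x : ℝ) : ℝ := if x ≤ 0 then 0 else if x ≤ 1 then 1 else 2 ^ (x - 1) + 1

theorem mReal_natCast (i : ℕ) : mReal i = m i := by
  rcases Nat.lt_or_ge i 2 with h | h
  · interval_cases i <;> simp [mReal, m]
  · have h1 : ¬ ((i : ℝ) ≤ 0) := by
      have : (2 : ℝ) ≤ i := by exact_mod_cast h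
      linarith
    have h2 : ¬ ((i : ℝ) ≤ 1) := by
      have : (2 : ℝ) ≤ i := by exact_mod_cast h
      linarith
    have h3 : i ≠ 0 := by omega
    have h4 : i ≠ 1 := by omega
    have h5 : (i : ℝ) - 1 = ((i - 1 : ℕ) : ℝ) := by
      rw [Nat.cast_sub (by omega)]; simp
    simp only [mReal, m, h1, h2, h3, h4, if_false]
    rw [h5, Real.rpow_natCast]
    push_cast
    rfl

/-- The `k` Clenshaw-Curtis nodes on `[-1, 1]`, numbered from `0`; a single node is the
midpoint. -/
def ccNode (k : ℕ) (j : Fin k) : ℝ :=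
  if k = 1 then 0 else -Real.cos (Real.pi * j / ((k : ℝ) - 1))

/-- The Clenshaw-Curtis nodes transported affinely to `[p, q]`. -/
def node (p q : ℝ) (k : ℕ) (j : Fin k) : ℝ := (p + q) / 2 + (q - p) / 2 * ccNode k j

variable {N : ℕ} {E : Type*} [AddCommGroup E] [Module ℝ E]

/-- The univariate Lagrange interpolation operator on the `k` nodes of `[αₙ, βₙ]`, acting on the
`n`-th variable of `E`-valued functions on `ℝ^N`. For `k = 0` it is `0`. -/
def interp (α β : Fin N → ℝ) (n : Fin N) (k : ℕ) : Module.End ℝ ((Fin N → ℝ) → E) where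
  toFun g y := ∑ j : Fin k,
    (Lagrange.basis Finset.univ (node (α n) (β n) k) j).eval (y n) •
      g (Function.update y n (node (α n) (β n) k j))
  map_add' g h := by
    funext y
    simp [Finset.sum_add_distrib]
  map_smul' c g := by
    funext y
    simp only [Pi.smul_apply, RingHom.id_apply, Finset.smul_sum]
    exact Finset.sum_congr rfl fun j _ => smul_comm _ _ _

/-- The detail operator in the `n`-th variable. -/
def detail (α β : Fin N → ℝ) (n : Fin N) (i : ℕ) : Module.End ℝ ((Fin N → ℝ) → E) :=
  interp α β n (m i) - interp α β n (m (i - 1))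

/-- The hierarchical surplus operator: the tensor product of the detail operators, that is, the
composition of the detail operators in the variables `1, …, N`. -/
def surplus (α β : Fin N → ℝ) (i : Fin N → ℕ) : Module.End ℝ ((Fin N → ℝ) → E) :=
  (List.ofFn fun n => detail α β n (i n)).prod

/-- The sparse grid interpolation operator `S_I`. -/
def sparseInterp (α β : Fin N → ℝ) (I : Finset (Fin N → ℕ)) : Module.End ℝ ((Fin N → ℝ) → E) :=
  ∑ i ∈ I, surplus α β i

/-! ### The adaptive algorithm

Multi-indices have entries in `{1, 2, …}`; they are represented as functions `Fin N → ℕ`. -/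

/-- Downward-closed multi-index sets. -/
def IsDownwardClosed (I : Finset (Fin N → ℕ)) : Prop :=
  ∀ i ∈ I, ∀ n, 1 < i n → i - Pi.single n 1 ∈ I

/-- The margin of `I`: all `i ∉ I` such that `i - eₙ ∈ I` for some `n` with `iₙ > 1`. -/
def margin (I : Finset (Fin N → ℕ)) : Finset (Fin N → ℕ) :=
  ((I ×ˢ Finset.univ).image fun p : (Fin N → ℕ) × Fin N => p.1 + Pi.single p.2 1).filter
    fun i => i ∉ I ∧ ∃ n, 1 < i n ∧ i - Pi.single n 1 ∈ I

theorem mem_margin {I : Finset (Fin N → ℕ)} {i : Fin N → ℕ} :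
    i ∈ margin I ↔ i ∉ I ∧ ∃ n, 1 < i n ∧ i - Pi.single n 1 ∈ I := by
  simp only [margin, Finset.mem_filter, and_iff_right_iff_imp]
  rintro ⟨-, n, hn, h⟩
  refine Finset.mem_image.2 ⟨(i - Pi.single n 1, n), by simpa using h, ?_⟩
  funext k
  by_cases hk : k = n
  · subst hk; simp; omega
  · simp [hk]

open Classical in
/-- `A_{i,I}`: the smallest subset `A` of the margin of `I` that contains `i` and for which `I ∪ A`
is downward-closed. -/
def addedSet (I : Finset (Fin N → ℕ)) (i : Fin N → ℕ) : Finset (Fin N → ℕ) :=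
  (margin I).filter fun j =>
    ∀ A : Finset (Fin N → ℕ), A ⊆ margin I → i ∈ A → IsDownwardClosed (I ∪ A) → j ∈ A

/-- The work `W_j = ∏ₙ (m(jₙ) - m(jₙ - 1))`. -/
def work (j : Fin N → ℕ) : ℝ := ∏ n, ((m (j n) : ℝ) - m (j n - 1))

/-- The profit with work built from pointwise estimators `ζ_{i,I}`. -/
def profitWithWork (ζ : Finset (Fin N → ℕ) → (Fin N → ℕ) → ℝ) (I : Finset (Fin N → ℕ))
    (i : Fin N → ℕ) : ℝ :=
  (∑ j ∈ addedSet I i, ζ I j) / ∑ j ∈ addedSet I i, work j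

open Classical in
/-- The elements of the margin that maximize the profit `P`. -/
def maximizers (P : Finset (Fin N → ℕ) → (Fin N → ℕ) → ℝ) (I : Finset (Fin N → ℕ)) :
    Finset (Fin N → ℕ) :=
  (margin I).filter fun i => ∀ j ∈ margin I, P I j ≤ P I i

open Classical in
/-- One step of the algorithm: `I` is enlarged by `A_{i,I}`, where `i` is the lexicographically
first profit maximizer. -/
def step (P : Finset (Fin N → ℕ) → (Fin N → ℕ) → ℝ) (I : Finset (Fin N → ℕ)) :
    Finset (Fin N → ℕ) :=
  if h : (maximizers P I).Nonempty then
    I ∪ addedSet I (ofLex (((maximizers P I).map toLex.toEmbedding).min' (h.map)))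
  else I

/-- The multi-index sets `I_ℓ`, `ℓ = 1, 2, …`, with `I_1 = {(1, …, 1)}`. -/
def indexSet (P : Finset (Fin N → ℕ) → (Fin N → ℕ) → ℝ) : ℕ → Finset (Fin N → ℕ)
  | 0 => ∅
  | 1 => {fun _ => 1}
  | ℓ + 2 => step P (indexSet P (ℓ + 1))

/-- The pointwise error estimator
`ζ_{i,I} = ‖Δ^{m(i)} (a ∇S_I[u])‖_{L^∞(Γ, L²(D))}`. -/
def estimator {d : ℕ} {D : Set (EuclideanSpace ℝ (Fin d))} (α β : Fin N → ℝ)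
    (a₀ : EuclideanSpace ℝ (Fin d) → ℝ) (a : Fin N → EuclideanSpace ℝ (Fin d) → ℝ)
    (u : (Fin N → ℝ) → H10 ℝ D) (I : Finset (Fin N → ℕ)) (i : Fin N → ℕ) : ℝ :=
  (eLpNorm (surplus α β i fun y => mulField (coef a₀ a y) (grad (sparseInterp α β I u y)))
    ⊤ (volume.restrict (Set.Icc α β))).toReal

/-- The sparse grid approximation `S_{I_ℓ}[u]` produced by the adaptive algorithm driven by the
profit with work. -/
def adaptiveApprox {d : ℕ} {D : Set (EuclideanSpace ℝ (Fin d))} (α β : Fin N → ℝ)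
    (a₀ : EuclideanSpace ℝ (Fin d) → ℝ) (a : Fin N → EuclideanSpace ℝ (Fin d) → ℝ)
    (u : (Fin N → ℝ) → H10 ℝ D) (ℓ : ℕ) : (Fin N → ℝ) → H10 ℝ D :=
  sparseInterp α β (indexSet (profitWithWork (estimator α β a₀ a u)) ℓ) u

end SparseGrid

end

open SparseGrid

open MeasureTheory
open SparseGrid

namespace SparseGrid

/-! ### Clenshaw-Curtis interpolation on `[-1, 1]` -/

/-! Write `G = ∇u` and let `a` act on gradient fields by multiplication. The Clenshaw-Curtis nodes
are nested, and each level has at least one node more than the previous one. So, with respect to the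
splitting into hierarchical surpluses, multiplication by `y_n` is block bidiagonal: block `i`
reaches only the blocks `i` and `i + e_n` (`surplus_mulCoord_surplus_eq_zero`). For downward-closed
`I` this has two consequences: `a S_I G` is reproduced by interpolation on `I` together with its
margin, and `S_I (a S_I G) = S_I (a G)`.

Reliability follows. Fix `y` and test with the error `w` at `y`. By the weak formulation the pairing
of `a G` with `w` does not depend on the parameter, so `S_I` preserves it. What remains of the
pairing of `a (G - S_I G)` with `w` is minus the sum of the margin surpluses of `a S_I G`, and
coercivity bounds the error by the sum of the estimators over the margin
(`norm_sub_sparseInterp_le`).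

The estimators decay because the off-diagonal block at level `i` is the commutator of `y_n` with
interpolation at level `i` (`detail_succ_mulCoord_detail`). This commutator annihilates polynomials
of degree below `m i - 1`, so a truncated Chebyshev expansion on a Bernstein ellipse makes it of
order `i exp(-σ m(i))` (`norm_sum_basis_sub_node_le`, `exists_commutator_bound`). The other
variables cost only powers of the level, since the Lebesgue constants grow linearly in the level
(`sum_abs_eval_basis_node_le`).

The algorithm enters through a pigeonhole argument. Since `I_ℓ` has at least `ℓ` elements, an entry
`J` must have appeared if `(J-1)^N < ℓ`. At the step where it first appears, all added indices carry
`J` in the same place (`exists_first_step`), so their estimators are small while their works are at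
least `2^J / 4`. The maximal profit is therefore small, and since works in the margin are at most
`2^((J-1)N)`, every estimator in the margin is small at that step (`sum_margin_le`). Thus the error
is small at some step not after `ℓ`. Passing to step `ℓ` costs only a Lebesgue constant polynomial
in `ℓ`, because `S_{I'} S_I = S_I` for `I ⊆ I'` (`norm_grad_error_le_of_subset`). The choice `J =
⌈ℓ^(1/N)⌉` gives the rate; `m J ≤ 2 m (J-1) + 1` is what turns `σ` into `σ/2` (`exists_level`).

The holomorphic extension exists because coercivity survives small complex perturbations of the
parameters, and inversion of operators is holomorphic (`exists_holomorphic_solution`). -/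

/-- The kernel of even trigonometric interpolation at `2 n` equispaced points. -/
noncomputable def trigKernel (n : ℕ) (t : ℝ) : ℝ :=
  (∑ k ∈ Finset.range n, (Real.cos (k * t) + Real.cos ((k + 1 : ℕ) * t))) / (2 * n)

/-- Multiplication by `sin (t/2)` makes the cosine sum telescope. The product form stays meaningful
where `sin (t/2)` vanishes. -/
theorem trigKernel_mul_sin {n : ℕ} (hn : n ≠ 0) (t : ℝ) :
    trigKernel n t * (2 * n * Real.sin (t / 2)) = Real.cos (t / 2) * Real.sin (n * t) := by
  have h : ∀ N : ℕ, (∑ k ∈ Finset.range N, (Real.cos (k * t) + Real.cos ((k + 1 : ℕ) * t)))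
      * Real.sin (t / 2) = Real.cos (t / 2) * Real.sin (N * t) := by
    intro N
    induction N with
    | zero => simp
    | succ N ih =>
      rw [Finset.sum_range_succ, add_mul, ih]
      have e1 : ((N : ℕ) : ℝ) * t = (N + 1 / 2 : ℝ) * t - t / 2 := by ring
      have e2 : ((N + 1 : ℕ) : ℝ) * t = (N + 1 / 2 : ℝ) * t + t / 2 := by push_cast; ring
      rw [e1, e2, Real.cos_sub, Real.cos_add, Real.sin_sub, Real.sin_add]
      ring
  have hn' : (n : ℝ) ≠ 0 := Nat.cast_ne_zero.2 hn
  rw [← h n, trigKernel, div_mul_eq_mul_div, div_eq_iff (by positivity)]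
  ring

theorem abs_trigKernel_le_one {n : ℕ} (t : ℝ) : |trigKernel n t| ≤ 1 := by
  rcases Nat.eq_zero_or_pos n with rfl | hn
  · simp [trigKernel]
  have hn' : (0 : ℝ) < n := Nat.cast_pos.2 hn
  rw [trigKernel, abs_div, abs_of_pos (by positivity : (0 : ℝ) < 2 * n), div_le_one (by positivity)]
  refine (Finset.abs_sum_le_sum_abs _ _).trans ?_
  calc _ ≤ ∑ _k ∈ Finset.range n, (2 : ℝ) := by
        refine Finset.sum_le_sum fun k _ => (abs_add_le _ _).trans ?_
        have := Real.abs_cos_le_one (k * t)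
        have := Real.abs_cos_le_one ((k + 1 : ℕ) * t)
        linarith
    _ = 2 * n := by simp [mul_comm]

/-- The closed form gives `1/(2x)` for `x ≥ 1`, and `x = 0` is the trivial bound. The weaker
`1/(x+1)` covers both and sums to a harmonic number. -/
theorem abs_trigKernel_le {n : ℕ} (hn : n ≠ 0) {t : ℝ} {x : ℕ}
    (hx : (x : ℝ) / n ≤ |Real.sin (t / 2)|) : |trigKernel n t| ≤ 1 / (x + 1) := by
  rcases Nat.eq_zero_or_pos x with rfl | hx0
  · simpa using abs_trigKernel_le_one t
  have hn' : (0 : ℝ) < n := Nat.cast_pos.2 (Nat.pos_of_ne_zero hn)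
  have hx1 : (1 : ℝ) ≤ x := by exact_mod_cast hx0
  have h := congrArg abs (trigKernel_mul_sin hn t)
  rw [abs_mul, abs_mul (2 * (n : ℝ)), abs_mul (Real.cos _),
    abs_of_pos (by positivity : (0 : ℝ) < 2 * n)] at h
  have h1 : |Real.cos (t / 2)| * |Real.sin (n * t)| ≤ 1 :=
    mul_le_one₀ (Real.abs_cos_le_one _) (abs_nonneg _) (Real.abs_sin_le_one _)
  rw [div_le_iff₀ hn'] at hx
  rw [le_div_iff₀ (by positivity)]
  have h2 : |trigKernel n t| * (2 * x) ≤ 1 := by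
    calc |trigKernel n t| * (2 * x) ≤ |trigKernel n t| * (2 * (|Real.sin (t / 2)| * n)) := by gcongr
      _ = |trigKernel n t| * (2 * n * |Real.sin (t / 2)|) := by ring
      _ ≤ 1 := h ▸ h1
  have h3 : |trigKernel n t| * (x + 1) ≤ |trigKernel n t| * (2 * x) := by
    gcongr; linarith
  exact h3.trans h2

theorem trigKernel_zero {n : ℕ} (hn : n ≠ 0) : trigKernel n 0 = 1 := by
  have hn' : (n : ℝ) ≠ 0 := Nat.cast_ne_zero.2 hn
  simp [trigKernel]
  field_simp; norm_num

theorem trigKernel_two_pi {n : ℕ} (hn : n ≠ 0) : trigKernel n (2 * Real.pi) = 1 := by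
  have hn' : (n : ℝ) ≠ 0 := Nat.cast_ne_zero.2 hn
  simp only [trigKernel, Real.cos_nat_mul_two_pi]
  simp
  field_simp; norm_num

theorem trigKernel_eq_zero {n : ℕ} (hn : n ≠ 0) {l : ℤ} (h0 : l ≠ 0) (h1 : |l| < 2 * n) :
    trigKernel n (Real.pi * l / n) = 0 := by
  have hn' : (0 : ℝ) < n := Nat.cast_pos.2 (Nat.pos_of_ne_zero hn)
  have h := trigKernel_mul_sin hn (Real.pi * l / n)
  have e : (n : ℝ) * (Real.pi * l / n) = l * Real.pi := by field_simp
  rw [e, Real.sin_int_mul_pi, mul_zero] at h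
  rcases mul_eq_zero.1 h with h | h
  · exact h
  exfalso
  have hs : Real.sin (Real.pi * l / n / 2) = 0 := by
    rcases mul_eq_zero.1 h with h | h
    · exact absurd h (by positivity)
    · exact h
  rw [Real.sin_eq_zero_iff] at hs
  obtain ⟨k, hk⟩ := hs
  have hk' : (l : ℝ) = 2 * n * k := by
    have := Real.pi_pos.ne'
    field_simp at hk
    linarith
  have hk'' : l = 2 * n * k := by exact_mod_cast hk'
  have hk0 : k ≠ 0 := by rintro rfl; simp at hk''; exact h0 hk''
  have : (1 : ℤ) ≤ |k| := Int.one_le_abs hk0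
  rw [hk'', abs_mul, abs_of_nonneg (by positivity : (0 : ℤ) ≤ 2 * n)] at h1
  nlinarith

/-- The angle of the `j`-th Clenshaw-Curtis node. -/
noncomputable def ccAngle (n j : ℕ) : ℝ := Real.pi * j / n

theorem ccNode_succ {n : ℕ} (hn : n ≠ 0) (j : Fin (n + 1)) :
    ccNode (n + 1) j = -Real.cos (ccAngle n j) := by
  simp [ccNode, ccAngle, hn]

theorem ccAngle_mem {n : ℕ} {j : ℕ} (hj : j ≤ n) : ccAngle n j ∈ Set.Icc 0 Real.pi := by
  have hp := Real.pi_pos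
  rcases Nat.eq_zero_or_pos n with rfl | hn
  · simp [ccAngle, hp.le]
  have hn' : (0 : ℝ) < n := Nat.cast_pos.2 hn
  refine ⟨by unfold ccAngle; positivity, ?_⟩
  rw [ccAngle, div_le_iff₀ hn']
  gcongr

theorem ccNode_mem (k : ℕ) (j : Fin k) : ccNode k j ∈ Set.Icc (-1 : ℝ) 1 := by
  unfold ccNode
  split_ifs
  · simp
  · have h1 := Real.neg_one_le_cos (Real.pi * j / ((k : ℝ) - 1))
    have h2 := Real.cos_le_one (Real.pi * j / ((k : ℝ) - 1))
    constructor <;> linarith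

theorem ccNode_injective (k : ℕ) : Function.Injective (ccNode k) := by
  rcases k with _ | _ | n
  · intro i; exact i.elim0
  · intro i j _; exact Subsingleton.elim (α := Fin 1) _ _
  intro i j h
  have hn : n + 1 ≠ 0 := by omega
  rw [ccNode_succ hn, ccNode_succ hn, neg_inj] at h
  have h2 := Real.injOn_cos (ccAngle_mem (Nat.lt_succ_iff.1 i.2)) (ccAngle_mem (Nat.lt_succ_iff.1 j.2)) h
  have hn' : ((n + 1 : ℕ) : ℝ) ≠ 0 := Nat.cast_ne_zero.2 hn
  have hp := Real.pi_pos.ne'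
  unfold ccAngle at h2
  field_simp at h2
  exact Fin.ext (by exact_mod_cast h2)

open Polynomial in
/-- The Lagrange polynomials of the Clenshaw-Curtis nodes in the Chebyshev basis. -/
noncomputable def ccPoly (n j : ℕ) : ℝ[X] :=
  ∑ k ∈ Finset.range n,
    (C (Real.cos (k * ccAngle n j) / n) * (Chebyshev.T ℝ (k : ℤ)).comp (-X) +
    C (Real.cos ((k + 1 : ℕ) * ccAngle n j) / n) * (Chebyshev.T ℝ ((k + 1 : ℕ) : ℤ)).comp (-X))

/-- By product-to-sum, each `cos(kθ_j) cos(kθ)` is the mean of the cosines at `θ - θ_j` and `θ +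
θ_j`. The argument `-X` accounts for nodes being negated cosines. -/
theorem eval_ccPoly (n j : ℕ) (θ : ℝ) : (ccPoly n j).eval (-Real.cos θ) =
    trigKernel n (θ - ccAngle n j) + trigKernel n (θ + ccAngle n j) := by
  have h : ∀ k : ℕ, (Polynomial.Chebyshev.T ℝ (k : ℤ)).eval (Real.cos θ) = Real.cos (k * θ) := by
    intro k
    simp [Polynomial.Chebyshev.T_real_cos]
  simp only [ccPoly, Polynomial.eval_finsetSum, Polynomial.eval_add, Polynomial.eval_mul,
    Polynomial.eval_C, Polynomial.eval_comp, Polynomial.eval_neg, Polynomial.eval_X, neg_neg,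
    h, trigKernel]
  rw [← add_div, ← Finset.sum_add_distrib, Finset.sum_div]
  refine Finset.sum_congr rfl fun k _ => ?_
  rw [mul_sub, mul_add, mul_sub, mul_add, Real.cos_sub, Real.cos_add, Real.cos_sub, Real.cos_add]
  rcases eq_or_ne n 0 with rfl | hn
  · simp
  have hn' : (n : ℝ) ≠ 0 := Nat.cast_ne_zero.2 hn
  field_simp
  ring

theorem degree_ccPoly_lt (n j : ℕ) : (ccPoly n j).degree < (n + 1 : ℕ) := by
  have hT : ∀ (k : ℕ) (c : ℝ), k ≤ n →
      (Polynomial.C c * (Polynomial.Chebyshev.T ℝ (k : ℤ)).comp (-Polynomial.X)).degree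
        < (n + 1 : ℕ) := by
    intro k c hk
    refine lt_of_le_of_lt Polynomial.degree_le_natDegree (Nat.cast_lt.2 ?_)
    refine lt_of_le_of_lt (Polynomial.natDegree_C_mul_le _ _) ?_
    rw [Polynomial.natDegree_comp, Polynomial.Chebyshev.natDegree_T]
    simp; omega
  refine lt_of_le_of_lt (Polynomial.degree_sum_le _ _) ?_
  rw [Finset.sup_lt_iff (WithBot.bot_lt_coe _)]
  intro k hk
  have hk' := Finset.mem_range.1 hk
  exact lt_of_le_of_lt (Polynomial.degree_add_le _ _)
    (max_lt (hT k _ hk'.le) (hT (k + 1) _ hk'))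

theorem eval_ccPoly_node_ne {n : ℕ} (hn : n ≠ 0) {i j : ℕ} (hi : i ≤ n) (hj : j ≤ n)
    (hij : i ≠ j) : (ccPoly n j).eval (-Real.cos (ccAngle n i)) = 0 := by
  rw [eval_ccPoly]
  have e1 : ccAngle n i - ccAngle n j = Real.pi * ((i - j : ℤ) : ℝ) / n := by
    unfold ccAngle; push_cast; ring
  have e2 : ccAngle n i + ccAngle n j = Real.pi * ((i + j : ℤ) : ℝ) / n := by
    unfold ccAngle; push_cast; ring
  rw [e1, e2, trigKernel_eq_zero hn, trigKernel_eq_zero hn, add_zero]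
  · omega
  · rw [abs_lt]; omega
  · omega
  · rw [abs_lt]; omega

/-- Only an inequality holds: the value is `1` at interior nodes, but `2` at the two endpoints,
where both kernels equal `1`. -/
theorem one_le_eval_ccPoly_node {n : ℕ} (hn : n ≠ 0) {j : ℕ} (hj : j ≤ n) :
    1 ≤ (ccPoly n j).eval (-Real.cos (ccAngle n j)) := by
  rw [eval_ccPoly, sub_self, trigKernel_zero hn]
  have e2 : ccAngle n j + ccAngle n j = Real.pi * ((2 * j : ℤ) : ℝ) / n := by
    unfold ccAngle; push_cast; ring
  have hn' : (n : ℝ) ≠ 0 := Nat.cast_ne_zero.2 hn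
  have : 0 ≤ trigKernel n (ccAngle n j + ccAngle n j) := by
    rcases Nat.eq_zero_or_pos j with rfl | hj0
    · simp [ccAngle, trigKernel_zero hn]
    rcases hj.eq_or_lt with rfl | hj1
    · have : ccAngle j j + ccAngle j j = 2 * Real.pi := by
        unfold ccAngle; field_simp; norm_num
      rw [this, trigKernel_two_pi hn]; norm_num
    · rw [e2, trigKernel_eq_zero hn]
      · omega
      · rw [abs_lt]; omega
  linarith

/-- `ccPoly n j` has the degree bound and the zeros of the Lagrange polynomial, so it is a multiple
of it by its value at the `j`-th node. As that value is at least `1`, the Lagrange polynomial is the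
smaller of the two. -/
theorem abs_eval_basis_ccNode_le {n : ℕ} (hn : n ≠ 0) (j : Fin (n + 1)) (θ : ℝ) :
    |(Lagrange.basis Finset.univ (ccNode (n + 1)) j).eval (-Real.cos θ)| ≤
      |trigKernel n (θ - ccAngle n j)| + |trigKernel n (θ + ccAngle n j)| := by
  have hj : (j : ℕ) ≤ n := Nat.lt_succ_iff.1 j.2
  set c := (ccPoly n j).eval (-Real.cos (ccAngle n j)) with hc
  have hc1 : 1 ≤ c := one_le_eval_ccPoly_node hn hj
  have hinj : Set.InjOn (ccNode (n + 1)) (Finset.univ : Finset (Fin (n + 1))) :=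
    (ccNode_injective _).injOn
  have key : ccPoly n j = Polynomial.C c * Lagrange.basis Finset.univ (ccNode (n + 1)) j := by
    refine Polynomial.eq_of_degrees_lt_of_eval_index_eq (v := ccNode (n + 1)) Finset.univ hinj
      ?_ ?_ ?_
    · simpa using degree_ccPoly_lt n j
    · rw [Polynomial.degree_C_mul (zero_lt_one.trans_le hc1).ne', Lagrange.degree_basis hinj (Finset.mem_univ _)]
      simpa using Nat.cast_lt.2 (Nat.lt_succ_self n)
    · intro i _
      rw [Polynomial.eval_mul, Polynomial.eval_C]
      by_cases hij : i = j
      · subst hij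
        rw [Lagrange.eval_basis_self hinj (Finset.mem_univ _), mul_one, ccNode_succ hn, hc]
      · rw [Lagrange.eval_basis_of_ne (Ne.symm hij) (Finset.mem_univ _), mul_zero, ccNode_succ hn]
        exact eval_ccPoly_node_ne hn (Nat.lt_succ_iff.1 i.2) hj (fun h => hij (Fin.ext h))
  have h2 := congrArg (fun P => |Polynomial.eval (-Real.cos θ) P|) key
  simp only [Polynomial.eval_mul, Polynomial.eval_C, abs_mul] at h2
  rw [eval_ccPoly, abs_of_nonneg (zero_le_one.trans hc1)] at h2
  have := abs_add_le (trigKernel n (θ - ccAngle n j)) (trigKernel n (θ + ccAngle n j))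
  have h3 := abs_nonneg (Polynomial.eval (-Real.cos θ) (Lagrange.basis Finset.univ (ccNode (n + 1)) j))
  nlinarith

theorem div_pi_le_abs_sin_half {t : ℝ} (ht : |t| ≤ Real.pi) : |t| / Real.pi ≤ |Real.sin (t / 2)| := by
  have hp := Real.pi_pos
  have h := Real.mul_le_sin (x := |t| / 2) (by positivity) (by linarith)
  have h1 : |Real.sin (t / 2)| = Real.sin (|t| / 2) := by
    rcases abs_cases t with ⟨h1, h2⟩ | ⟨h1, h2⟩
    · rw [h1, abs_of_nonneg (Real.sin_nonneg_of_nonneg_of_le_pi (by linarith) (by linarith))]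
    · rw [h1, neg_div, Real.sin_neg, abs_of_nonpos]
      refine Real.sin_nonpos_of_nonpos_of_neg_pi_le (by linarith) (by linarith)
  rw [h1]
  refine le_trans (le_of_eq ?_) h
  field_simp

theorem sum_abs_eval_basis_ccNode_le {n : ℕ} (hn : n ≠ 0) {y : ℝ} (hy : y ∈ Set.Icc (-1 : ℝ) 1) :
    ∑ j, |(Lagrange.basis Finset.univ (ccNode (n + 1)) j).eval y| ≤
      4 * ∑ k ∈ Finset.range (n + 1), 1 / ((k : ℝ) + 1) := by
  have hp := Real.pi_pos
  have hn' : (0 : ℝ) < n := Nat.cast_pos.2 (Nat.pos_of_ne_zero hn)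
  obtain ⟨θ, hθ0, hθ1, rfl⟩ : ∃ θ, 0 ≤ θ ∧ θ ≤ Real.pi ∧ y = -Real.cos θ :=
    ⟨Real.arccos (-y), Real.arccos_nonneg _, Real.arccos_le_pi _, by
      rw [Real.cos_arccos (by linarith [hy.2]) (by linarith [hy.1]), neg_neg]⟩
  set H := ∑ k ∈ Finset.range (n + 1), 1 / ((k : ℝ) + 1) with hH
  have hsub : ∀ s ≤ n + 1, ∑ k ∈ Finset.range s, 1 / ((k : ℝ) + 1) ≤ H := fun s hs =>
    Finset.sum_le_sum_of_subset_of_nonneg (Finset.range_mono hs) fun _ _ _ => by positivity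
  refine (Finset.sum_le_sum fun j _ => abs_eval_basis_ccNode_le hn j θ).trans ?_
  rw [Finset.sum_add_distrib,
    Fin.sum_univ_eq_sum_range (fun j => |trigKernel n (θ - ccAngle n j)|) (n + 1),
    Fin.sum_univ_eq_sum_range (fun j => |trigKernel n (θ + ccAngle n j)|) (n + 1)]
  have h1 : ∑ j ∈ Finset.range (n + 1), |trigKernel n (θ - ccAngle n j)| ≤ 2 * H := by
    -- `l` is the last node whose angle does not exceed `θ`. Counting outwards from `θ`, the `k`-th
    -- node on either side is at least `kπ/n` away, so each side contributes at most a harmonic sum.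
    set l := ⌊n * θ / Real.pi⌋₊ with hl
    have hl0 : (l : ℝ) ≤ n * θ / Real.pi := Nat.floor_le (by positivity)
    have hl1 : n * θ / Real.pi < l + 1 := Nat.lt_floor_add_one _
    have hln : l ≤ n := by
      have : (l : ℝ) ≤ n := hl0.trans (by rw [div_le_iff₀ hp]; gcongr)
      exact_mod_cast this
    have habs : ∀ j ≤ n, |θ - ccAngle n j| ≤ Real.pi := fun j hj => by
      have := ccAngle_mem hj
      rw [abs_le]; constructor <;> linarith [this.1, this.2]
    have hscale : ∀ j, (θ - ccAngle n j) / Real.pi = (n * θ / Real.pi - j) / n := by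
      intro j; unfold ccAngle; field_simp
    obtain ⟨r, hr⟩ : ∃ r, n + 1 = (l + 1) + r := ⟨n - l, by omega⟩
    rw [hr, Finset.sum_range_add, two_mul]
    refine add_le_add ?_ ?_
    · refine le_trans ?_ (hsub (l + 1) (by omega))
      rw [← Finset.sum_range_reflect]
      refine Finset.sum_le_sum fun k hk => ?_
      have hk' := Finset.mem_range.1 hk
      have hkl : l + 1 - 1 - k = l - k := by omega
      rw [hkl]
      refine abs_trigKernel_le hn (le_trans ?_ (div_pi_le_abs_sin_half (habs _ (by omega))))
      have : (k : ℝ) / n ≤ (θ - ccAngle n (l - k)) / Real.pi := by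
        rw [hscale]
        gcongr
        rw [Nat.cast_sub (by omega)]
        linarith
      refine this.trans ?_
      gcongr
      exact le_abs_self _
    · refine le_trans ?_ (hsub r (by omega))
      refine Finset.sum_le_sum fun k hk => ?_
      have hk' := Finset.mem_range.1 hk
      refine abs_trigKernel_le hn (le_trans ?_ (div_pi_le_abs_sin_half (habs _ (by omega))))
      have : (k : ℝ) / n ≤ -(θ - ccAngle n (l + 1 + k)) / Real.pi := by
        rw [neg_div, hscale, ← neg_div]
        gcongr
        push_cast
        linarith
      refine this.trans ?_
      gcongr
      exact neg_le_abs _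
  have h2 : ∑ j ∈ Finset.range (n + 1), |trigKernel n (θ + ccAngle n j)| ≤ 2 * H := by
    -- The kernel can peak only at `0` or `2π`. Below `π` the distance to `0` is at least `jπ/n`;
    -- above `π` the distance to `2π` is at least `(n-j)π/n`.
    have : ∀ j ∈ Finset.range (n + 1), |trigKernel n (θ + ccAngle n j)| ≤
        1 / ((j : ℝ) + 1) + 1 / (((n + 1 - 1 - j : ℕ) : ℝ) + 1) := by
      intro j hj
      have hjn : j ≤ n := Nat.lt_succ_iff.1 (Finset.mem_range.1 hj)
      have hc := ccAngle_mem hjn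
      have hcp : ccAngle n j / Real.pi = j / n := by unfold ccAngle; field_simp
      rcases le_total (θ + ccAngle n j) Real.pi with h | h
      · refine (abs_trigKernel_le (x := j) hn ?_).trans (le_add_of_nonneg_right (by positivity))
        have h0 : 0 ≤ θ + ccAngle n j := by linarith [hc.1]
        refine le_trans ?_ (div_pi_le_abs_sin_half (by rwa [abs_of_nonneg h0]))
        rw [abs_of_nonneg h0, ← hcp]
        gcongr; linarith
      · refine (abs_trigKernel_le (x := n + 1 - 1 - j) hn ?_).trans
          (le_add_of_nonneg_left (by positivity))
        have h0 : 0 ≤ 2 * Real.pi - (θ + ccAngle n j) := by linarith [hc.2]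
        have e : |Real.sin ((θ + ccAngle n j) / 2)| =
            |Real.sin ((2 * Real.pi - (θ + ccAngle n j)) / 2)| := by
          rw [← Real.sin_pi_sub]; congr 2; ring
        rw [e]
        refine le_trans ?_ (div_pi_le_abs_sin_half (by rw [abs_of_nonneg h0]; linarith))
        rw [abs_of_nonneg h0, Nat.add_sub_cancel, Nat.cast_sub hjn, sub_div, ← hcp,
          div_self hn'.ne', ← div_self hp.ne', ← sub_div]
        exact div_le_div_of_nonneg_right (by linarith) hp.le
    refine (Finset.sum_le_sum this).trans ?_
    rw [Finset.sum_add_distrib, Finset.sum_range_reflect (fun k : ℕ => 1 / ((k : ℝ) + 1)), two_mul]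
  linarith

/-- The Lebesgue constant is logarithmic in the number of nodes, and that number doubles with the
level, so the bound is linear in the level. -/
theorem sum_abs_eval_basis_ccNode_m_le (i : ℕ) {y : ℝ} (hy : y ∈ Set.Icc (-1 : ℝ) 1) :
    ∑ j, |(Lagrange.basis Finset.univ (ccNode (m i)) j).eval y| ≤ 8 * i := by
  rcases i with _ | _ | i
  · exact (Finset.sum_eq_zero fun j _ => j.elim0).trans_le (by simp)
  · have h1 : m (0 + 1) = 1 := rfl
    rw [h1, Fin.sum_univ_one, show (Finset.univ : Finset (Fin 1)) = {0} from rfl, Lagrange.basis_singleton]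
    norm_num
  have hm : m (i + 2) = 2 ^ (i + 1) + 1 := by simp [m]
  rw [hm]
  refine (sum_abs_eval_basis_ccNode_le (by positivity) hy).trans ?_
  have h := harmonic_le_one_add_log (2 ^ (i + 1) + 1)
  have e : ((harmonic (2 ^ (i + 1) + 1) : ℚ) : ℝ) =
      ∑ k ∈ Finset.range (2 ^ (i + 1) + 1), 1 / ((k : ℝ) + 1) := by
    simp [harmonic]
  rw [e] at h
  have h2 : Real.log ((2 ^ (i + 1) + 1 : ℕ) : ℝ) ≤ i + 2 := by
    have : Real.log ((2 ^ (i + 1) + 1 : ℕ) : ℝ) ≤ Real.log (2 ^ (i + 2)) := by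
      refine Real.log_le_log (by positivity) ?_
      have : 2 ^ (i + 1) + 1 ≤ 2 ^ (i + 2) := by
        have := Nat.one_le_two_pow (n := i + 1)
        rw [pow_succ 2 (i + 1)]; omega
      exact_mod_cast this
    refine this.trans ?_
    rw [Real.log_pow]
    have : Real.log 2 ≤ 1 := by linarith [Real.log_two_lt_d9]
    push_cast
    nlinarith
  push_cast at *
  linarith

/-! ### Transport to a general interval and nestedness of the nodes. -/

theorem basis_node_eq {p q : ℝ} (hpq : p < q) (k : ℕ) (j : Fin k) (t : ℝ) :
    (Lagrange.basis Finset.univ (node p q k) j).eval ((p + q) / 2 + (q - p) / 2 * t) =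
      (Lagrange.basis Finset.univ (ccNode k) j).eval t := by
  have h : (q - p) / 2 ≠ 0 := by
    have : 0 < (q - p) / 2 := by linarith
    exact this.ne'
  simp only [Lagrange.basis, Polynomial.eval_prod, Lagrange.basisDivisor, Polynomial.eval_mul,
    Polynomial.eval_C, Polynomial.eval_sub, Polynomial.eval_X, node, add_sub_add_left_eq_sub,
    ← mul_sub]
  refine Finset.prod_congr rfl fun i _ => ?_
  rw [mul_inv, mul_mul_mul_comm, inv_mul_cancel₀ h, one_mul]

theorem exists_affine_coord {p q : ℝ} (hpq : p < q) {y : ℝ} (hy : y ∈ Set.Icc p q) :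
    ∃ t ∈ Set.Icc (-1 : ℝ) 1, y = (p + q) / 2 + (q - p) / 2 * t := by
  have h : 0 < q - p := by linarith
  refine ⟨(2 * y - (p + q)) / (q - p), ⟨?_, ?_⟩, ?_⟩
  · rw [le_div_iff₀ h]; linarith [hy.1]
  · rw [div_le_iff₀ h]; linarith [hy.2]
  · field_simp; ring

theorem sum_abs_eval_basis_node_le {p q : ℝ} (hpq : p < q) (i : ℕ) {y : ℝ}
    (hy : y ∈ Set.Icc p q) :
    ∑ j, |(Lagrange.basis Finset.univ (node p q (m i)) j).eval y| ≤ 8 * i := by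
  obtain ⟨t, ht, rfl⟩ := exists_affine_coord hpq hy
  simp only [basis_node_eq hpq]
  exact sum_abs_eval_basis_ccNode_m_le i ht

theorem node_mem {p q : ℝ} (hpq : p ≤ q) (k : ℕ) (j : Fin k) : node p q k j ∈ Set.Icc p q := by
  have h := ccNode_mem k j
  unfold node
  constructor <;> nlinarith [h.1, h.2]

theorem node_injective {p q : ℝ} (hpq : p < q) (k : ℕ) : Function.Injective (node p q k) := by
  intro i j h
  have : (q - p) / 2 ≠ 0 := by
    have : 0 < (q - p) / 2 := by linarith
    exact this.ne'
  exact ccNode_injective k (mul_left_cancel₀ this (add_left_cancel h))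

/-- Doubling the number of subintervals sends index `j` to `2j`. The single node of level `1` is the
middle one of the three nodes of level `2`. -/
theorem exists_node_succ (p q : ℝ) (i : ℕ) (j : Fin (m i)) :
    ∃ j' : Fin (m (i + 1)), node p q (m (i + 1)) j' = node p q (m i) j := by
  suffices h : ∃ j' : Fin (m (i + 1)), ccNode (m (i + 1)) j' = ccNode (m i) j by
    obtain ⟨j', h⟩ := h
    exact ⟨j', by rw [node, node, h]⟩
  rcases i with _ | _ | i
  · exact j.elim0
  · refine ⟨⟨1, by decide⟩, ?_⟩
    have : m (0 + 1 + 1) = 3 := rfl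
    have h1 : m (0 + 1) = 1 := rfl
    simp only [ccNode, this, h1]
    norm_num
  · have h1 : m (i + 1 + 1) = 2 ^ (i + 1) + 1 := rfl
    have h2 : m (i + 1 + 1 + 1) = 2 ^ (i + 2) + 1 := rfl
    have hj : (j : ℕ) < 2 ^ (i + 1) + 1 := h1 ▸ j.2
    refine ⟨⟨2 * j, ?_⟩, ?_⟩
    · rw [h2, pow_succ 2 (i + 1)]; omega
    · simp only [ccNode, h1, h2]
      rw [if_neg (by simp), if_neg (by simp)]
      push_cast
      have : (2 : ℝ) ^ (i + 2) = 2 * 2 ^ (i + 1) := by ring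
      rw [add_sub_cancel_right, add_sub_cancel_right, this]
      congr 2
      rw [mul_left_comm, mul_div_mul_left _ _ two_ne_zero]

theorem exists_node_of_le (p q : ℝ) {i i' : ℕ} (h : i ≤ i') (j : Fin (m i)) :
    ∃ j' : Fin (m i'), node p q (m i') j' = node p q (m i) j := by
  induction i', h using Nat.le_induction with
  | base => exact ⟨j, rfl⟩
  | succ k _ ih =>
    obtain ⟨j', hj'⟩ := ih
    obtain ⟨j'', hj''⟩ := exists_node_succ p q k j'
    exact ⟨j'', hj''.trans hj'⟩

theorem m_succ_le (i : ℕ) : m i + 1 ≤ m (i + 1) := by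
  rcases i with _ | _ | i
  · decide
  · decide
  · have h1 : m (i + 1 + 1) = 2 ^ (i + 1) + 1 := rfl
    have h2 : m (i + 1 + 1 + 1) = 2 ^ (i + 2) + 1 := rfl
    have := Nat.one_le_two_pow (n := i + 1)
    rw [h1, h2, pow_succ 2 (i + 1)]; omega

theorem m_mono : StrictMono m := strictMono_nat_of_lt_succ fun i => m_succ_le i

end SparseGrid

namespace SparseGrid

/-! ### Algebra of the univariate operators -/

theorem sum_basis_node_eval {p q : ℝ} (hpq : p < q) {k : ℕ} {P : Polynomial ℝ} (hP : P.degree < k)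
    (t : ℝ) :
    ∑ j, (Lagrange.basis Finset.univ (node p q k) j).eval t * P.eval (node p q k j) = P.eval t := by
  have h := Lagrange.eq_interpolate (s := Finset.univ) (v := node p q k)
    (node_injective hpq k).injOn (f := P) (by simpa using hP)
  conv_rhs => rw [h, Lagrange.interpolate_apply, Polynomial.eval_finsetSum]
  exact Finset.sum_congr rfl fun j _ => by rw [Polynomial.eval_mul, Polynomial.eval_C, mul_comm]

theorem degree_basis_node_lt {p q : ℝ} (hpq : p < q) {k : ℕ} (j : Fin k) :
    (Lagrange.basis Finset.univ (node p q k) j).degree < k := by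
  rw [Lagrange.degree_basis (node_injective hpq k).injOn (Finset.mem_univ _)]
  have := j.2
  rw [Finset.card_univ, Fintype.card_fin]
  exact_mod_cast (by omega : k - 1 < k)

section Operators

variable {N : ℕ} {E : Type*} [AddCommGroup E] [Module ℝ E] {α β : Fin N → ℝ}

theorem interp_apply (n : Fin N) (k : ℕ) (g : (Fin N → ℝ) → E) (y : Fin N → ℝ) :
    interp α β n k g y = ∑ j : Fin k,
      (Lagrange.basis Finset.univ (node (α n) (β n) k) j).eval (y n) •
        g (Function.update y n (node (α n) (β n) k j)) := rfl

theorem interp_apply_node (h : ∀ n, α n < β n) (n : Fin N) {k : ℕ} (g : (Fin N → ℝ) → E)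
    {y : Fin N → ℝ} {j : Fin k} (hy : y n = node (α n) (β n) k j) : interp α β n k g y = g y := by
  have hinj := node_injective (h n) k
  rw [interp_apply, Finset.sum_eq_single j, hy, Lagrange.eval_basis_self hinj.injOn
    (Finset.mem_univ _), one_smul, ← hy, Function.update_eq_self]
  · intro l _ hl
    rw [hy, Lagrange.eval_basis_of_ne hl (Finset.mem_univ _), zero_smul]
  · exact fun hj => absurd (Finset.mem_univ _) hj

/-- Multiplication of a function by its `n`-th variable. -/
noncomputable def mulCoord (n : Fin N) : Module.End ℝ ((Fin N → ℝ) → E) where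
  toFun g y := y n • g y
  map_add' g h := by funext y; simp
  map_smul' c g := by
    funext y
    exact smul_comm _ _ _

theorem mulCoord_apply (n : Fin N) (g : (Fin N → ℝ) → E) (y : Fin N → ℝ) :
    mulCoord n g y = y n • g y := rfl

variable (α β) in
/-- Interpolation at the `i`-th level in the `n`-th variable. -/
noncomputable abbrev levelInterp (n : Fin N) (i : ℕ) : Module.End ℝ ((Fin N → ℝ) → E) := interp α β n (m i)

theorem levelInterp_zero (n : Fin N) :
    (levelInterp α β n 0 : Module.End ℝ ((Fin N → ℝ) → E)) = 0 := by
  ext g y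
  rw [interp_apply]
  exact Finset.sum_eq_zero fun (j : Fin 0) _ => j.elim0

theorem detail_eq (n : Fin N) (i : ℕ) : (detail α β n i : Module.End ℝ ((Fin N → ℝ) → E)) =
    levelInterp α β n i - levelInterp α β n (i - 1) := rfl

/-- Nestedness: the coarse interpolant samples only at nodes where the fine one is exact. -/
theorem levelInterp_mul_of_le (h : ∀ n, α n < β n) (n : Fin N) {i j : ℕ} (hij : i ≤ j) :
    (levelInterp α β n i * levelInterp α β n j : Module.End ℝ ((Fin N → ℝ) → E)) =
      levelInterp α β n i := by
  ext g y
  rw [Module.End.mul_apply, interp_apply, interp_apply]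
  refine Finset.sum_congr rfl fun l _ => ?_
  obtain ⟨l', hl'⟩ := exists_node_of_le (α n) (β n) hij l
  rw [interp_apply_node h n (j := l') g (by rw [Function.update_self, hl'])]

theorem interp_interp_of_exact (h : ∀ n, α n < β n) (n : Fin N) {k l : ℕ}
    (P : Fin l → Polynomial ℝ) (hP : ∀ j, (P j).degree < k) (v : Fin l → ℝ)
    (g : (Fin N → ℝ) → E) (y : Fin N → ℝ) :
    interp α β n k (fun z => ∑ j, (P j).eval (z n) • g (Function.update z n (v j))) y =
      ∑ j, (P j).eval (y n) • g (Function.update y n (v j)) := by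
  rw [interp_apply]
  simp only [Function.update_self, Function.update_idem, Finset.smul_sum, smul_smul]
  rw [Finset.sum_comm]
  refine Finset.sum_congr rfl fun j _ => ?_
  rw [← Finset.sum_smul, sum_basis_node_eval (h n) (hP j)]

/-- Polynomial exactness: the coarse interpolant has low enough degree in `y_n` to be reproduced on
the fine grid. -/
theorem levelInterp_mul_of_ge (h : ∀ n, α n < β n) (n : Fin N) {i j : ℕ} (hij : j ≤ i) :
    (levelInterp α β n i * levelInterp α β n j : Module.End ℝ ((Fin N → ℝ) → E)) =
      levelInterp α β n j := by
  ext g y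
  exact interp_interp_of_exact h n _
    (fun l => (degree_basis_node_lt (h n) l).trans_le (Nat.cast_le.2 (m_mono.monotone hij))) _ g y

theorem levelInterp_mulCoord (h : ∀ n, α n < β n) (n : Fin N) {i j : ℕ} (hij : i ≤ j) :
    (levelInterp α β n i * mulCoord n * levelInterp α β n j : Module.End ℝ ((Fin N → ℝ) → E)) =
      levelInterp α β n i * mulCoord n := by
  ext g y
  rw [Module.End.mul_apply, Module.End.mul_apply, Module.End.mul_apply, interp_apply, interp_apply]
  refine Finset.sum_congr rfl fun l _ => ?_
  obtain ⟨l', hl'⟩ := exists_node_of_le (α n) (β n) hij l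
  rw [mulCoord_apply, mulCoord_apply,
    interp_apply_node h n (j := l') g (by rw [Function.update_self, hl'])]

/-- Multiplication by the variable raises the degree by one, and the next level has at least one
more node to absorb it. -/
theorem levelInterp_mulCoord_levelInterp (h : ∀ n, α n < β n) (n : Fin N) {i j : ℕ} (hij : i < j) :
    (levelInterp α β n j * (mulCoord n * levelInterp α β n i) :
      Module.End ℝ ((Fin N → ℝ) → E)) = mulCoord n * levelInterp α β n i := by
  ext g y
  have e : ∀ z : Fin N → ℝ, (mulCoord n * levelInterp α β n i : Module.End ℝ _) g z =
      ∑ l, (Polynomial.X * Lagrange.basis Finset.univ (node (α n) (β n) (m i)) l).eval (z n) •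
        g (Function.update z n (node (α n) (β n) (m i) l)) := by
    intro z
    rw [Module.End.mul_apply, mulCoord_apply, interp_apply, Finset.smul_sum]
    exact Finset.sum_congr rfl fun l _ => by
      rw [smul_smul, Polynomial.eval_mul, Polynomial.eval_X]
  rw [Module.End.mul_apply, funext e]
  refine interp_interp_of_exact h n _ (fun l => ?_) _ g y
  rw [mul_comm, Polynomial.degree_mul_X,
    Lagrange.degree_basis (node_injective (h n) _).injOn (Finset.mem_univ _), Finset.card_univ,
    Fintype.card_fin]
  have := m_mono hij
  have := l.2
  exact_mod_cast (by omega : m i - 1 + 1 < m j)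

theorem detail_mul_levelInterp (h : ∀ n, α n < β n) (n : Fin N) {i j : ℕ} (hij : i < j) :
    (detail α β n j * levelInterp α β n i : Module.End ℝ ((Fin N → ℝ) → E)) = 0 := by
  rw [detail, sub_mul, levelInterp_mul_of_ge h n hij.le, levelInterp_mul_of_ge h n (by omega),
    sub_self]

theorem levelInterp_mul_detail (h : ∀ n, α n < β n) (n : Fin N) {i j : ℕ} (hij : i < j) :
    (levelInterp α β n i * detail α β n j : Module.End ℝ ((Fin N → ℝ) → E)) = 0 := by
  rw [detail, mul_sub, levelInterp_mul_of_le h n hij.le, levelInterp_mul_of_le h n (by omega),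
    sub_self]

theorem levelInterp_mul_detail_of_ge (h : ∀ n, α n < β n) (n : Fin N) {i j : ℕ} (hij : j ≤ i) :
    (levelInterp α β n i * detail α β n j : Module.End ℝ ((Fin N → ℝ) → E)) = detail α β n j := by
  rw [detail, mul_sub, levelInterp_mul_of_ge h n hij, levelInterp_mul_of_ge h n (by omega)]

theorem detail_mul_detail_of_ne (h : ∀ n, α n < β n) (n : Fin N) {i j : ℕ} (hij : i ≠ j) :
    (detail α β n i * detail α β n j : Module.End ℝ ((Fin N → ℝ) → E)) = 0 := by
  rcases lt_or_gt_of_ne hij with hij | hij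
  · rw [detail, sub_mul, levelInterp_mul_detail h n hij, levelInterp_mul_detail h n (by omega),
      sub_self]
  · rw [detail, detail, mul_sub, ← detail, detail_mul_levelInterp h n hij,
      detail_mul_levelInterp h n (by omega), sub_self]

theorem detail_mul_self (h : ∀ n, α n < β n) (n : Fin N) {i : ℕ} (hi : 1 ≤ i) :
    (detail α β n i * detail α β n i : Module.End ℝ ((Fin N → ℝ) → E)) = detail α β n i := by
  nth_rw 1 [detail]
  rw [sub_mul, levelInterp_mul_detail_of_ge h n le_rfl, levelInterp_mul_detail h n (by omega),
    sub_zero]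

theorem detail_mulCoord_levelInterp (h : ∀ n, α n < β n) (n : Fin N) {i j : ℕ} (hij : i + 1 < j) :
    (detail α β n j * mulCoord n * levelInterp α β n i : Module.End ℝ ((Fin N → ℝ) → E)) = 0 := by
  rw [mul_assoc, ← levelInterp_mulCoord_levelInterp h n (Nat.lt_succ_self i), ← mul_assoc,
    detail_mul_levelInterp h n hij, zero_mul]

theorem detail_mulCoord (h : ∀ n, α n < β n) (n : Fin N) {i j : ℕ} (hij : i ≤ j) :
    (detail α β n i * mulCoord n * levelInterp α β n j : Module.End ℝ ((Fin N → ℝ) → E)) =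
      detail α β n i * mulCoord n := by
  simp only [detail, sub_mul]
  rw [levelInterp_mulCoord h n hij, levelInterp_mulCoord h n (by omega : i - 1 ≤ j)]

/-- Multiplication by the variable is block bidiagonal. Levels below `i` are excluded because their
nodes are among those where the detail vanishes, levels above `i + 1` because the degree grows by
only one. -/
theorem detail_mulCoord_detail_eq_zero (h : ∀ n, α n < β n) (n : Fin N) {i j : ℕ}
    (h1 : j ≠ i) (h2 : j ≠ i + 1) :
    (detail α β n j * mulCoord n * detail α β n i : Module.End ℝ ((Fin N → ℝ) → E)) = 0 := by
  rcases lt_or_gt_of_ne h1 with hij | hij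
  · rw [← detail_mulCoord h n le_rfl, mul_assoc, levelInterp_mul_detail h n hij, mul_zero]
  · rw [detail, detail, mul_sub, ← detail, detail_mulCoord_levelInterp h n (by omega),
      detail_mulCoord_levelInterp h n (by omega), sub_zero]

theorem detail_mulCoord_detail_add (h : ∀ n, α n < β n) (n : Fin N) {i : ℕ} (hi : 1 ≤ i) :
    (detail α β n i * mulCoord n * detail α β n i +
      detail α β n (i + 1) * mulCoord n * detail α β n i : Module.End ℝ ((Fin N → ℝ) → E)) =
      mulCoord n * detail α β n i := by
  have e : (detail α β n i + detail α β n (i + 1) : Module.End ℝ ((Fin N → ℝ) → E)) =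
      levelInterp α β n (i + 1) - levelInterp α β n (i - 1) := by
    rw [detail, detail, Nat.add_sub_cancel]; abel
  rw [← add_mul, ← add_mul, e, sub_mul, sub_mul,
    ← levelInterp_mulCoord h n le_rfl (i := i - 1),
    mul_assoc (levelInterp α β n (i - 1) * mulCoord n) _ (detail α β n i),
    levelInterp_mul_detail h n (by omega : i - 1 < i), mul_zero, sub_zero, mul_assoc]
  rw [detail, mul_sub, mul_sub, levelInterp_mulCoord_levelInterp h n (by omega),
    levelInterp_mulCoord_levelInterp h n (by omega)]

theorem detail_mulCoord_add (h : ∀ n, α n < β n) (n : Fin N) {i : ℕ} (hi : 2 ≤ i) :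
    (detail α β n i * mulCoord n * detail α β n i +
      detail α β n i * mulCoord n * detail α β n (i - 1) : Module.End ℝ ((Fin N → ℝ) → E)) =
      detail α β n i * mulCoord n := by
  have e : (detail α β n i + detail α β n (i - 1) : Module.End ℝ ((Fin N → ℝ) → E)) =
      levelInterp α β n i - levelInterp α β n (i - 2) := by
    rw [detail, detail, Nat.sub_sub]; abel
  rw [← mul_add, e, mul_sub, detail_mulCoord h n le_rfl,
    detail_mulCoord_levelInterp h n (by omega), sub_zero]

theorem detail_one (n : Fin N) :
    (detail α β n 1 : Module.End ℝ ((Fin N → ℝ) → E)) = levelInterp α β n 1 := by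
  rw [detail_eq, Nat.sub_self, levelInterp_zero, sub_zero]

theorem detail_one_mulCoord (h : ∀ n, α n < β n) (n : Fin N) :
    (detail α β n 1 * mulCoord n * detail α β n 1 : Module.End ℝ ((Fin N → ℝ) → E)) =
      detail α β n 1 * mulCoord n := by
  nth_rw 2 [detail_one]
  exact detail_mulCoord h n le_rfl

/-- The only block that moves between levels is a commutator. This is the source of smallness: the
commutator contains the factor `y_n` minus node and vanishes on polynomials of degree below `m i -
1`. -/
theorem detail_succ_mulCoord_detail (h : ∀ n, α n < β n) (n : Fin N) {i : ℕ} (hi : 1 ≤ i) :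
    (detail α β n (i + 1) * mulCoord n * detail α β n i : Module.End ℝ ((Fin N → ℝ) → E)) =
      mulCoord n * levelInterp α β n i - levelInterp α β n i * mulCoord n := by
  rw [detail_eq n i, mul_sub, detail_mulCoord_levelInterp h n (by omega : i - 1 + 1 < i + 1),
    sub_zero,
    detail_eq, Nat.add_sub_cancel, sub_mul, sub_mul, levelInterp_mulCoord h n le_rfl, mul_assoc,
    levelInterp_mulCoord_levelInterp h n (by omega)]

theorem mulCoord_levelInterp_sub_apply (n : Fin N) (i : ℕ) (g : (Fin N → ℝ) → E)
    (y : Fin N → ℝ) :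
    (mulCoord n * levelInterp α β n i - levelInterp α β n i * mulCoord n :
      Module.End ℝ ((Fin N → ℝ) → E)) g y =
      ∑ j, (Lagrange.basis Finset.univ (node (α n) (β n) (m i)) j).eval (y n) •
        (y n - node (α n) (β n) (m i) j) •
          g (Function.update y n (node (α n) (β n) (m i) j)) := by
  rw [LinearMap.sub_apply, Pi.sub_apply, Module.End.mul_apply, Module.End.mul_apply,
    mulCoord_apply, interp_apply, interp_apply, Finset.smul_sum, ← Finset.sum_sub_distrib]
  refine Finset.sum_congr rfl fun j _ => ?_
  rw [mulCoord_apply, Function.update_self, sub_smul, smul_sub, smul_comm]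

/-! ### Commutation of operators in different variables -/

theorem interp_commute {n n' : Fin N} (hn : n ≠ n') (k k' : ℕ) :
    Commute (interp α β n k : Module.End ℝ ((Fin N → ℝ) → E)) (interp α β n' k') := by
  ext g y
  simp only [Module.End.mul_apply, interp_apply, Finset.smul_sum, Function.update_of_ne hn,
    Function.update_of_ne hn.symm]
  rw [Finset.sum_comm]
  refine Finset.sum_congr rfl fun j _ => Finset.sum_congr rfl fun l _ => ?_
  rw [smul_comm, Function.update_comm hn]

theorem interp_commute_mulCoord {n n' : Fin N} (hn : n ≠ n') (k : ℕ) :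
    Commute (interp α β n k : Module.End ℝ ((Fin N → ℝ) → E)) (mulCoord n') := by
  ext g y
  simp only [Module.End.mul_apply, interp_apply, mulCoord_apply, Finset.smul_sum,
    Function.update_of_ne hn.symm]
  exact Finset.sum_congr rfl fun j _ => smul_comm _ _ _

theorem detail_commute {n n' : Fin N} (hn : n ≠ n') (i i' : ℕ) :
    Commute (detail α β n i : Module.End ℝ ((Fin N → ℝ) → E)) (detail α β n' i') :=
  ((interp_commute hn _ _).sub_left (interp_commute hn _ _)).sub_right
    ((interp_commute hn _ _).sub_left (interp_commute hn _ _))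

theorem detail_commute_mulCoord {n n' : Fin N} (hn : n ≠ n') (i : ℕ) :
    Commute (detail α β n i : Module.End ℝ ((Fin N → ℝ) → E)) (mulCoord n') :=
  (interp_commute_mulCoord hn _).sub_left (interp_commute_mulCoord hn _)

end Operators

/-! ### Products of operators over the variables -/

section OrderedProd

variable {N : ℕ} {A : Type*} [Ring A] [Algebra ℝ A]

/-- The ordered product as a multilinear map. -/
noncomputable abbrev orderedProd (f : Fin N → A) : A := MultilinearMap.mkPiAlgebraFin ℝ N A f

theorem orderedProd_eq (f : Fin N → A) : orderedProd f = (List.ofFn f).prod :=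
  MultilinearMap.mkPiAlgebraFin_apply f

/-- Commutation is required only between different slots, since interpolation and multiplication in
the same variable do not commute. -/
theorem orderedProd_mul {f g : Fin N → A} (h : ∀ i j, i ≠ j → Commute (f i) (g j)) :
    orderedProd f * orderedProd g = orderedProd fun i => f i * g i := by
  simp only [orderedProd_eq]
  induction N with
  | zero => simp
  | succ N ih =>
    simp only [List.ofFn_succ, List.prod_cons]
    rw [← ih fun i j hij => h _ _ fun he => hij (Fin.succ_injective _ he)]
    have hc : Commute (List.ofFn fun i : Fin N => f i.succ).prod (g 0) := by
      refine Commute.list_prod_left _ _ fun x hx => ?_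
      obtain ⟨i, rfl⟩ := (List.mem_ofFn' _ _).1 hx
      exact h _ _ (Fin.succ_ne_zero i)
    rw [mul_assoc, mul_assoc, ← mul_assoc _ (g 0), hc.eq, mul_assoc]

theorem orderedProd_update_one (n : Fin N) (a : A) :
    orderedProd (Function.update (fun _ => 1) n a) = a := by
  simp only [orderedProd_eq]
  induction N with
  | zero => exact n.elim0
  | succ N ih =>
    rw [List.ofFn_succ, List.prod_cons]
    refine Fin.cases ?_ (fun n => ?_) n
    · have : (fun i : Fin N => Function.update (fun _ : Fin (N + 1) => (1 : A)) 0 a i.succ) =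
          fun _ => 1 := by
        funext i; rw [Function.update_of_ne (Fin.succ_ne_zero i)]
      rw [this, Function.update_self, List.ofFn_const, List.prod_replicate, one_pow, mul_one]
    · have : (fun i : Fin N => Function.update (fun _ : Fin (N + 1) => (1 : A)) n.succ a i.succ) =
          Function.update (fun _ => 1) n a := by
        funext i
        by_cases hi : i = n
        · subst hi; simp
        · rw [Function.update_of_ne hi, Function.update_of_ne]
          exact fun he => hi (Fin.succ_injective _ he)
      rw [this, ih, Function.update_of_ne (Fin.succ_ne_zero n).symm, one_mul]

theorem orderedProd_induction {Q : A → Prop} (h1 : Q 1) (hmul : ∀ a b, Q a → Q b → Q (a * b))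
    {f : Fin N → A} (hf : ∀ n, Q (f n)) : Q (orderedProd f) := by
  rw [orderedProd_eq]
  refine List.prod_induction Q hmul h1 fun x hx => ?_
  obtain ⟨i, rfl⟩ := (List.mem_ofFn' _ _).1 hx
  exact hf i

end OrderedProd

/-! ### Hierarchical surpluses and their interaction with multiplication by a variable. -/

section Surplus

variable {N : ℕ} {E : Type*} [AddCommGroup E] [Module ℝ E] {α β : Fin N → ℝ}

theorem surplus_eq (i : Fin N → ℕ) : (surplus α β i : Module.End ℝ ((Fin N → ℝ) → E)) =
    orderedProd fun n => detail α β n (i n) :=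
  (orderedProd_eq _).symm

/-- The family of operators that is `T` at `n` and the identity elsewhere. -/
noncomputable abbrev opAt (n : Fin N) (T : Module.End ℝ ((Fin N → ℝ) → E)) :
    Fin N → Module.End ℝ ((Fin N → ℝ) → E) := Function.update (fun _ => 1) n T

theorem opAt_self (n : Fin N) (T : Module.End ℝ ((Fin N → ℝ) → E)) : opAt n T n = T :=
  Function.update_self _ _ _

theorem opAt_of_ne {n l : Fin N} (hl : l ≠ n) (T : Module.End ℝ ((Fin N → ℝ) → E)) :
    opAt n T l = 1 := Function.update_of_ne hl _ _

theorem surplus_mul_mulCoord (n : Fin N) (j : Fin N → ℕ) :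
    (surplus α β j * mulCoord n : Module.End ℝ ((Fin N → ℝ) → E)) =
      orderedProd fun l => detail α β l (j l) * opAt n (mulCoord n) l := by
  rw [← orderedProd_mul, orderedProd_update_one, surplus_eq]
  intro l l' hl
  by_cases hn : l' = n
  · subst hn; rw [opAt_self]; exact detail_commute_mulCoord hl _
  · rw [opAt_of_ne hn]; exact Commute.one_right _

theorem surplus_mulCoord_surplus (n : Fin N) (i j : Fin N → ℕ) :
    (surplus α β j * mulCoord n * surplus α β i : Module.End ℝ ((Fin N → ℝ) → E)) =
      orderedProd fun l => detail α β l (j l) * opAt n (mulCoord n) l *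
        detail α β l (i l) := by
  rw [surplus_mul_mulCoord, surplus_eq i, orderedProd_mul]
  intro l l' hl
  refine (detail_commute hl _ _).mul_left ?_
  by_cases hn : l = n
  · subst hn; rw [opAt_self]; exact (detail_commute_mulCoord hl.symm _).symm
  · rw [opAt_of_ne hn]; exact Commute.one_left _

/-- In the variables other than `n` different details annihilate each other, which forces equal
entries there; in the variable `n` the univariate bidiagonal structure leaves two possibilities. -/
theorem surplus_mulCoord_surplus_eq_zero (h : ∀ n, α n < β n) (n : Fin N) {i j : Fin N → ℕ}
    (h1 : j ≠ i) (h2 : j ≠ i + Pi.single n 1) :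
    (surplus α β j * mulCoord n * surplus α β i : Module.End ℝ ((Fin N → ℝ) → E)) = 0 := by
  rw [surplus_mulCoord_surplus]
  by_cases hl : ∃ l, l ≠ n ∧ j l ≠ i l
  · obtain ⟨l, hln, hl⟩ := hl
    refine MultilinearMap.map_coord_zero _ l ?_
    simp only [opAt_of_ne hln, mul_one]
    exact detail_mul_detail_of_ne h l hl
  · push Not at hl
    refine MultilinearMap.map_coord_zero _ n ?_
    simp only [opAt_self]
    refine detail_mulCoord_detail_eq_zero h n (fun hn => h1 ?_) (fun hn => h2 ?_)
    · funext l
      by_cases hln : l = n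
      · rw [hln, hn]
      · exact hl l hln
    · funext l
      by_cases hln : l = n
      · subst hln; simp [hn]
      · simpa [hln] using hl l hln

theorem orderedProd_congr_update (n : Fin N) {f g : Fin N → Module.End ℝ ((Fin N → ℝ) → E)}
    {a : Module.End ℝ ((Fin N → ℝ) → E)} (hn : f n = a) (hf : ∀ l, l ≠ n → f l = g l) :
    orderedProd f = orderedProd (Function.update g n a) := by
  congr 1
  funext l
  by_cases hl : l = n
  · subst hl; rw [Function.update_self, hn]
  · rw [Function.update_of_ne hl, hf l hl]

theorem surplus_mulCoord_surplus_eq_update (h : ∀ n, α n < β n) (n : Fin N) {i j : Fin N → ℕ}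
    (hi : ∀ l, 1 ≤ i l) (hij : ∀ l, l ≠ n → j l = i l) :
    (surplus α β j * mulCoord n * surplus α β i : Module.End ℝ ((Fin N → ℝ) → E)) =
      orderedProd (Function.update (fun l => detail α β l (i l)) n
        (detail α β n (j n) * mulCoord n * detail α β n (i n))) := by
  rw [surplus_mulCoord_surplus]
  refine orderedProd_congr_update n (by rw [opAt_self]) fun l hl => ?_
  rw [opAt_of_ne hl, mul_one, hij l hl, detail_mul_self h l (hi l)]

theorem surplus_mulCoord_eq_update (n : Fin N) (j : Fin N → ℕ) :
    (surplus α β j * mulCoord n : Module.End ℝ ((Fin N → ℝ) → E)) =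
      orderedProd (Function.update (fun l => detail α β l (j l)) n
        (detail α β n (j n) * mulCoord n)) := by
  rw [surplus_mul_mulCoord]
  refine orderedProd_congr_update n (by rw [opAt_self]) fun l hl => ?_
  rw [opAt_of_ne hl, mul_one]

theorem mulCoord_surplus_eq_update (n : Fin N) (i : Fin N → ℕ) :
    (mulCoord n * surplus α β i : Module.End ℝ ((Fin N → ℝ) → E)) =
      orderedProd (Function.update (fun l => detail α β l (i l)) n
        (mulCoord n * detail α β n (i n))) := by
  nth_rw 1 [← orderedProd_update_one (A := Module.End ℝ ((Fin N → ℝ) → E)) n (mulCoord n)]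
  rw [surplus_eq, orderedProd_mul]
  · refine orderedProd_congr_update n (by rw [Function.update_self]) fun l hl => ?_
    rw [Function.update_of_ne hl, one_mul]
  intro l l' hl
  by_cases hn : l = n
  · subst hn; rw [Function.update_self]; exact (detail_commute_mulCoord hl.symm _).symm
  · rw [Function.update_of_ne hn]; exact Commute.one_left _

/-- All entries of all multi-indices in `I` are positive. -/
def IsPositive (I : Finset (Fin N → ℕ)) : Prop := ∀ i ∈ I, ∀ n, 1 ≤ i n

/-- Column form of the bidiagonal structure: the two blocks reached from `i` already make up all of
`y_n Δ_i`. -/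
theorem sum_surplus_mulCoord_surplus (h : ∀ n, α n < β n) (n : Fin N) {J : Finset (Fin N → ℕ)}
    {i : Fin N → ℕ} (hi : ∀ l, 1 ≤ i l) (h1 : i ∈ J) (h2 : i + Pi.single n 1 ∈ J) :
    (∑ j ∈ J, surplus α β j * mulCoord n * surplus α β i : Module.End ℝ ((Fin N → ℝ) → E)) =
      mulCoord n * surplus α β i := by
  have hne : i ≠ i + Pi.single n 1 := fun he => by simpa using congrFun he n
  rw [Finset.sum_eq_add i (i + Pi.single n 1) hne ?_ (fun hn => absurd h1 hn)
    (fun hn => absurd h2 hn)]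
  · rw [surplus_mulCoord_surplus_eq_update h n hi fun l _ => rfl,
      surplus_mulCoord_surplus_eq_update h n hi fun l hl => by simp [hl],
      ← MultilinearMap.map_update_add, mulCoord_surplus_eq_update]
    congr 2
    simpa using detail_mulCoord_detail_add h n (hi n)
  · exact fun j _ hj => surplus_mulCoord_surplus_eq_zero h n hj.1 hj.2

/-- Row form of the bidiagonal structure: `Δ_j y_n` receives contributions only from `j` and `j -
e_n`. Downward-closedness supplies the second; at level `1` it is not needed. -/
theorem sum_surplus_mulCoord (h : ∀ n, α n < β n) (n : Fin N) {I : Finset (Fin N → ℕ)}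
    (hpos : IsPositive I) (hI : IsDownwardClosed I) {j : Fin N → ℕ} (hj : j ∈ I) :
    (∑ i ∈ I, surplus α β j * mulCoord n * surplus α β i : Module.End ℝ ((Fin N → ℝ) → E)) =
      surplus α β j * mulCoord n := by
  rcases (hpos j hj n).eq_or_lt with hn | hn
  · rw [Finset.sum_eq_single j]
    · rw [surplus_mulCoord_surplus_eq_update h n (hpos j hj) fun l _ => rfl,
        surplus_mulCoord_eq_update, ← hn, detail_one_mulCoord h]
    · intro i hi hij
      refine surplus_mulCoord_surplus_eq_zero h n hij.symm fun he => ?_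
      have := congrFun he n
      have := hpos i hi n
      simp at *
      omega
    · exact fun h => absurd hj h
  · have hj' := hI j hj n hn
    have hne : j ≠ j - Pi.single n 1 := fun he => by
      have := congrFun he n
      simp at this; omega
    have hadd : j - Pi.single n 1 + Pi.single n 1 = j := by
      funext l
      by_cases hl : l = n
      · subst hl; simp; omega
      · simp [hl]
    rw [Finset.sum_eq_add j (j - Pi.single n 1) hne ?_ (fun hn => absurd hj hn)
      (fun hn => absurd hj' hn)]
    · rw [surplus_mulCoord_surplus_eq_update h n (hpos j hj) fun l _ => rfl,
        surplus_mulCoord_surplus_eq_update h n (hpos _ hj') fun l hl => by simp [hl],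
        surplus_mulCoord_eq_update]
      have e : Function.update (fun l => (detail α β l ((j - Pi.single n 1 : Fin N → ℕ) l) :
          Module.End ℝ ((Fin N → ℝ) → E))) n
          (detail α β n (j n) * mulCoord n * detail α β n ((j - Pi.single n 1 : Fin N → ℕ) n)) =
        Function.update (fun l => detail α β l (j l)) n
          (detail α β n (j n) * mulCoord n * detail α β n (j n - 1)) := by
        funext l
        by_cases hl : l = n
        · subst hl; simp
        · simp [hl]
      rw [e, ← MultilinearMap.map_update_add, detail_mulCoord_add h n hn]
    · intro i _ hi
      refine surplus_mulCoord_surplus_eq_zero h n hi.1.symm fun he => hi.2 ?_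
      rw [he]; funext l; simp

theorem surplus_mul_surplus_of_ne (h : ∀ n, α n < β n) {i j : Fin N → ℕ} (hij : j ≠ i) :
    (surplus α β j * surplus α β i : Module.End ℝ ((Fin N → ℝ) → E)) = 0 := by
  rw [surplus_eq, surplus_eq, orderedProd_mul fun l l' hl => detail_commute hl _ _]
  obtain ⟨l, hl⟩ := Function.ne_iff.1 hij
  exact MultilinearMap.map_coord_zero _ l (detail_mul_detail_of_ne h l hl)

theorem surplus_mul_self (h : ∀ n, α n < β n) {i : Fin N → ℕ} (hi : ∀ l, 1 ≤ i l) :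
    (surplus α β i * surplus α β i : Module.End ℝ ((Fin N → ℝ) → E)) = surplus α β i := by
  rw [surplus_eq, orderedProd_mul fun l l' hl => detail_commute hl _ _]
  congr 1
  funext l
  exact detail_mul_self h l (hi l)

/-- Surpluses with positive indices are idempotent and annihilate each other, so summing over the
larger set keeps exactly the surpluses of `I`. -/
theorem sparseInterp_mul_of_subset (h : ∀ n, α n < β n) {I J : Finset (Fin N → ℕ)}
    (hpos : IsPositive I) (hIJ : I ⊆ J) :
    (sparseInterp α β J * sparseInterp α β I : Module.End ℝ ((Fin N → ℝ) → E)) =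
      sparseInterp α β I := by
  rw [sparseInterp, sparseInterp, Finset.sum_mul_sum, Finset.sum_comm]
  refine Finset.sum_congr rfl fun i hi => ?_
  rw [Finset.sum_eq_single i, surplus_mul_self h (hpos i hi)]
  · exact fun j _ hj => surplus_mul_surplus_of_ne h hj
  · exact fun hn => absurd (hIJ hi) hn

/-- The space spanned by `S_I` is mapped by multiplication by a variable into the space spanned by
`S_J` if `J` contains `I` and its forward neighbours. -/
theorem sparseInterp_mulCoord_sparseInterp (h : ∀ n, α n < β n) (n : Fin N)
    {I J : Finset (Fin N → ℕ)} (hpos : IsPositive I) (hIJ : I ⊆ J)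
    (hIJ' : ∀ i ∈ I, i + Pi.single n 1 ∈ J) :
    (sparseInterp α β J * (mulCoord n * sparseInterp α β I) : Module.End ℝ ((Fin N → ℝ) → E)) =
      mulCoord n * sparseInterp α β I := by
  rw [sparseInterp, sparseInterp, Finset.mul_sum, Finset.sum_mul_sum, Finset.sum_comm]
  refine Finset.sum_congr rfl fun i hi => ?_
  simp only [← mul_assoc]
  rw [sum_surplus_mulCoord_surplus h n (hpos i hi) (hIJ hi) (hIJ' i hi)]

/-- Sparse grid interpolation only sees the values on the sparse grid. -/
theorem sparseInterp_mulCoord (h : ∀ n, α n < β n) (n : Fin N)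
    {I : Finset (Fin N → ℕ)} (hpos : IsPositive I) (hI : IsDownwardClosed I) :
    (sparseInterp α β I * mulCoord n * sparseInterp α β I : Module.End ℝ ((Fin N → ℝ) → E)) =
      sparseInterp α β I * mulCoord n := by
  rw [sparseInterp, Finset.sum_mul, Finset.sum_mul_sum]
  exact Finset.sum_congr rfl fun j hj => sum_surplus_mulCoord h n hpos hI hj

theorem detail_const (h : ∀ n, α n < β n) (n : Fin N) (i : ℕ) (c : E) :
    detail α β n (i + 1) (fun _ => c) = fun _ => if i = 0 then c else 0 := by
  have e : ∀ k, levelInterp α β n (k + 1) (fun _ => c) = fun _ => c := by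
    intro k
    funext y
    rw [interp_apply, ← Finset.sum_smul]
    have hm : 0 < m (k + 1) := by have := m_succ_le k; omega
    have := sum_basis_node_eval (h n) (k := m (k + 1)) (P := 1)
      (by rw [Polynomial.degree_one]; exact_mod_cast hm) (y n)
    simp only [Polynomial.eval_one, mul_one] at this
    rw [this, one_smul]
  rw [detail_eq, LinearMap.sub_apply, e, Nat.add_sub_cancel]
  rcases i with _ | i
  · rw [if_pos rfl, levelInterp_zero, LinearMap.zero_apply, sub_zero]
  · rw [e, sub_self]
    simp only [if_neg (Nat.succ_ne_zero i)]
    rfl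

/-- Constants are fixed by the surplus of index `(1, …, 1)`, and `S_I` is the identity on the range
of that surplus once the index lies in `I`. -/
theorem sparseInterp_const (h : ∀ n, α n < β n) {I : Finset (Fin N → ℕ)}
    (h1 : (fun _ => 1) ∈ I) (c : E) :
    sparseInterp α β I (fun _ => c) = fun _ => c := by
  have hone : surplus α β (fun _ => 1) (fun _ => c) = fun _ => c := by
    rw [surplus_eq]
    refine orderedProd_induction (Q := fun T : Module.End ℝ ((Fin N → ℝ) → E) => T (fun _ => c) = fun _ => c) rfl
      (fun a b ha hb => by rw [Module.End.mul_apply, hb, ha]) fun n => ?_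
    rw [show (1 : ℕ) = 0 + 1 from rfl, detail_const h, if_pos rfl]
  rw [← hone, ← Module.End.mul_apply]
  congr 1
  have := sparseInterp_mul_of_subset (E := E) h (I := {fun _ => 1}) (J := I) (by
    intro i hi n; rw [Finset.mem_singleton.1 hi]) (by simpa using h1)
  simpa [sparseInterp] using this

end Surplus

/-! ### Naturality in the space of values -/

section Naturality

variable {N : ℕ} {E F : Type*} [AddCommGroup E] [Module ℝ E] [AddCommGroup F] [Module ℝ F]
  {α β : Fin N → ℝ}

theorem detail_map (L : E →ₗ[ℝ] F) (n : Fin N) (i : ℕ) (g : (Fin N → ℝ) → E) :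
    detail α β n i (fun y => L (g y)) = fun y => L (detail α β n i g y) := by
  funext y
  simp [detail, interp_apply]

theorem surplus_map (L : E →ₗ[ℝ] F) (i : Fin N → ℕ) (g : (Fin N → ℝ) → E) :
    surplus α β i (fun y => L (g y)) = fun y => L (surplus α β i g y) := by
  have hl : ∀ l : List (Fin N), (l.map fun n => detail α β n (i n)).prod (fun y => L (g y)) =
      fun y => L ((l.map fun n => (detail α β n (i n) : Module.End ℝ _)).prod g y) := by
    intro l
    induction l with
    | nil => rfl
    | cons n l ih =>
      rw [List.map_cons, List.prod_cons, List.map_cons, List.prod_cons, Module.End.mul_apply, ih,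
        detail_map]
      rfl
  have := hl (List.ofFn id)
  rw [List.map_ofFn, List.map_ofFn] at this
  exact this

theorem sparseInterp_map (L : E →ₗ[ℝ] F) (I : Finset (Fin N → ℕ)) (g : (Fin N → ℝ) → E) :
    sparseInterp α β I (fun y => L (g y)) = fun y => L (sparseInterp α β I g y) := by
  funext y
  simp only [sparseInterp, LinearMap.sum_apply, Finset.sum_apply, map_sum, surplus_map]

end Naturality

/-! ### Stability in the supremum norm -/

section Sup

variable {N : ℕ} {E : Type*} [NormedAddCommGroup E] [NormedSpace ℝ E] {α β : Fin N → ℝ}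

variable (α β) in
/-- The operator `T` is bounded by `c` in the supremum norm over `Γ`. -/
def SupBound (T : Module.End ℝ ((Fin N → ℝ) → E)) (c : ℝ) : Prop :=
  ∀ (g : (Fin N → ℝ) → E) (K : ℝ), (∀ y ∈ Set.Icc α β, ‖g y‖ ≤ K) →
    ∀ y ∈ Set.Icc α β, ‖T g y‖ ≤ c * K

theorem SupBound.mul {S T : Module.End ℝ ((Fin N → ℝ) → E)} {c d : ℝ} (hS : SupBound α β S c)
    (hT : SupBound α β T d) : SupBound α β (S * T) (c * d) := fun g K hg => by
  rw [mul_assoc]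
  exact hS (T g) (d * K) (hT g K hg)

theorem SupBound.sub {S T : Module.End ℝ ((Fin N → ℝ) → E)} {c d : ℝ} (hS : SupBound α β S c)
    (hT : SupBound α β T d) : SupBound α β (S - T) (c + d) := fun g K hg y hy => by
  rw [add_mul]
  exact (norm_sub_le _ _).trans (add_le_add (hS g K hg y hy) (hT g K hg y hy))

theorem SupBound.sum {ι : Type*} (s : Finset ι) {T : ι → Module.End ℝ ((Fin N → ℝ) → E)}
    {c : ι → ℝ} (hT : ∀ i ∈ s, SupBound α β (T i) (c i)) :
    SupBound α β (∑ i ∈ s, T i) (∑ i ∈ s, c i) := fun g K hg y hy => by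
  rw [LinearMap.sum_apply, Finset.sum_apply, Finset.sum_mul]
  exact norm_sum_le_of_le _ fun i hi => hT i hi g K hg y hy

theorem supBound_one : SupBound α β (1 : Module.End ℝ ((Fin N → ℝ) → E)) 1 := fun g K hg y hy => by
  simpa using hg y hy

theorem SupBound.mono (hαβ : ∀ n, α n < β n) {T : Module.End ℝ ((Fin N → ℝ) → E)} {c d : ℝ}
    (hT : SupBound α β T c) (hcd : c ≤ d) : SupBound α β T d := fun g K hg y hy => by
  have : 0 ≤ K := (norm_nonneg _).trans (hg α ⟨le_rfl, fun n => (hαβ n).le⟩)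
  exact (hT g K hg y hy).trans (by gcongr)

theorem update_mem_Icc {y : Fin N → ℝ} (hy : y ∈ Set.Icc α β) {n : Fin N} {t : ℝ}
    (ht : t ∈ Set.Icc (α n) (β n)) : Function.update y n t ∈ Set.Icc α β := by
  constructor
  · intro l
    by_cases hl : l = n
    · subst hl; simpa using ht.1
    · simpa [hl] using hy.1 l
  · intro l
    by_cases hl : l = n
    · subst hl; simpa using ht.2
    · simpa [hl] using hy.2 l

theorem supBound_levelInterp (h : ∀ n, α n < β n) (n : Fin N) (i : ℕ) :
    SupBound α β (levelInterp α β n i : Module.End ℝ ((Fin N → ℝ) → E)) (8 * i) := by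
  intro g K hg y hy
  have hK : 0 ≤ K := (norm_nonneg _).trans (hg y hy)
  rw [interp_apply]
  calc _ ≤ ∑ j, |(Lagrange.basis Finset.univ (node (α n) (β n) (m i)) j).eval (y n)| * K := by
        refine norm_sum_le_of_le _ fun j _ => ?_
        rw [norm_smul, Real.norm_eq_abs]
        gcongr
        exact hg _ (update_mem_Icc hy (node_mem (h n).le _ _))
    _ ≤ 8 * i * K := by
        rw [← Finset.sum_mul]
        gcongr
        exact sum_abs_eval_basis_node_le (h n) i ⟨hy.1 n, hy.2 n⟩

theorem supBound_detail (h : ∀ n, α n < β n) (n : Fin N) (i : ℕ) :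
    SupBound α β (detail α β n i : Module.End ℝ ((Fin N → ℝ) → E)) (16 * i) := by
  refine ((supBound_levelInterp h n i).sub (supBound_levelInterp h n (i - 1))).mono h ?_
  have : ((i - 1 : ℕ) : ℝ) ≤ i := by exact_mod_cast Nat.sub_le i 1
  linarith

theorem SupBound.orderedProd {f : Fin N → Module.End ℝ ((Fin N → ℝ) → E)} {c : Fin N → ℝ}
    (hf : ∀ n, SupBound α β (f n) (c n)) : SupBound α β (orderedProd f) (∏ n, c n) := by
  have hl : ∀ l : List (Fin N), SupBound α β (l.map f).prod (l.map c).prod := by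
    intro l
    induction l with
    | nil => exact supBound_one
    | cons n l ih => rw [List.map_cons, List.prod_cons, List.map_cons, List.prod_cons]
                     exact (hf n).mul ih
  have := hl (List.ofFn id)
  rw [List.map_ofFn, List.map_ofFn, List.prod_ofFn] at this
  rw [orderedProd_eq]
  exact this

theorem supBound_surplus (h : ∀ n, α n < β n) {i : Fin N → ℕ} {J : ℕ} (hi : ∀ n, i n ≤ J) :
    SupBound α β (surplus α β i : Module.End ℝ ((Fin N → ℝ) → E)) ((16 * J) ^ N) := by
  rw [surplus_eq]
  refine (SupBound.orderedProd fun n => (supBound_detail h n (i n)).mono h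
    (d := 16 * J) ?_).mono h (by simp)
  have : (i n : ℝ) ≤ J := by exact_mod_cast hi n
  linarith

theorem supBound_sparseInterp (h : ∀ n, α n < β n) {I : Finset (Fin N → ℕ)} {J : ℕ}
    (hI : ∀ i ∈ I, ∀ n, i n ≤ J) :
    SupBound α β (sparseInterp α β I : Module.End ℝ ((Fin N → ℝ) → E))
      (I.card * (16 * J) ^ N) :=
  (SupBound.sum I fun i hi => supBound_surplus h (hI i hi)).mono h (by simp)

/-- A supremum bound with `K = 0`, applied to the difference, shows that values of `T g` on `Γ`
depend only on values of `g` on `Γ`. It is needed because `u` solves the problem only there. -/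
theorem SupBound.congr {T : Module.End ℝ ((Fin N → ℝ) → E)} {c : ℝ} (hT : SupBound α β T c)
    {g g' : (Fin N → ℝ) → E} (hg : ∀ y ∈ Set.Icc α β, g y = g' y) {y : Fin N → ℝ}
    (hy : y ∈ Set.Icc α β) : T g y = T g' y := by
  have := hT (g - g') 0 (fun y hy => by simp [hg y hy]) y hy
  rw [mul_zero, norm_le_zero_iff, map_sub, Pi.sub_apply, sub_eq_zero] at this
  exact this

/-- The off-diagonal blocks of multiplication by a variable are commutators. -/
theorem norm_surplus_mulCoord_surplus_le (h : ∀ n, α n < β n) (n : Fin N) {i : Fin N → ℕ} {J : ℕ}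
    (hJ : 1 ≤ J) (hi : ∀ l, 1 ≤ i l) (hiJ : ∀ l, i l ≤ J) {g : (Fin N → ℝ) → E} {K : ℝ}
    (hK : ∀ y ∈ Set.Icc α β, ‖(mulCoord n * levelInterp α β n (i n) -
      levelInterp α β n (i n) * mulCoord n : Module.End ℝ ((Fin N → ℝ) → E)) g y‖ ≤ K) :
    ∀ y ∈ Set.Icc α β, ‖(surplus α β (i + Pi.single n 1) * mulCoord n * surplus α β i :
      Module.End ℝ ((Fin N → ℝ) → E)) g y‖ ≤ (16 * J) ^ N * K := by
  set T : Module.End ℝ ((Fin N → ℝ) → E) := mulCoord n * levelInterp α β n (i n) -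
      levelInterp α β n (i n) * mulCoord n with hT
  -- The block factors into the details in the other variables, which cost `16 J` each, and the
  -- commutator in the variable `n`, which acts first on `g` itself.
  have e : (surplus α β (i + Pi.single n 1) * mulCoord n * surplus α β i :
      Module.End ℝ ((Fin N → ℝ) → E)) =
      orderedProd (Function.update (fun l => detail α β l (i l)) n 1) * T := by
    have h1 := orderedProd_update_one (A := Module.End ℝ ((Fin N → ℝ) → E)) n T
    conv_rhs => rw [← h1]
    rw [orderedProd_mul, surplus_mulCoord_surplus_eq_update h n hi fun l hl => by simp [hl]]
    · refine (orderedProd_congr_update n ?_ fun l hl => ?_).symm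
      · simp only [Function.update_self, one_mul, Pi.add_apply, Pi.single_eq_same]
        rw [detail_succ_mulCoord_detail h n (hi n)]
      · simp only [Function.update_of_ne hl, mul_one]
    · intro l l' hl
      by_cases hl' : l' = n
      · subst hl'
        rw [Function.update_self, Function.update_of_ne hl]
        have h1 := detail_commute_mulCoord (α := α) (β := β) (E := E) hl (i l)
        have h2 : Commute (detail α β l (i l) : Module.End ℝ ((Fin N → ℝ) → E))
            (levelInterp α β l' (i l')) :=
          (interp_commute hl _ _).sub_left (interp_commute hl _ _)
        exact (h1.mul_right h2).sub_right (h2.mul_right h1)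
      · rw [Function.update_of_ne hl']; exact Commute.one_right _
  rw [e]
  have hJ' : (1 : ℝ) ≤ J := by exact_mod_cast hJ
  have hb : SupBound α β (orderedProd (Function.update
      (fun l => (detail α β l (i l) : Module.End ℝ ((Fin N → ℝ) → E))) n 1)) ((16 * J) ^ N) := by
    refine (SupBound.orderedProd (c := fun _ => 16 * J) fun l => ?_).mono h (by simp)
    by_cases hl : l = n
    · subst hl
      rw [Function.update_self]
      exact supBound_one.mono h (by linarith)
    · rw [Function.update_of_ne hl]
      refine (supBound_detail h l (i l)).mono h ?_
      have : (i l : ℝ) ≤ J := by exact_mod_cast hiJ l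
      linarith
  exact hb (T g) K hK

/-! ### Continuity -/

theorem continuousOn_interp (h : ∀ n, α n < β n) (n : Fin N) (k : ℕ) {g : (Fin N → ℝ) → E}
    (hg : ContinuousOn g (Set.Icc α β)) : ContinuousOn (interp α β n k g) (Set.Icc α β) := by
  have e : interp α β n k g = fun y => ∑ j : Fin k,
      (Lagrange.basis Finset.univ (node (α n) (β n) k) j).eval (y n) •
        g (Function.update y n (node (α n) (β n) k j)) := rfl
  rw [e]
  refine continuousOn_finsetSum _ fun j _ => ContinuousOn.smul ?_ ?_
  · exact ((Polynomial.continuous _).comp (continuous_apply n)).continuousOn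
  · exact hg.comp (continuous_id.update n continuous_const).continuousOn fun y hy =>
      update_mem_Icc hy (node_mem (h n).le _ _)

theorem continuousOn_surplus (h : ∀ n, α n < β n) (i : Fin N → ℕ) {g : (Fin N → ℝ) → E}
    (hg : ContinuousOn g (Set.Icc α β)) : ContinuousOn (surplus α β i g) (Set.Icc α β) := by
  rw [surplus_eq]
  refine orderedProd_induction (Q := fun T : Module.End ℝ ((Fin N → ℝ) → E) =>
    ∀ g, ContinuousOn g (Set.Icc α β) → ContinuousOn (T g) (Set.Icc α β)) (fun g hg => hg)
    (fun a b ha hb g hg => ha _ (hb g hg)) (fun n g hg => ?_) g hg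
  exact (continuousOn_interp h n _ hg).sub (continuousOn_interp h n _ hg)

theorem continuousOn_sparseInterp (h : ∀ n, α n < β n) (I : Finset (Fin N → ℕ))
    {g : (Fin N → ℝ) → E} (hg : ContinuousOn g (Set.Icc α β)) :
    ContinuousOn (sparseInterp α β I g) (Set.Icc α β) := by
  have e : sparseInterp α β I g = fun y => ∑ i ∈ I, surplus α β i g y := by
    funext y
    rw [sparseInterp, LinearMap.sum_apply, Finset.sum_apply]
  rw [e]
  exact continuousOn_finsetSum _ fun i _ => continuousOn_surplus h i hg

end Sup

end SparseGrid

namespace SparseGrid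

/-! ### Downward-closed sets and margins -/

section Algorithm

variable {N : ℕ} {I : Finset (Fin N → ℕ)}

theorem IsDownwardClosed.mem_of_le (hI : IsDownwardClosed I) {i j : Fin N → ℕ}
    (hj : j ∈ I) (hij : i ≤ j) (hi : ∀ n, 1 ≤ i n) : i ∈ I := by
  induction hs : ∑ n, (j n - i n) generalizing j with
  | zero =>
    have : i = j := by
      funext n
      have h1 : j n - i n = 0 := (Finset.sum_eq_zero_iff.1 hs) n (Finset.mem_univ _)
      have h2 : i n ≤ j n := hij n
      omega
    rwa [this]
  | succ s ih =>
    obtain ⟨n, hn⟩ : ∃ n, i n < j n := by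
      by_contra! hc
      have : ∑ n, (j n - i n) = 0 := Finset.sum_eq_zero fun n _ => by have := hc n; omega
      omega
    have h1 := hi n
    refine ih (hI j hj n (by omega)) (fun l => ?_) ?_
    · by_cases hl : l = n
      · subst hl; simp; omega
      · simpa [hl] using hij l
    · rw [← Finset.add_sum_erase _ _ (Finset.mem_univ n)] at hs ⊢
      have : ∑ l ∈ Finset.univ.erase n, ((j - Pi.single n 1 : Fin N → ℕ) l - i l) =
          ∑ l ∈ Finset.univ.erase n, (j l - i l) :=
        Finset.sum_congr rfl fun l hl => by simp [Finset.ne_of_mem_erase hl]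
      rw [this]
      simp
      omega

theorem IsPositive.margin (hI : IsPositive I) : IsPositive (margin I) := by
  intro i hi l
  obtain ⟨-, n, hn, h⟩ := mem_margin.1 hi
  by_cases hl : l = n
  · subst hl; omega
  · simpa [hl] using hI _ h l

theorem IsPositive.mono {J : Finset (Fin N → ℕ)} (hJ : IsPositive J) (h : I ⊆ J) :
    IsPositive I := fun i hi => hJ i (h hi)

theorem IsPositive.union {J : Finset (Fin N → ℕ)} (hI : IsPositive I) (hJ : IsPositive J) :
    IsPositive (I ∪ J) := fun i hi => (Finset.mem_union.1 hi).elim (hI i) (hJ i)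

theorem mem_union_margin_of_sub {i : Fin N → ℕ} {n : Fin N} (hn : 1 < i n)
    (h : i - Pi.single n 1 ∈ I) : i ∈ I ∪ margin I := by
  by_cases hi : i ∈ I
  · exact Finset.mem_union_left _ hi
  · exact Finset.mem_union_right _ (mem_margin.2 ⟨hi, n, hn, h⟩)

theorem add_single_mem_union_margin (hpos : IsPositive I) {i : Fin N → ℕ} (hi : i ∈ I)
    (n : Fin N) : i + Pi.single n 1 ∈ I ∪ margin I := by
  refine mem_union_margin_of_sub (n := n) ?_ ?_
  · have := hpos i hi n
    simp; omega
  · rwa [add_tsub_cancel_right]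

theorem IsDownwardClosed.union_margin (hI : IsDownwardClosed I) :
    IsDownwardClosed (I ∪ margin I) := by
  intro i hi l hl
  rcases Finset.mem_union.1 hi with h | h
  · exact Finset.mem_union_left _ (hI i h l hl)
  · obtain ⟨-, n, hn, h⟩ := mem_margin.1 h
    by_cases hln : l = n
    · subst hln; exact Finset.mem_union_left _ h
    · refine mem_union_margin_of_sub (n := n) (by simpa [Ne.symm hln] using hn) ?_
      rw [tsub_right_comm]
      exact hI _ h l (by simpa [hln] using hl)

theorem margin_disjoint (I : Finset (Fin N → ℕ)) : Disjoint I (margin I) :=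
  Finset.disjoint_right.2 fun _ hi => (mem_margin.1 hi).1

theorem margin_nonempty (hN : 1 ≤ N) (hpos : IsPositive I) (h : I.Nonempty) :
    (margin I).Nonempty := by
  obtain ⟨i, hi, hmax⟩ := I.exists_max_image (fun i => i ⟨0, hN⟩) h
  have := add_single_mem_union_margin hpos hi ⟨0, hN⟩
  rcases Finset.mem_union.1 this with h | h
  · have := hmax _ h
    simp at this
  · exact ⟨_, h⟩

theorem margin_le {J : ℕ} (hJ : ∀ i ∈ I, ∀ n, i n ≤ J) {i : Fin N → ℕ} (hi : i ∈ margin I)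
    (n : Fin N) : i n ≤ J + 1 := by
  obtain ⟨-, l, hl, h⟩ := mem_margin.1 hi
  have := hJ _ h n
  by_cases hn : n = l
  · subst hn; simp at this; omega
  · simp [hn] at this; omega

theorem mem_addedSet {i j : Fin N → ℕ} : j ∈ addedSet I i ↔ j ∈ margin I ∧
    ∀ A : Finset (Fin N → ℕ), A ⊆ margin I → i ∈ A → IsDownwardClosed (I ∪ A) → j ∈ A := by
  simp only [addedSet, Finset.mem_filter]

theorem addedSet_subset_margin (I : Finset (Fin N → ℕ)) (i : Fin N → ℕ) :
    addedSet I i ⊆ margin I := fun _ hj => (mem_addedSet.1 hj).1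

theorem self_mem_addedSet {i : Fin N → ℕ} (hi : i ∈ margin I) : i ∈ addedSet I i :=
  mem_addedSet.2 ⟨hi, fun _ _ h _ => h⟩

/-- Any admissible `A` containing `j` must also contain a predecessor of `j` that lies in the
margin, so the common part of all admissible sets is again admissible. -/
theorem IsDownwardClosed.union_addedSet (hI : IsDownwardClosed I) (i : Fin N → ℕ) :
    IsDownwardClosed (I ∪ addedSet I i) := by
  intro j hj l hl
  rcases Finset.mem_union.1 hj with h | h
  · exact Finset.mem_union_left _ (hI j h l hl)
  · obtain ⟨hjm, hmin⟩ := mem_addedSet.1 h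
    rcases Finset.mem_union.1 (hI.union_margin j (Finset.mem_union_right _ hjm) l hl) with h' | h'
    · exact Finset.mem_union_left _ h'
    refine Finset.mem_union_right _ (mem_addedSet.2 ⟨h', fun A hA hiA hAdc => ?_⟩)
    have := hAdc j (Finset.mem_union_right _ (hmin A hA hiA hAdc)) l hl
    exact (Finset.mem_union.1 this).resolve_left (mem_margin.1 h').1

theorem le_of_mem_addedSet (hI : IsDownwardClosed I) {i j : Fin N → ℕ} (hi : i ∈ margin I)
    (hj : j ∈ addedSet I i) : j ≤ i := by
  classical
  obtain ⟨-, hmin⟩ := mem_addedSet.1 hj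
  -- The margin elements below `i` form an admissible competitor, so the smallest admissible set
  -- lies inside it.
  have := hmin ((margin I).filter (· ≤ i)) (Finset.filter_subset _ _)
    (Finset.mem_filter.2 ⟨hi, le_rfl⟩) ?_
  · exact (Finset.mem_filter.1 this).2
  intro k hk l hl
  rcases Finset.mem_union.1 hk with h | h
  · exact Finset.mem_union_left _ (hI k h l hl)
  · obtain ⟨hkm, hki⟩ := Finset.mem_filter.1 h
    rcases Finset.mem_union.1 (hI.union_margin k (Finset.mem_union_right _ hkm) l hl) with h' | h'
    · exact Finset.mem_union_left _ h'
    · exact Finset.mem_union_right _ (Finset.mem_filter.2 ⟨h', tsub_le_self.trans hki⟩)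

/-! ### The sets produced by the algorithm -/

theorem maximizers_subset_margin (P : Finset (Fin N → ℕ) → (Fin N → ℕ) → ℝ)
    (I : Finset (Fin N → ℕ)) : maximizers P I ⊆ margin I := Finset.filter_subset _ _

theorem exists_step_eq (hN : 1 ≤ N) (P : Finset (Fin N → ℕ) → (Fin N → ℕ) → ℝ)
    (hpos : IsPositive I) (h : I.Nonempty) :
    ∃ i ∈ maximizers P I, step P I = I ∪ addedSet I i := by
  have hne : (maximizers P I).Nonempty := by
    obtain ⟨i, hi, hmax⟩ := (margin I).exists_max_image (P I) (margin_nonempty hN hpos h)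
    exact ⟨i, Finset.mem_filter.2 ⟨hi, hmax⟩⟩
  refine ⟨_, ?_, dif_pos hne⟩
  obtain ⟨i, hi, he⟩ := Finset.mem_map.1 (Finset.min'_mem _ (hne.map (f := toLex.toEmbedding)))
  rw [← he]
  exact hi

variable {P : Finset (Fin N → ℕ) → (Fin N → ℕ) → ℝ}

/-- Invariants of the algorithm. A step adds at least the maximizer itself and raises the largest
entry by at most one, because all additions lie in the margin. -/
theorem indexSet_spec (hN : 1 ≤ N) (ℓ : ℕ) :
    (fun _ => 1) ∈ indexSet P (ℓ + 1) ∧ IsPositive (indexSet P (ℓ + 1)) ∧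
      IsDownwardClosed (indexSet P (ℓ + 1)) ∧
      (∀ i ∈ indexSet P (ℓ + 1), ∀ n, i n ≤ ℓ + 1) ∧ ℓ + 1 ≤ (indexSet P (ℓ + 1)).card := by
  induction ℓ with
  | zero =>
    refine ⟨by simp [indexSet], ?_, ?_, ?_, by simp [indexSet]⟩
    · intro i hi n
      rw [indexSet, Finset.mem_singleton] at hi
      simp [hi]
    · intro i hi n hn
      rw [indexSet, Finset.mem_singleton] at hi
      simp [hi] at hn
    · intro i hi n
      rw [indexSet, Finset.mem_singleton] at hi
      simp [hi]
  | succ ℓ ih =>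
    obtain ⟨h1, hpos, hdc, hle, hcard⟩ := ih
    obtain ⟨i, hi, hstep⟩ := exists_step_eq hN P hpos ⟨_, h1⟩
    have him := maximizers_subset_margin _ _ hi
    rw [show indexSet P (ℓ + 1 + 1) = step P (indexSet P (ℓ + 1)) from rfl, hstep]
    refine ⟨Finset.mem_union_left _ h1, hpos.union (hpos.margin.mono (addedSet_subset_margin _ _)),
      hdc.union_addedSet i, ?_, ?_⟩
    · intro j hj n
      rcases Finset.mem_union.1 hj with h | h
      · exact (hle j h n).trans (Nat.le_succ _)
      · exact margin_le hle (addedSet_subset_margin _ _ h) n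
    · have : indexSet P (ℓ + 1) ⊂ indexSet P (ℓ + 1) ∪ addedSet (indexSet P (ℓ + 1)) i := by
        refine Finset.ssubset_iff_subset_ne.2 ⟨Finset.subset_union_left, fun he => ?_⟩
        refine (mem_margin.1 him).1 ?_
        rw [he]
        exact Finset.mem_union_right _ (self_mem_addedSet him)
      have := Finset.card_lt_card this
      omega

theorem indexSet_mono (hN : 1 ≤ N) : Monotone (indexSet P) := by
  refine monotone_nat_of_le_succ fun ℓ => ?_
  rcases ℓ with _ | ℓ
  · exact Finset.empty_subset _
  obtain ⟨h1, hpos, -⟩ := indexSet_spec (P := P) hN ℓ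
  obtain ⟨i, -, hstep⟩ := exists_step_eq hN P hpos ⟨_, h1⟩
  rw [show indexSet P (ℓ + 1 + 1) = step P (indexSet P (ℓ + 1)) from rfl, hstep]
  exact Finset.subset_union_left

/-- Positive multi-indices with entries at most `J` number at most `J ^ N`. -/
theorem card_le_pow (hpos : IsPositive I) {J : ℕ} (hJ : ∀ i ∈ I, ∀ n, i n ≤ J) :
    I.card ≤ J ^ N := by
  have : I ⊆ Fintype.piFinset fun _ : Fin N => Finset.Icc 1 J := fun i hi =>
    Fintype.mem_piFinset.2 fun n => Finset.mem_Icc.2 ⟨hpos i hi n, hJ i hi n⟩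
  simpa [Fintype.card_piFinset] using Finset.card_le_card this

/-- The step of the algorithm in which the entry `J` first occurs: all new multi-indices have the
entry `J` in the same place. -/
theorem exists_first_step (hN : 1 ≤ N) {J ℓ : ℕ} (hJ : 2 ≤ J)
    (h : ∃ j ∈ indexSet P ℓ, ∃ n, J ≤ j n) :
    ∃ k, k + 1 ≤ ℓ ∧ (∀ j ∈ indexSet P (k + 1), ∀ n, j n < J) ∧
      ∃ i ∈ maximizers P (indexSet P (k + 1)), ∃ n,
        ∀ j ∈ addedSet (indexSet P (k + 1)) i, j n = J := by
  classical
  have hex : ∃ ℓ, ∃ j ∈ indexSet P ℓ, ∃ n, J ≤ j n := ⟨ℓ, h⟩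
  have hmin : ∀ k < Nat.find hex, ∀ j ∈ indexSet P k, ∀ n, j n < J := by
    intro k hk j hj n
    by_contra! hc
    exact Nat.find_min hex hk ⟨j, hj, n, hc⟩
  have hle : Nat.find hex ≤ ℓ := Nat.find_min' hex h
  obtain ⟨j, hj, n, hn⟩ := Nat.find_spec hex
  rcases hf : Nat.find hex with _ | _ | k
  · rw [hf] at hj
    simp [indexSet] at hj
  · rw [hf] at hj
    simp [indexSet] at hj
    simp [hj] at hn
    omega
  rw [hf] at hj hle hmin
  have hlt := hmin (k + 1) (by omega)
  refine ⟨k, by omega, hlt, ?_⟩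
  obtain ⟨h1, hpos, hdc, -⟩ := indexSet_spec (P := P) hN k
  obtain ⟨i, hi, hstep⟩ := exists_step_eq hN P hpos ⟨_, h1⟩
  have him := maximizers_subset_margin _ _ hi
  rw [show indexSet P (k + 1 + 1) = step P (indexSet P (k + 1)) from rfl, hstep] at hj
  have hji : j ≤ i := by
    refine le_of_mem_addedSet hdc him ((Finset.mem_union.1 hj).resolve_left fun hjI => ?_)
    exact absurd (hlt j hjI n) (by omega)
  obtain ⟨-, n', hn', hin'⟩ := mem_margin.1 him
  have hin : J ≤ i n := hn.trans (hji n)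
  -- The predecessor of `i` has all entries below `J` while `i n ≥ J`, so the incremented coordinate
  -- must be `n`, and `i n` is exactly `J`.
  have hnn : n' = n := by
    by_contra hne
    have := hlt _ hin' n
    simp [Ne.symm hne] at this
    omega
  subst hnn
  have hiJ : i n' = J := by
    have := hlt _ hin' n'
    simp at this
    omega
  refine ⟨i, hi, n', fun j' hj' => ?_⟩
  have hj'i := le_of_mem_addedSet hdc him hj'
  have hj'm := addedSet_subset_margin _ _ hj'
  by_contra hne
  -- An added index lies below `i`. If its `n`-th entry were smaller than `J`, it would lie below
  -- the predecessor of `i`, hence already in the old set.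
  refine (mem_margin.1 hj'm).1 (hdc.mem_of_le hin' (fun l => ?_) (hpos.margin _ hj'm))
  have h3 : j' l ≤ i l := hj'i l
  by_cases hl : l = n'
  · subst hl
    rw [Pi.sub_apply, Pi.single_eq_same]
    exact Nat.le_sub_one_of_lt (by omega)
  · simpa [hl] using h3

/-! ### Profits -/

theorem work_factor_bounds {i : ℕ} (hi : 1 ≤ i) :
    1 ≤ (m i : ℝ) - m (i - 1) ∧ (2 : ℝ) ^ i / 4 ≤ (m i : ℝ) - m (i - 1) ∧
      (m i : ℝ) - m (i - 1) ≤ 2 ^ (i - 1) := by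
  rcases i with _ | _ | _ | i
  · omega
  · norm_num [m]
  · norm_num [m]
  · have h1 : m (i + 1 + 1) = 2 ^ (i + 1) + 1 := rfl
    have h2 : m (i + 1 + 1 + 1) = 2 ^ (i + 2) + 1 := rfl
    have h3 : (1 : ℝ) ≤ 2 ^ i := one_le_pow₀ one_le_two
    rw [Nat.add_sub_cancel, h1, h2]
    push_cast
    refine ⟨?_, ?_, ?_⟩ <;> ring_nf <;> linarith

theorem work_bounds {j : Fin N → ℕ} (hj : ∀ n, 1 ≤ j n) {J : ℕ} (hJ : ∀ n, j n ≤ J) :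
    0 < work j ∧ (∀ n, (2 : ℝ) ^ j n / 4 ≤ work j) ∧ work j ≤ (2 ^ (J - 1)) ^ N := by
  refine ⟨Finset.prod_pos fun n _ => zero_lt_one.trans_le (work_factor_bounds (hj n)).1,
    fun n => ?_, ?_⟩
  · refine (work_factor_bounds (hj n)).2.1.trans ?_
    rw [work, ← Finset.mul_prod_erase _ _ (Finset.mem_univ n)]
    refine le_mul_of_one_le_right (zero_le_one.trans (work_factor_bounds (hj n)).1) ?_
    exact Finset.one_le_prod fun l _ => (work_factor_bounds (hj l)).1
  · have : work j ≤ ∏ _n : Fin N, (2 : ℝ) ^ (J - 1) := by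
      refine Finset.prod_le_prod (fun n _ => zero_le_one.trans (work_factor_bounds (hj n)).1)
        fun n _ => (work_factor_bounds (hj n)).2.2.trans ?_
      exact pow_le_pow_right₀ one_le_two (by have := hJ n; omega)
    simpa using this

/-- If all multi-indices added by the profit maximizer have an entry `J` and small estimators, then
all estimators on the margin are small. -/
theorem sum_margin_le {ζ : Finset (Fin N → ℕ) → (Fin N → ℕ) → ℝ} (hζ : ∀ i, 0 ≤ ζ I i)
    (hpos : IsPositive I) {J : ℕ} (hJ : ∀ j ∈ I, ∀ n, j n < J) {i : Fin N → ℕ}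
    (hi : i ∈ maximizers (profitWithWork ζ) I) {n : Fin N} (hn : ∀ j ∈ addedSet I i, j n = J)
    {Z : ℝ} (hZ : ∀ j ∈ addedSet I i, ζ I j ≤ Z) :
    ∑ j ∈ margin I, ζ I j ≤ (J : ℝ) ^ N * (J ^ N * (2 ^ (J - 1)) ^ N * (4 * Z / 2 ^ J)) := by
  have hmpos := hpos.margin
  have hmJ : ∀ j ∈ margin I, ∀ n, j n ≤ J := fun j hj n => by
    have := hJ
    have h1 := margin_le (J := J - 1) (fun i hi n => by have := hJ i hi n; omega) hj n
    have h2 : 1 ≤ J := by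
      obtain ⟨-, l, hl, h⟩ := mem_margin.1 hj
      have := hJ _ h n
      omega
    omega
  have him := maximizers_subset_margin _ _ hi
  have hcard : ((margin I).card : ℝ) ≤ J ^ N := by exact_mod_cast card_le_pow hmpos hmJ
  have hA := addedSet_subset_margin I
  -- The cardinality of the added set cancels: each member contributes at most `Z` to the numerator,
  -- and at least `2^J / 4` to the denominator because of its entry `J`.
  have hprofit : profitWithWork ζ I i ≤ 4 * Z / 2 ^ J := by
    have hc : 0 < ((addedSet I i).card : ℝ) :=
      Nat.cast_pos.2 (Finset.card_pos.2 ⟨i, self_mem_addedSet him⟩)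
    have h1 : ∑ j ∈ addedSet I i, ζ I j ≤ (addedSet I i).card * Z := by
      simpa using Finset.sum_le_card_nsmul _ _ _ hZ
    have h2 : ((addedSet I i).card : ℝ) * (2 ^ J / 4) ≤ ∑ j ∈ addedSet I i, work j := by
      have := Finset.card_nsmul_le_sum (addedSet I i) work ((2 : ℝ) ^ J / 4) fun j hj => by
        have := (work_bounds (hmpos j (hA i hj)) (hmJ j (hA i hj))).2.1 n
        rwa [hn j hj] at this
      simpa using this
    have hZ0 : 0 ≤ Z := (hζ i).trans (hZ i (self_mem_addedSet him))
    rw [profitWithWork, div_le_iff₀ (lt_of_lt_of_le (by positivity) h2)]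
    refine h1.trans ?_
    calc ((addedSet I i).card : ℝ) * Z = 4 * Z / 2 ^ J * ((addedSet I i).card * (2 ^ J / 4)) := by
          field_simp
      _ ≤ _ := by gcongr
  have hP0 : 0 ≤ profitWithWork ζ I i := by
    refine div_nonneg (Finset.sum_nonneg fun j _ => hζ j) (Finset.sum_nonneg fun j hj => ?_)
    exact (work_bounds (hmpos j (hA i hj)) (hmJ j (hA i hj))).1.le
  -- Maximality of the profit at `i` transfers smallness to any `j`, at the price of the total work
  -- of the set added for `j`: at most `J^N` indices, each of work at most `2^((J-1)N)`.
  have hone : ∀ j ∈ margin I, ζ I j ≤ J ^ N * (2 ^ (J - 1)) ^ N * (4 * Z / 2 ^ J) := by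
    intro j hj
    have hWpos : 0 < ∑ k ∈ addedSet I j, work k := Finset.sum_pos
      (fun k hk => (work_bounds (hmpos k (hA j hk)) (hmJ k (hA j hk))).1)
      ⟨j, self_mem_addedSet hj⟩
    have hW : ∑ k ∈ addedSet I j, work k ≤ J ^ N * (2 ^ (J - 1)) ^ N := by
      have h1 := Finset.sum_le_card_nsmul (addedSet I j) work ((2 ^ (J - 1)) ^ N) fun k hk =>
        (work_bounds (hmpos k (hA j hk)) (hmJ k (hA j hk))).2.2
      have h2 : ((addedSet I j).card : ℝ) ≤ (margin I).card := by
        exact_mod_cast Finset.card_le_card (hA j)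
      rw [nsmul_eq_mul] at h1
      exact h1.trans (by gcongr; exact h2.trans hcard)
    have hle := (Finset.mem_filter.1 hi).2 j hj
    calc ζ I j ≤ ∑ k ∈ addedSet I j, ζ I k :=
          Finset.single_le_sum (f := ζ I) (fun k _ => hζ k) (self_mem_addedSet hj)
      _ = (∑ k ∈ addedSet I j, work k) * profitWithWork ζ I j := by
          rw [profitWithWork, mul_div_cancel₀ _ hWpos.ne']
      _ ≤ (∑ k ∈ addedSet I j, work k) * profitWithWork ζ I i := by gcongr
      _ ≤ J ^ N * (2 ^ (J - 1)) ^ N * (4 * Z / 2 ^ J) := by gcongr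
  have hX : 0 ≤ J ^ N * (2 ^ (J - 1)) ^ N * (4 * Z / 2 ^ J) := (hζ i).trans (hone i him)
  refine (Finset.sum_le_card_nsmul _ _ _ hone).trans ?_
  rw [nsmul_eq_mul]
  gcongr

end Algorithm

end SparseGrid

namespace SparseGrid

/-! ### Polynomial approximation of holomorphic functions -/

/-- The Joukowski map. -/
noncomputable def joukowski (w : ℂ) : ℂ := (w + w⁻¹) / 2

theorem joukowski_circle (θ : ℝ) : joukowski (circleMap 0 1 θ) = Real.cos θ := by
  rw [joukowski, circleMap_zero, Complex.ofReal_one, one_mul, ← Complex.exp_neg,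
    Complex.ofReal_cos, Complex.cos, neg_mul]

/-- The Bernstein ellipse with semi-minor axis `t` lies within distance `t` of `[-1, 1]`. -/
theorem exists_norm_joukowski_sub_le {t : ℝ} (ht : 0 < t) {w : ℂ} (h1 : 1 ≤ ‖w‖)
    (h2 : ‖w‖ ≤ t + √(1 + t ^ 2)) : ∃ x ∈ Set.Icc (-1 : ℝ) 1, ‖joukowski w - x‖ ≤ t := by
  set r := ‖w‖ with hr
  have hr0 : 0 < r := by linarith
  set c := Real.cos w.arg
  set s := Real.sin w.arg
  -- With `a = (r + 1/r)/2` and `b = (r - 1/r)/2`, the image of `w = r e^{iθ}` is `a cos θ + i b sin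
  -- θ`. Its squared distance to `cos θ` is at most `b²`, since `(a-1)² ≤ a² - 1 = b²`.
  refine ⟨c, ⟨Real.neg_one_le_cos _, Real.cos_le_one _⟩, ?_⟩
  have hcs : c ^ 2 + s ^ 2 = 1 := Real.cos_sq_add_sin_sq _
  have hb : (r - r⁻¹) / 2 ≤ t := by
    have hs : √(1 + t ^ 2) ^ 2 = 1 + t ^ 2 := Real.sq_sqrt (by positivity)
    have hs0 : 0 < √(1 + t ^ 2) := Real.sqrt_pos.2 (by positivity)
    rw [div_le_iff₀ two_pos, sub_le_iff_le_add]
    refine le_of_mul_le_mul_right ?_ hr0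
    rw [add_mul, inv_mul_cancel₀ hr0.ne']
    have hst : t < √(1 + t ^ 2) := Real.lt_sqrt_of_sq_lt (by linarith)
    nlinarith [mul_nonneg (by linarith : 0 ≤ √(1 + t ^ 2) - (r - t))
      (by linarith : 0 ≤ √(1 + t ^ 2) + (r - t))]
  have hb0 : 0 ≤ (r - r⁻¹) / 2 := by
    have : r⁻¹ ≤ 1 := inv_le_one_of_one_le₀ h1
    linarith
  have hw : w = r * (c + s * Complex.I) := by
    rw [hr, Complex.ofReal_cos, Complex.ofReal_sin]
    exact (Complex.norm_mul_cos_add_sin_mul_I w).symm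
  have hcsC : (c : ℂ) ^ 2 + (s : ℂ) ^ 2 = 1 := by exact_mod_cast hcs
  have hwi : w⁻¹ = (r⁻¹ : ℝ) * (c - s * Complex.I) := by
    refine inv_eq_of_mul_eq_one_right ?_
    rw [hw]
    have hrC : (r : ℂ) ≠ 0 := by exact_mod_cast hr0.ne'
    push_cast
    field_simp
    ring_nf
    rw [Complex.I_sq]
    linear_combination hcsC
  have e : joukowski w - c =
      (((r + r⁻¹) / 2 - 1) * c : ℝ) + ((r - r⁻¹) / 2 * s : ℝ) * Complex.I := by
    rw [joukowski, hwi]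
    nth_rw 1 [hw]
    push_cast
    ring
  rw [e]
  refine le_trans ?_ hb
  refine (le_abs_self _).trans (abs_le_of_sq_le_sq ?_ hb0)
  rw [Complex.sq_norm, Complex.normSq_add_mul_I]
  have hri : r * r⁻¹ = 1 := mul_inv_cancel₀ hr0.ne'
  have h3 : ((r + r⁻¹) / 2 - 1) ^ 2 ≤ ((r - r⁻¹) / 2) ^ 2 := by nlinarith [sq_nonneg (r - 1)]
  calc _ = ((r + r⁻¹) / 2 - 1) ^ 2 * c ^ 2 + ((r - r⁻¹) / 2) ^ 2 * s ^ 2 := by ring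
    _ ≤ ((r - r⁻¹) / 2) ^ 2 * c ^ 2 + ((r - r⁻¹) / 2) ^ 2 * s ^ 2 := by gcongr
    _ = _ := by rw [← mul_add, hcs, mul_one]

/-! ### Chebyshev coefficients of functions holomorphic on a Bernstein ellipse. -/

section Chebyshev

variable {ρ M : ℝ} {S : Set ℂ} {G : ℂ → ℂ}

/-- Cauchy's theorem on the annulus moves the contour from radius `1` to radius `ρ`, where the power
of `w` gains the factor `ρ^(-n)`. -/
theorem norm_circleIntegral_joukowski_le (hρ : 1 < ρ)
    (hS : ∀ w : ℂ, 1 ≤ ‖w‖ → ‖w‖ ≤ ρ → joukowski w ∈ S) (hG : DifferentiableOn ℂ G S)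
    (hM : ∀ z ∈ S, ‖G z‖ ≤ M) (n : ℕ) :
    ‖(2 * Real.pi * Complex.I : ℂ)⁻¹ •
      ∮ w in C(0, 1), (w ^ (n + 1))⁻¹ * G (joukowski w)‖ ≤ M * (ρ⁻¹) ^ n := by
  have hρ0 : 0 < ρ := by linarith
  have hdj : ∀ w : ℂ, w ≠ 0 → DifferentiableAt ℂ joukowski w := fun w hw =>
    (differentiableAt_id.add (differentiableAt_inv hw)).div_const _
  have hA : ∀ w ∈ Metric.closedBall (0 : ℂ) ρ \ Metric.ball 0 1, 1 ≤ ‖w‖ ∧ ‖w‖ ≤ ρ ∧ w ≠ 0 := by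
    intro w hw
    have h1 : 1 ≤ ‖w‖ := by simpa using hw.2
    exact ⟨h1, by simpa using hw.1, norm_pos_iff.1 (by linarith)⟩
  have hdiff : DifferentiableOn ℂ (fun w => (w ^ (n + 1))⁻¹ * G (joukowski w))
      (Metric.closedBall 0 ρ \ Metric.ball 0 1) := by
    intro w hw
    obtain ⟨h1, h2, h3⟩ := hA w hw
    refine DifferentiableWithinAt.mul ?_ ?_
    · exact ((differentiableAt_id.pow _).inv (pow_ne_zero _ h3)).differentiableWithinAt
    · exact (hG _ (hS w h1 h2)).comp w (hdj w h3).differentiableWithinAt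
        fun z hz => hS z (hA z hz).1 (hA z hz).2.1
  rw [← Complex.circleIntegral_eq_of_differentiable_on_annulus_off_countable zero_lt_one hρ.le
    Set.countable_empty hdiff.continuousOn]
  · refine (circleIntegral.norm_two_pi_i_inv_smul_integral_le_of_norm_le_const hρ0.le
      (C := (ρ⁻¹) ^ (n + 1) * M) fun w hw => ?_).trans (le_of_eq ?_)
    · have hw' : ‖w‖ = ρ := by simpa using hw
      rw [norm_mul, norm_inv, norm_pow, hw', inv_pow]
      gcongr
      exact hM _ (hS w (by linarith) hw'.le)
    · rw [pow_succ]
      field_simp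
  · intro w hw
    have hw1 : w ∈ Metric.ball (0 : ℂ) ρ \ Metric.closedBall 0 1 := hw.1
    have ho : IsOpen (Metric.ball (0 : ℂ) ρ \ Metric.closedBall 0 1) :=
      Metric.isOpen_ball.sdiff Metric.isClosed_closedBall
    have hsub : Metric.ball (0 : ℂ) ρ \ Metric.closedBall 0 1 ⊆
        Metric.closedBall 0 ρ \ Metric.ball 0 1 :=
      Set.sdiff_subset_sdiff Metric.ball_subset_closedBall Metric.ball_subset_closedBall
    exact (hdiff.mono hsub).differentiableAt (ho.mem_nhds hw1)

/-- Truncated Chebyshev expansion of a function that is holomorphic on a Bernstein ellipse. -/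
theorem exists_chebyshev_approx (hρ : 1 < ρ)
    (hS : ∀ w : ℂ, 1 ≤ ‖w‖ → ‖w‖ ≤ ρ → joukowski w ∈ S) (hG : DifferentiableOn ℂ G S)
    (hM : ∀ z ∈ S, ‖G z‖ ≤ M) (k : ℕ) :
    ∃ c : ℕ → ℂ, ∀ θ : ℝ, ‖G (Real.cos θ) - ∑ l ∈ Finset.range k, c l * Real.cos (l * θ)‖ ≤
      2 * M * (ρ⁻¹) ^ k / (1 - ρ⁻¹) := by
  have hρ0 : 0 < ρ := by linarith
  have hρi : ρ⁻¹ < 1 := inv_lt_one_of_one_lt₀ hρ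
  have hρi0 : 0 < ρ⁻¹ := inv_pos.2 hρ0
  have : Fact (0 < 2 * Real.pi) := ⟨Real.two_pi_pos⟩
  have hcos : ∀ θ : ℝ, (Real.cos θ : ℂ) ∈ S := fun θ => by
    rw [← joukowski_circle]
    exact hS _ (by simp) (by simp [hρ.le])
  have hM0 : 0 ≤ M := (norm_nonneg _).trans (hM _ (hcos 0))
  have hfre : ∀ θ : ℝ, (fourier 1 (θ : AddCircle (2 * Real.pi)) : ℂ).re = Real.cos θ := by
    intro θ
    rw [fourier_coe_apply]
    have : 2 * (Real.pi : ℂ) * Complex.I * (1 : ℤ) * θ / (2 * Real.pi : ℝ) = θ * Complex.I := by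
      have : (Real.pi : ℂ) ≠ 0 := by exact_mod_cast Real.pi_ne_zero
      push_cast
      field_simp
    rw [this, Complex.exp_ofReal_mul_I_re]
  -- This is `G ∘ cos` on the circle. Writing the cosine as the real part of the first character
  -- makes it descend to the quotient without choosing a representative.
  let f : C(AddCircle (2 * Real.pi), ℂ) :=
    { toFun := fun t => G ((fourier 1 t : ℂ).re : ℂ)
      continuous_toFun := by
        rw [← continuousOn_univ]
        refine hG.continuousOn.comp (by fun_prop) fun t _ => ?_
        induction t using QuotientAddGroup.induction_on with
        | H θ => rw [hfre]; exact hcos θ }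
  have hf : ∀ θ : ℝ, f θ = G (Real.cos θ) := fun θ => by
    change G ((fourier 1 (θ : AddCircle (2 * Real.pi)) : ℂ).re : ℂ) = _
    rw [hfre]
  have hfneg : ∀ t, f (-t) = f t := by
    intro t
    induction t using QuotientAddGroup.induction_on with
    | H θ =>
      have := hf (-θ)
      rw [Real.cos_neg, ← hf] at this
      exact this
  have hcneg : ∀ n : ℤ, fourierCoeff f (-n) = fourierCoeff f n := by
    intro n
    rw [fourierCoeff, fourierCoeff, ← integral_neg_eq_self]
    refine integral_congr_ae (Filter.Eventually.of_forall fun t => ?_)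
    simp only [hfneg, fourier_apply, smul_neg, neg_smul, neg_neg]
  have hcoef : ∀ n : ℕ, ‖fourierCoeff f n‖ ≤ M * (ρ⁻¹) ^ n := by
    intro n
    refine le_trans (le_of_eq ?_) (norm_circleIntegral_joukowski_le hρ hS hG hM n)
    rw [fourierCoeff_eq_intervalIntegral f n 0, circleIntegral, zero_add]
    have e : ∀ θ : ℝ, deriv (circleMap 0 1) θ •
        (((circleMap 0 1 θ) ^ (n + 1))⁻¹ * G (joukowski (circleMap 0 1 θ))) =
        Complex.I * (fourier (-(n : ℤ)) (θ : AddCircle (2 * Real.pi)) • f θ) := by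
      intro θ
      rw [joukowski_circle, hf, deriv_circleMap, fourier_coe_apply]
      have h2 : 2 * (Real.pi : ℂ) * Complex.I * (-(n : ℤ) : ℤ) * θ / (2 * Real.pi : ℝ) =
          -(n * (θ * Complex.I)) := by
        have : (Real.pi : ℂ) ≠ 0 := by exact_mod_cast Real.pi_ne_zero
        push_cast
        field_simp
      rw [h2, Complex.exp_neg, Complex.exp_nat_mul, circleMap_zero, Complex.ofReal_one, one_mul]
      have := Complex.exp_ne_zero (θ * Complex.I)
      simp only [smul_eq_mul]
      field_simp
      ring
    simp only [e]
    rw [intervalIntegral.integral_const_mul, norm_smul, norm_smul, norm_mul, Complex.norm_I,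
      one_mul, norm_inv, norm_mul, Complex.norm_I, mul_one]
    simp
  have hgeo : Summable fun n : ℕ => M * (ρ⁻¹) ^ n :=
    (summable_geometric_of_lt_one hρi0.le hρi).mul_left M
  have hsum : Summable (fourierCoeff f) := by
    refine Summable.of_nat_of_neg ?_ ?_
    · exact Summable.of_norm_bounded hgeo hcoef
    · exact Summable.of_norm_bounded hgeo fun n => by rw [hcneg]; exact hcoef n
  rcases Nat.eq_zero_or_pos k with rfl | hk
  · refine ⟨0, fun θ => ?_⟩
    rw [Finset.sum_range_zero, sub_zero, pow_zero, mul_one, le_div_iff₀ (by linarith)]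
    have := hM _ (hcos θ)
    nlinarith [norm_nonneg (G (Real.cos θ))]
  -- Pairing `n` with `-n` counts index `0` twice. Hence the undoubled coefficient here, and the
  -- extra zeroth term added to `f θ` below.
  refine ⟨fun l => if l = 0 then fourierCoeff f 0 else 2 * fourierCoeff f l, fun θ => ?_⟩
  have hs := (has_pointwise_sum_fourier_series_of_summable hsum (θ : AddCircle (2 * Real.pi)))
  have hs2 := hs.nat_add_neg
  have hterm : ∀ n : ℕ, fourierCoeff f n • fourier n (θ : AddCircle (2 * Real.pi)) +
      fourierCoeff f (-n : ℤ) • fourier (-n : ℤ) (θ : AddCircle (2 * Real.pi)) =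
      2 * fourierCoeff f n * Real.cos (n * θ) := by
    intro n
    have h2 : ∀ n : ℤ, 2 * (Real.pi : ℂ) * Complex.I * n * θ / (2 * Real.pi : ℝ) =
        n * θ * Complex.I := by
      have : (Real.pi : ℂ) ≠ 0 := by exact_mod_cast Real.pi_ne_zero
      intro n
      push_cast
      field_simp
    rw [hcneg, fourier_coe_apply, fourier_coe_apply, h2, h2, Complex.ofReal_cos, Complex.cos]
    push_cast
    simp only [smul_eq_mul, neg_mul]
    ring
  simp only [hterm] at hs2
  rw [← hasSum_nat_add_iff' k] at hs2
  have e : G (Real.cos θ) - ∑ l ∈ Finset.range k,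
      (if l = 0 then fourierCoeff f 0 else 2 * fourierCoeff f l) * Real.cos (l * θ) =
      f θ + fourierCoeff f 0 • fourier 0 (θ : AddCircle (2 * Real.pi)) -
      ∑ n ∈ Finset.range k, 2 * fourierCoeff f n * Real.cos (n * θ) := by
    obtain ⟨k, rfl⟩ := Nat.exists_eq_succ_of_ne_zero hk.ne'
    rw [Finset.sum_range_succ', Finset.sum_range_succ', hf]
    simp
    ring
  rw [e]
  refine le_of_le_of_eq (hs2.norm_le_of_bounded
    (g := fun n => 2 * M * (ρ⁻¹) ^ k * (ρ⁻¹) ^ n) ((hasSum_geometric_of_lt_one hρi0.le hρi).mul_left _)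
    fun n => ?_) (by rw [div_eq_mul_inv])
  rw [norm_mul, norm_mul, RCLike.norm_ofNat, Complex.norm_real, Real.norm_eq_abs]
  calc 2 * ‖fourierCoeff f (n + k : ℕ)‖ * |Real.cos ((n + k : ℕ) * θ)|
      ≤ 2 * (M * (ρ⁻¹) ^ (n + k)) * 1 := by
        gcongr
        · exact hcoef _
        · exact Real.abs_cos_le_one _
    _ = _ := by rw [pow_add]; ring

end Chebyshev

/-- The parameter of the largest Bernstein ellipse in the `t`-neighbourhood of `[-1, 1]`. -/
noncomputable def bernstein (t : ℝ) : ℝ := t + √(1 + t ^ 2)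

theorem one_lt_bernstein {t : ℝ} (ht : 0 < t) : 1 < bernstein t := by
  have : 1 ≤ √(1 + t ^ 2) := Real.one_le_sqrt.2 (by nlinarith)
  unfold bernstein
  linarith

/-- The commutator of interpolation and multiplication by the variable is exponentially small on
holomorphic functions. -/
theorem norm_sum_basis_sub_node_le {p q τ M : ℝ} (hpq : p < q) (hτ : 0 < τ)
    {F : Type*} [NormedAddCommGroup F] [NormedSpace ℂ F] {G : ℂ → F}
    (hG : DifferentiableOn ℂ G {z | Metric.infDist z (Complex.ofReal '' Set.Icc p q) ≤ τ})
    (hM : ∀ z, Metric.infDist z (Complex.ofReal '' Set.Icc p q) ≤ τ → ‖G z‖ ≤ M)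
    (i : ℕ) {y : ℝ} (hy : y ∈ Set.Icc p q) :
    ‖∑ j, (((Lagrange.basis Finset.univ (node p q (m i)) j).eval y *
        (y - node p q (m i) j) : ℝ) : ℂ) • G (node p q (m i) j)‖ ≤
      8 * i * ((q - p) * (2 * M * (bernstein (2 * τ / (q - p)))⁻¹ ^ (m i - 1) /
        (1 - (bernstein (2 * τ / (q - p)))⁻¹))) := by
  have hqp : 0 < q - p := by linarith
  set t := 2 * τ / (q - p) with ht
  have ht0 : 0 < t := by positivity
  set ρ := bernstein t with hρ
  have hρ1 : 1 < ρ := one_lt_bernstein ht0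
  set S := {z | Metric.infDist z (Complex.ofReal '' Set.Icc p q) ≤ τ} with hS
  -- A norming functional reduces the vector-valued estimate to a scalar holomorphic function.
  obtain ⟨φ, hφ1, hφ⟩ := exists_dual_vector'' ℂ (∑ j, (((Lagrange.basis Finset.univ
    (node p q (m i)) j).eval y * (y - node p q (m i) j) : ℝ) : ℂ) • G (node p q (m i) j))
  let A : ℂ → ℂ := fun z => (((p + q) / 2 : ℝ) : ℂ) + (((q - p) / 2 : ℝ) : ℂ) * z
  have hAS : ∀ w : ℂ, 1 ≤ ‖w‖ → ‖w‖ ≤ ρ → joukowski w ∈ A ⁻¹' S := by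
    intro w h1 h2
    obtain ⟨x, hx, hxw⟩ := exists_norm_joukowski_sub_le ht0 h1 h2
    have hx' : (((p + q) / 2 + (q - p) / 2 * x : ℝ) : ℂ) ∈ Complex.ofReal '' Set.Icc p q :=
      ⟨_, ⟨by nlinarith [hx.1], by nlinarith [hx.2]⟩, rfl⟩
    refine (Metric.infDist_le_dist_of_mem hx').trans ?_
    have e : A (joukowski w) - (((p + q) / 2 + (q - p) / 2 * x : ℝ) : ℂ) =
        (((q - p) / 2 : ℝ) : ℂ) * (joukowski w - x) := by
      simp only [A]
      push_cast
      ring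
    rw [dist_eq_norm, e, norm_mul, Complex.norm_real, Real.norm_of_nonneg (by positivity)]
    calc (q - p) / 2 * ‖joukowski w - x‖ ≤ (q - p) / 2 * t := by gcongr
      _ = τ := by rw [ht]; field_simp
  have hdiff : DifferentiableOn ℂ (fun z => φ (G (A z))) (A ⁻¹' S) := by
    refine φ.differentiable.comp_differentiableOn (hG.comp ?_ fun z hz => hz)
    exact Differentiable.differentiableOn (by fun_prop)
  have hbd : ∀ z ∈ A ⁻¹' S, ‖φ (G (A z))‖ ≤ M := fun z hz => by
    refine (φ.le_opNorm _).trans ?_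
    calc ‖φ‖ * ‖G (A z)‖ ≤ 1 * ‖G (A z)‖ := by gcongr
      _ ≤ M := by rw [one_mul]; exact hM _ hz
  obtain ⟨c, hc⟩ := exists_chebyshev_approx hρ1 hAS hdiff hbd (m i - 1)
  set ε := 2 * M * ρ⁻¹ ^ (m i - 1) / (1 - ρ⁻¹) with hε
  let B : Polynomial ℝ := Polynomial.C (2 / (q - p)) * Polynomial.X -
    Polynomial.C ((p + q) / (q - p))
  let T : ℕ → Polynomial ℝ := fun l => (Polynomial.Chebyshev.T ℝ l).comp B
  have hTdeg : ∀ l, (T l).natDegree ≤ l := by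
    intro l
    refine Polynomial.natDegree_comp_le.trans ?_
    have hB : B.natDegree ≤ 1 := by
      refine (Polynomial.natDegree_sub_le _ _).trans (max_le ?_ (by simp))
      exact (Polynomial.natDegree_C_mul_le _ _).trans Polynomial.natDegree_X_le
    rw [Polynomial.Chebyshev.natDegree_T]
    calc _ ≤ (l : ℤ).natAbs * 1 := Nat.mul_le_mul_left _ hB
      _ = l := by simp
  have happrox : ∀ x ∈ Set.Icc p q, ‖φ (G x) - ∑ l ∈ Finset.range (m i - 1),
      c l * ((T l).eval x : ℝ)‖ ≤ ε := by
    intro x hx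
    obtain ⟨s, hs, rfl⟩ := exists_affine_coord hpq hx
    have hsc := Real.cos_arccos hs.1 hs.2
    have := hc (Real.arccos s)
    have hB : B.eval ((p + q) / 2 + (q - p) / 2 * s) = s := by
      simp only [B, Polynomial.eval_sub, Polynomial.eval_mul, Polynomial.eval_C, Polynomial.eval_X]
      field_simp
      ring
    have hT : ∀ l : ℕ, (T l).eval ((p + q) / 2 + (q - p) / 2 * s) =
        Real.cos (l * Real.arccos s) := by
      intro l
      rw [Polynomial.eval_comp, hB]
      nth_rw 1 [← hsc]
      rw [Polynomial.Chebyshev.T_real_cos]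
      simp
    rw [hsc] at this
    simp only [hT]
    convert this using 5
    simp only [A]
    push_cast
    rfl
  -- The factor `y - X` uses up one degree, which is why only `m i - 1` Chebyshev terms are
  -- subtracted. The product is interpolated exactly, and it vanishes at `y`.
  have hzero : ∀ l ∈ Finset.range (m i - 1),
      ∑ j, (Lagrange.basis Finset.univ (node p q (m i)) j).eval y *
        ((y - node p q (m i) j) * (T l).eval (node p q (m i) j)) = 0 := by
    intro l hl
    have hl' := Finset.mem_range.1 hl
    have := sum_basis_node_eval hpq (k := m i) (P := (Polynomial.C y - Polynomial.X) * T l) ?_ y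
    · simpa using this
    · refine lt_of_le_of_lt Polynomial.degree_le_natDegree (Nat.cast_lt.2 ?_)
      refine lt_of_le_of_lt Polynomial.natDegree_mul_le ?_
      have h1 : (Polynomial.C y - Polynomial.X : Polynomial ℝ).natDegree ≤ 1 :=
        (Polynomial.natDegree_sub_le _ _).trans (max_le (by simp) Polynomial.natDegree_X_le)
      have := hTdeg l
      omega
  have key : φ (∑ j, (((Lagrange.basis Finset.univ (node p q (m i)) j).eval y *
      (y - node p q (m i) j) : ℝ) : ℂ) • G (node p q (m i) j)) =
      ∑ j, (((Lagrange.basis Finset.univ (node p q (m i)) j).eval y *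
      (y - node p q (m i) j) : ℝ) : ℂ) * (φ (G (node p q (m i) j)) -
        ∑ l ∈ Finset.range (m i - 1), c l * ((T l).eval (node p q (m i) j) : ℝ)) := by
    simp only [map_sum, map_smul, smul_eq_mul, mul_sub, Finset.sum_sub_distrib]
    rw [eq_comm, sub_eq_self]
    simp only [Finset.mul_sum]
    rw [Finset.sum_comm]
    refine Finset.sum_eq_zero fun l hl => ?_
    have := congrArg (fun x : ℝ => c l * (x : ℂ)) (hzero l hl)
    simp only [Complex.ofReal_zero, mul_zero] at this
    rw [← this]
    push_cast
    rw [Finset.mul_sum]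
    refine Finset.sum_congr rfl fun j _ => ?_
    ring
  have hε0 : 0 ≤ ε := (norm_nonneg _).trans (happrox y hy)
  have h2 : ‖∑ j, (((Lagrange.basis Finset.univ (node p q (m i)) j).eval y *
      (y - node p q (m i) j) : ℝ) : ℂ) • G (node p q (m i) j)‖ =
      ‖φ (∑ j, (((Lagrange.basis Finset.univ (node p q (m i)) j).eval y *
      (y - node p q (m i) j) : ℝ) : ℂ) • G (node p q (m i) j))‖ := by
    rw [hφ]
    simp
  rw [h2, key]
  calc _ ≤ ∑ j, |(Lagrange.basis Finset.univ (node p q (m i)) j).eval y| * ((q - p) * ε) := by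
        refine norm_sum_le_of_le _ fun j _ => ?_
        have hj := node_mem hpq.le (m i) j
        rw [norm_mul, Complex.norm_real, Real.norm_eq_abs, abs_mul, mul_assoc]
        gcongr
        · rw [abs_le]
          constructor <;> linarith [hj.1, hj.2, hy.1, hy.2]
        · exact happrox _ hj
    _ ≤ 8 * i * ((q - p) * ε) := by
        rw [← Finset.sum_mul]
        gcongr
        exact sum_abs_eval_basis_node_le hpq i hy

end SparseGrid

namespace SparseGrid

/-! ### Multiplication operators -/

section MulOp

variable {X : Type*} [MeasurableSpace X] {μ : Measure X} {𝕜 F : Type*} [RCLike 𝕜]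
  [NormedAddCommGroup F] [NormedSpace 𝕜 F]

theorem memLp_smul_of_bound {b : X → 𝕜} (hb : AEStronglyMeasurable b μ) {K : ℝ}
    (hK : ∀ᵐ x ∂μ, ‖b x‖ ≤ K) (g : Lp F 2 μ) : MemLp (fun x => b x • g x) 2 μ := by
  refine (Lp.memLp g).of_le_mul (c := K) (hb.smul (Lp.aestronglyMeasurable g)) ?_
  filter_upwards [hK] with x hx
  rw [norm_smul]
  gcongr

/-- Multiplication by a bounded function as an operator on `L²`. -/
theorem exists_mulOp {b : X → 𝕜} (hb : AEStronglyMeasurable b μ) {K : ℝ}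
    (hK : ∀ᵐ x ∂μ, ‖b x‖ ≤ K) : ∃ A : Lp F 2 μ →L[𝕜] Lp F 2 μ,
      (∀ g : Lp F 2 μ, A g =ᵐ[μ] fun x => b x • g x) ∧ ∀ g, ‖A g‖ ≤ K * ‖g‖ := by
  have hm := fun g : Lp F 2 μ => memLp_smul_of_bound hb hK g
  have hc : ∀ g, (hm g).toLp _ =ᵐ[μ] fun x => b x • g x := fun g => (hm g).coeFn_toLp
  have hn : ∀ g, ‖(hm g).toLp _‖ ≤ K * ‖g‖ := fun g => by
    refine Lp.norm_le_mul_norm_of_ae_le_mul ?_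
    filter_upwards [hK, hc g] with x hx h
    rw [h, norm_smul]
    gcongr
  refine ⟨LinearMap.mkContinuous
    { toFun := fun g => (hm g).toLp _
      map_add' := fun g h => ?_
      map_smul' := fun c g => ?_ } K hn, hc, hn⟩
  · refine Lp.ext ?_
    filter_upwards [hc (g + h), hc g, hc h, Lp.coeFn_add g h,
      Lp.coeFn_add ((hm g).toLp _) ((hm h).toLp _)] with x h1 h2 h3 h4 h5
    rw [h1, h5, Pi.add_apply, h2, h3, h4, Pi.add_apply, smul_add]
  · refine Lp.ext ?_
    filter_upwards [hc (c • g), hc g, Lp.coeFn_smul c g,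
      Lp.coeFn_smul c ((hm g).toLp _)] with x h1 h2 h3 h4
    rw [RingHom.id_apply, h1, h4, Pi.smul_apply, h2, h3, Pi.smul_apply, smul_comm]

end MulOp

/-! ### Change of scalars in `H¹₀` -/

section Scalars

variable {𝕜 𝕜' : Type} [RCLike 𝕜] [RCLike 𝕜'] {d : ℕ} {D : Set (EuclideanSpace ℝ (Fin d))}

/-- The gradient as a continuous linear map. -/
noncomputable def gradL (𝕜 : Type) [RCLike 𝕜] {d : ℕ} (D : Set (EuclideanSpace ℝ (Fin d))) :
    H10 𝕜 D →L[𝕜] L2 D (EuclideanSpace 𝕜 (Fin d)) :=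
  (WithLp.sndL 2 𝕜 (L2 D 𝕜) (L2 D (EuclideanSpace 𝕜 (Fin d)))).comp (H10 𝕜 D).subtypeL

theorem gradL_apply (v : H10 𝕜 D) : gradL 𝕜 D v = grad v := rfl

/-- The embedding into `L²` as a continuous linear map. -/
noncomputable def toL2L (𝕜 : Type) [RCLike 𝕜] {d : ℕ} (D : Set (EuclideanSpace ℝ (Fin d))) :
    H10 𝕜 D →L[𝕜] L2 D 𝕜 :=
  (WithLp.fstL 2 𝕜 (L2 D 𝕜) (L2 D (EuclideanSpace 𝕜 (Fin d)))).comp (H10 𝕜 D).subtypeL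

theorem toL2L_apply (v : H10 𝕜 D) : toL2L 𝕜 D v = toL2 v := rfl

/-- A map of scalars applied to all components of a vector. -/
noncomputable def mapVec (L : 𝕜 →L[ℝ] 𝕜') (d : ℕ) :
    EuclideanSpace 𝕜 (Fin d) →L[ℝ] EuclideanSpace 𝕜' (Fin d) :=
  ((PiLp.continuousLinearEquiv 2 ℝ fun _ : Fin d => 𝕜').symm : _ →L[ℝ] _).comp
    ((ContinuousLinearMap.pi fun j => L.comp (ContinuousLinearMap.proj j)).comp
      ((PiLp.continuousLinearEquiv 2 ℝ fun _ : Fin d => 𝕜) :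
        PiLp 2 (fun _ : Fin d => 𝕜) →L[ℝ] (Fin d → 𝕜)))

theorem mapVec_apply (L : 𝕜 →L[ℝ] 𝕜') (x : EuclideanSpace 𝕜 (Fin d)) (j : Fin d) :
    mapVec L d x j = L (x j) := rfl

theorem classicalGrad_comp (L : 𝕜 →L[ℝ] 𝕜') {φ : EuclideanSpace ℝ (Fin d) → 𝕜}
    (hφ : Differentiable ℝ φ) (x : EuclideanSpace ℝ (Fin d)) :
    classicalGrad (fun x => L (φ x)) x = mapVec L d (classicalGrad φ x) := by
  ext j
  rw [mapVec_apply]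
  have : fderiv ℝ (fun x => L (φ x)) x = L.comp (fderiv ℝ φ x) :=
    (L.hasFDerivAt.comp x (hφ x).hasFDerivAt).fderiv
  simp [classicalGrad, this]

/-- The componentwise map is continuous and sends test pairs to test pairs, so it maps the closure
into the closure. It provides real parts, imaginary parts and complexifications. -/
theorem exists_map_scalars (L : 𝕜 →L[ℝ] 𝕜') (v : H10 𝕜 D) : ∃ w : H10 𝕜' D,
    toL2 w = L.compLpL 2 _ (toL2 v) ∧ grad w = (mapVec L d).compLpL 2 _ (grad v) := by
  let Φ : PairSpace 𝕜 D → PairSpace 𝕜' D := fun p =>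
    WithLp.toLp 2 (L.compLpL 2 _ p.fst, (mapVec L d).compLpL 2 _ p.snd)
  have hΦ : Continuous Φ := by
    refine (WithLp.prod_continuous_toLp 2 _ _).comp (Continuous.prodMk ?_ ?_)
    · exact (L.compLpL 2 _).continuous.comp (WithLp.fstL 2 𝕜 _ _).continuous
    · exact ((mapVec L d).compLpL 2 _).continuous.comp (WithLp.sndL 2 𝕜 _ _).continuous
  refine ⟨⟨Φ v.1, map_mem_closure hΦ v.2 ?_⟩, rfl, rfl⟩
  rintro p ⟨φ, hφ, h1, h2⟩
  refine ⟨fun x => L (φ x), ⟨L.contDiff.comp hφ.smooth, hφ.compact.comp_left L.map_zero, ?_⟩,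
    ?_, ?_⟩
  · exact (closure_mono (Function.support_comp_subset L.map_zero φ)).trans hφ.subset
  · filter_upwards [L.coeFn_compLpL (p := 2) p.fst, h1] with x h h'
    rw [← h']
    exact h
  · filter_upwards [(mapVec L d).coeFn_compLpL (p := 2) p.snd, h2] with x h h'
    rw [classicalGrad_comp L (hφ.smooth.differentiable (by simp)), ← h']
    exact h

/-- The complexification of real vectors. -/
noncomputable abbrev ofRealVec (d : ℕ) :
    EuclideanSpace ℝ (Fin d) →L[ℝ] EuclideanSpace ℂ (Fin d) := mapVec Complex.ofRealCLM d

theorem inner_ofRealVec (x y : EuclideanSpace ℝ (Fin d)) :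
    inner ℂ (ofRealVec d x) (ofRealVec d y) = (inner ℝ x y : ℝ) := by
  simp [PiLp.inner_apply, mapVec_apply]

theorem norm_ofRealVec (x : EuclideanSpace ℝ (Fin d)) : ‖ofRealVec d x‖ = ‖x‖ := by
  simp [EuclideanSpace.norm_eq, mapVec_apply]

/-- The complexification of real vector fields. -/
noncomputable abbrev ofRealField (D : Set (EuclideanSpace ℝ (Fin d))) :
    L2 D (EuclideanSpace ℝ (Fin d)) →L[ℝ] L2 D (EuclideanSpace ℂ (Fin d)) :=
  (ofRealVec d).compLpL 2 (volume.restrict D)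

theorem norm_ofRealField (g : L2 D (EuclideanSpace ℝ (Fin d))) : ‖ofRealField D g‖ = ‖g‖ := by
  rw [Lp.norm_def, Lp.norm_def]
  congr 1
  refine eLpNorm_congr_norm_ae ?_
  filter_upwards [(ofRealVec d).coeFn_compLpL (p := 2) g] with x h
  rw [h, norm_ofRealVec]

/-- The complexification of real functions. -/
noncomputable abbrev ofRealFun (D : Set (EuclideanSpace ℝ (Fin d))) : L2 D ℝ →L[ℝ] L2 D ℂ :=
  Complex.ofRealCLM.compLpL 2 (volume.restrict D)

theorem exists_complexification (v : H10 ℝ D) :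
    ∃ w : H10 ℂ D, toL2 w = ofRealFun D (toL2 v) ∧ grad w = ofRealField D (grad v) :=
  exists_map_scalars Complex.ofRealCLM v

theorem exists_re_im (w : H10 ℂ D) : ∃ v₁ v₂ : H10 ℝ D,
    toL2 w = ofRealFun D (toL2 v₁) + Complex.I • ofRealFun D (toL2 v₂) ∧
    grad w = ofRealField D (grad v₁) + Complex.I • ofRealField D (grad v₂) := by
  obtain ⟨v₁, h1, h1'⟩ := exists_map_scalars Complex.reCLM w
  obtain ⟨v₂, h2, h2'⟩ := exists_map_scalars Complex.imCLM w
  refine ⟨v₁, v₂, ?_, ?_⟩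
  · rw [h1, h2]
    refine Lp.ext ?_
    filter_upwards [Lp.coeFn_add (ofRealFun D (Complex.reCLM.compLpL 2 _ (toL2 w)))
        (Complex.I • ofRealFun D (Complex.imCLM.compLpL 2 _ (toL2 w))),
      Lp.coeFn_smul Complex.I (ofRealFun D (Complex.imCLM.compLpL 2 _ (toL2 w))),
      Complex.ofRealCLM.coeFn_compLpL (p := 2) (Complex.reCLM.compLpL 2 _ (toL2 w)),
      Complex.ofRealCLM.coeFn_compLpL (p := 2) (Complex.imCLM.compLpL 2 _ (toL2 w)),
      Complex.reCLM.coeFn_compLpL (p := 2) (toL2 w),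
      Complex.imCLM.coeFn_compLpL (p := 2) (toL2 w)] with x e1 e2 e3 e4 e5 e6
    rw [e1, Pi.add_apply, e2, Pi.smul_apply, e3, e4, e5, e6]
    simp [mul_comm Complex.I]
  · rw [h1', h2']
    refine Lp.ext ?_
    filter_upwards [Lp.coeFn_add (ofRealField D ((mapVec Complex.reCLM d).compLpL 2 _ (grad w)))
        (Complex.I • ofRealField D ((mapVec Complex.imCLM d).compLpL 2 _ (grad w))),
      Lp.coeFn_smul Complex.I (ofRealField D ((mapVec Complex.imCLM d).compLpL 2 _ (grad w))),
      (ofRealVec d).coeFn_compLpL (p := 2) ((mapVec Complex.reCLM d).compLpL 2 _ (grad w)),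
      (ofRealVec d).coeFn_compLpL (p := 2) ((mapVec Complex.imCLM d).compLpL 2 _ (grad w)),
      (mapVec Complex.reCLM d).coeFn_compLpL (p := 2) (grad w),
      (mapVec Complex.imCLM d).coeFn_compLpL (p := 2) (grad w)] with x e1 e2 e3 e4 e5 e6
    rw [e1, Pi.add_apply, e2, Pi.smul_apply, e3, e4, e5, e6]
    ext j
    simp [mapVec_apply, mul_comm Complex.I]

end Scalars

/-! ### The weak gradient is determined by the function -/

section WeakGradient

variable {𝕜 : Type} [RCLike 𝕜] {d : ℕ} {D : Set (EuclideanSpace ℝ (Fin d))}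

theorem IsTestFunction.fderiv_eq_zero {φ : EuclideanSpace ℝ (Fin d) → 𝕜} (hφ : IsTestFunction D φ)
    {x : EuclideanSpace ℝ (Fin d)} (hx : x ∉ D) : φ x = 0 ∧ fderiv ℝ φ x = 0 := by
  have hx' : x ∉ tsupport φ := fun h => hx (hφ.subset h)
  exact ⟨image_eq_zero_of_notMem_tsupport hx', fderiv_of_notMem_tsupport ℝ hx'⟩

theorem IsTestFunction.continuous_fderiv_apply {φ : EuclideanSpace ℝ (Fin d) → 𝕜}
    (hφ : IsTestFunction D φ) (v : EuclideanSpace ℝ (Fin d)) :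
    Continuous fun x => fderiv ℝ φ x v :=
  (hφ.smooth.continuous_fderiv (by simp)).clm_apply continuous_const

theorem IsTestFunction.hasCompactSupport_fderiv_apply {φ : EuclideanSpace ℝ (Fin d) → 𝕜}
    (hφ : IsTestFunction D φ) (v : EuclideanSpace ℝ (Fin d)) :
    HasCompactSupport fun x => fderiv ℝ φ x v :=
  (hφ.compact.fderiv ℝ).comp_left (g := fun L : EuclideanSpace ℝ (Fin d) →L[ℝ] 𝕜 => L v) rfl

/-- Integration by parts holds for smooth compactly supported functions, and it is a closed
condition on the pair of function and gradient. -/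
theorem integral_test_eq {ψ : EuclideanSpace ℝ (Fin d) → ℝ} (hψ : IsTestFunction D ψ)
    (j : Fin d) (v : H10 𝕜 D) :
    ∫ x in D, fderiv ℝ ψ x (EuclideanSpace.single j 1) • toL2 v x =
      -∫ x in D, ψ x • grad v x j := by
  set e := EuclideanSpace.single j (1 : ℝ)
  have hc1 := hψ.continuous_fderiv_apply e
  have hs1 := hψ.hasCompactSupport_fderiv_apply e
  have hm1 : MemLp (fun x => (algebraMap ℝ 𝕜) (fderiv ℝ ψ x e)) 2 (volume.restrict D) :=
    (((RCLike.continuous_ofReal.comp hc1).memLp_of_hasCompactSupport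
      (hs1.comp_left (g := algebraMap ℝ 𝕜) (map_zero _))).restrict D)
  have hm2 : MemLp (fun x => EuclideanSpace.single j ((algebraMap ℝ 𝕜) (ψ x))) 2
      (volume.restrict D) := by
    refine (Continuous.memLp_of_hasCompactSupport ?_ ?_).restrict D
    · have : Continuous fun c : 𝕜 => EuclideanSpace.single j c :=
        (PiLp.continuous_toLp 2 _).comp (continuous_single (A := fun _ : Fin d => 𝕜) j)
      exact this.comp (RCLike.continuous_ofReal.comp hψ.smooth.continuous)
    · exact hψ.compact.comp_left (g := fun c => EuclideanSpace.single j ((algebraMap ℝ 𝕜) c))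
        (by simp)
  have key : ∀ p ∈ H10 𝕜 D, inner 𝕜 (hm1.toLp _) p.fst + inner 𝕜 (hm2.toLp _) p.snd = 0 := by
    have hcl : IsClosed {p : PairSpace 𝕜 D |
        inner 𝕜 (hm1.toLp _) p.fst + inner 𝕜 (hm2.toLp _) p.snd = 0} := by
      refine isClosed_eq (Continuous.add ?_ ?_) continuous_const
      · exact continuous_const.inner (WithLp.fstL 2 𝕜 _ _).continuous
      · exact continuous_const.inner (WithLp.sndL 2 𝕜 _ _).continuous
    intro p hp
    refine closure_minimal ?_ hcl hp
    rintro q ⟨φ, hφ, h1, h2⟩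
    have e1 : inner 𝕜 (hm1.toLp _) q.fst = ∫ x in D, fderiv ℝ ψ x e • φ x := by
      rw [L2.inner_def]
      refine integral_congr_ae ?_
      filter_upwards [hm1.coeFn_toLp, h1] with x hx hx'
      rw [hx, hx', RCLike.inner_apply, RCLike.algebraMap_eq_ofReal, RCLike.conj_ofReal, mul_comm,
        RCLike.real_smul_eq_coe_mul]
    have e2 : inner 𝕜 (hm2.toLp _) q.snd = ∫ x in D, ψ x • fderiv ℝ φ x e := by
      rw [L2.inner_def]
      refine integral_congr_ae ?_
      filter_upwards [hm2.coeFn_toLp, h2] with x hx hx'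
      rw [hx, hx', EuclideanSpace.inner_single_left, RCLike.algebraMap_eq_ofReal,
        RCLike.conj_ofReal, RCLike.real_smul_eq_coe_mul]
      rfl
    rw [Set.mem_ofPred_eq, e1, e2,
      setIntegral_eq_integral_of_forall_compl_eq_zero fun x hx => by
        rw [(hψ.fderiv_eq_zero hx).2]; simp,
      setIntegral_eq_integral_of_forall_compl_eq_zero fun x hx => by
        rw [(hψ.fderiv_eq_zero hx).1]; simp,
      integral_smul_fderiv_eq_neg_fderiv_smul_of_integrable, add_neg_cancel]
    · exact (hc1.smul hφ.smooth.continuous).integrable_of_hasCompactSupport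
        (hs1.smul_right)
    · exact (hψ.smooth.continuous.smul (hφ.continuous_fderiv_apply e)).integrable_of_hasCompactSupport
        hψ.compact.smul_right
    · exact (hψ.smooth.continuous.smul hφ.smooth.continuous).integrable_of_hasCompactSupport
        hψ.compact.smul_right
    · exact fun x _ => hψ.smooth.differentiable (by simp) x
    · exact fun x _ => hφ.smooth.differentiable (by simp) x
  have h := key v.1 v.2
  rw [add_eq_zero_iff_eq_neg, L2.inner_def, L2.inner_def] at h
  refine Eq.trans (integral_congr_ae ?_) (h.trans (congrArg Neg.neg (integral_congr_ae ?_)))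
  · filter_upwards [hm1.coeFn_toLp] with x hx
    rw [hx, RCLike.inner_apply, RCLike.algebraMap_eq_ofReal, RCLike.conj_ofReal, mul_comm,
      RCLike.real_smul_eq_coe_mul]
    rfl
  · filter_upwards [hm2.coeFn_toLp] with x hx
    rw [hx, EuclideanSpace.inner_single_left, RCLike.algebraMap_eq_ofReal,
      RCLike.conj_ofReal, RCLike.real_smul_eq_coe_mul]
    rfl

/-- The extension property compares only the underlying `L²` functions. The fundamental lemma of the
calculus of variations, one component at a time, transfers the comparison to gradients. -/
theorem grad_eq_zero (hDopen : IsOpen D) (hDbdd : Bornology.IsBounded D) {v : H10 𝕜 D}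
    (hv : toL2 v = 0) : grad v = 0 := by
  have hfin : IsFiniteMeasure (volume.restrict D) :=
    ⟨by rw [Measure.restrict_apply_univ]; exact hDbdd.measure_lt_top⟩
  have hj : ∀ j, ∀ᵐ x ∂volume, x ∈ D → grad v x j = 0 := by
    intro j
    have hint : IntegrableOn (fun x => grad v x j) D volume := by
      refine MemLp.integrable (q := 2) (by norm_num) ?_
      refine (Lp.memLp (grad v)).of_le_mul (c := 1) ?_ (Filter.Eventually.of_forall fun x => ?_)
      · exact (EuclideanSpace.proj j : _ →L[𝕜] 𝕜).continuous.comp_aestronglyMeasurable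
          (Lp.aestronglyMeasurable _)
      · rw [one_mul]
        exact PiLp.norm_apply_le _ j
    refine hDopen.ae_eq_zero_of_integral_contDiff_smul_eq_zero hint.locallyIntegrableOn
      fun ψ h1 h2 h3 => ?_
    have hψ : IsTestFunction D ψ := ⟨h1, h2, h3⟩
    have h := integral_test_eq hψ j v
    have h0 : ∫ x in D, fderiv ℝ ψ x (EuclideanSpace.single j 1) • toL2 v x = 0 := by
      refine integral_eq_zero_of_ae ?_
      rw [hv]
      filter_upwards [Lp.coeFn_zero 𝕜 2 (volume.restrict D)] with x hx
      rw [hx]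
      simp
    rw [h0, eq_comm, neg_eq_zero] at h
    rwa [← setIntegral_eq_integral_of_forall_compl_eq_zero (s := D) fun x hx => by
      rw [(hψ.fderiv_eq_zero hx).1]; simp]
  refine Lp.ext ?_
  have hall := (ae_restrict_iff' (μ := volume) hDopen.measurableSet).2 (ae_all_iff.2 hj |>.mono
    fun x hx hxD j => hx j hxD)
  filter_upwards [hall, Lp.coeFn_zero (EuclideanSpace 𝕜 (Fin d)) 2 (volume.restrict D)]
    with x hx h0
  rw [h0]
  ext j
  simpa using hx j

theorem grad_eq_ofRealField (hDopen : IsOpen D) (hDbdd : Bornology.IsBounded D) {w : H10 ℂ D}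
    {v : H10 ℝ D} (h : toL2 w =ᵐ[volume.restrict D] fun x => ((toL2 v x : ℝ) : ℂ)) :
    grad w = ofRealField D (grad v) := by
  obtain ⟨w', h1, h2⟩ := exists_complexification v
  have h0 : toL2 (w - w') = 0 := by
    have : toL2 w = toL2 w' := by
      rw [h1]
      refine Lp.ext (h.trans ?_)
      filter_upwards [Complex.ofRealCLM.coeFn_compLpL (p := 2) (toL2 v)] with x hx
      rw [hx]
      rfl
    rw [← toL2L_apply, map_sub, toL2L_apply, toL2L_apply, this, sub_self]
  have h3 := grad_eq_zero hDopen hDbdd h0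
  rw [← gradL_apply, map_sub, gradL_apply, gradL_apply, sub_eq_zero] at h3
  rw [h3, h2]

end WeakGradient

end SparseGrid

namespace SparseGrid

/-! ### The Poincaré inequality -/

theorem Lp_norm_sq {X : Type*} [MeasurableSpace X] {μ : Measure X} (𝕜 : Type*) {F : Type*}
    [RCLike 𝕜] [NormedAddCommGroup F] [InnerProductSpace 𝕜 F] (g : Lp F 2 μ) :
    ‖g‖ ^ 2 = ∫ x, ‖g x‖ ^ 2 ∂μ := by
  have h : inner 𝕜 g g = ∫ x, ((‖g x‖ ^ 2 : ℝ) : 𝕜) ∂μ := by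
    rw [L2.inner_def]
    simp only [inner_self_eq_norm_sq_to_K, RCLike.ofReal_pow]
  rw [inner_self_eq_norm_sq_to_K, integral_ofReal] at h
  exact_mod_cast h

section Poincare

variable {d : ℕ} {D : Set (EuclideanSpace ℝ (Fin d))}

theorem hasCompactSupport_norm_sq {X : Type*} [TopologicalSpace X] {f : X → ℂ}
    (hf : HasCompactSupport f) : HasCompactSupport fun x => ‖f x‖ ^ 2 :=
  hf.mono fun x hx => by
    rw [Function.mem_support] at hx ⊢
    exact fun h => hx (by rw [h]; simp)

theorem IsTestFunction.integral_norm_sq_le {φ : EuclideanSpace ℝ (Fin d) → ℂ}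
    (hφ : IsTestFunction D φ) {R : ℝ} (hR : ∀ x ∈ D, ‖x‖ ≤ R) (j : Fin d) :
    ∫ x, ‖φ x‖ ^ 2 ≤ 4 * R ^ 2 * ∫ x, ‖fderiv ℝ φ x (EuclideanSpace.single j 1)‖ ^ 2 := by
  set e := EuclideanSpace.single j (1 : ℝ) with he
  set P : EuclideanSpace ℝ (Fin d) →L[ℝ] ℝ := EuclideanSpace.proj j with hP
  have hPc : Continuous fun x => P x := P.continuous
  have hd := hφ.smooth.differentiable (by simp)
  have hc := hφ.smooth.continuous
  have hc1 := hφ.continuous_fderiv_apply e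
  have hs1 := hφ.hasCompactSupport_fderiv_apply e
  have hfd : ∀ x, fderiv ℝ (fun x => P x • φ x) x e = P x • fderiv ℝ φ x e + φ x := by
    intro x
    rw [fderiv_fun_smul P.differentiableAt (hd x), P.fderiv]
    simp [hP, he]
  have hi1 : Integrable fun x => inner ℝ (P x • fderiv ℝ φ x e + φ x) (φ x) :=
    (((hPc.smul hc1).add hc).inner hc).integrable_of_hasCompactSupport
      (hφ.compact.mono fun x hx => by
        rw [Function.mem_support] at hx ⊢
        exact fun h0 => hx (by rw [h0, inner_zero_right]))
  have hi2 : Integrable fun x => inner ℝ (P x • φ x) (fderiv ℝ φ x e) :=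
    ((hPc.smul hc).inner hc1).integrable_of_hasCompactSupport
      (hφ.compact.mono fun x hx => by
        rw [Function.mem_support] at hx ⊢
        exact fun h0 => hx (by rw [h0, smul_zero, inner_zero_left]))
  have hi3 : Integrable fun x => inner ℝ (P x • φ x) (φ x) :=
    ((hPc.smul hc).inner hc).integrable_of_hasCompactSupport
      (hφ.compact.mono fun x hx => by
        rw [Function.mem_support] at hx ⊢
        exact fun h0 => hx (by rw [h0, inner_zero_right]))
  have hi4 : Integrable fun x => ‖φ x‖ ^ 2 :=
    (hc.norm.pow 2).integrable_of_hasCompactSupport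
      (hasCompactSupport_norm_sq hφ.compact)
  have hi5 : Integrable fun x => ‖fderiv ℝ φ x e‖ ^ 2 :=
    (hc1.norm.pow 2).integrable_of_hasCompactSupport
      (hasCompactSupport_norm_sq hs1)
  have hibp := integral_bilinear_fderiv_right_eq_neg_left_of_integrable
    (μ := volume) (f := fun x => P x • φ x) (g := φ) (v := e) (B := innerSL ℝ (E := ℂ))
    (by simp only [hfd]; exact hi1) hi2 hi3
    (fun x _ => (P.differentiableAt).smul (hd x)) (fun x _ => hd x)
  simp only [hfd] at hibp
  replace hibp : ∫ x, inner ℝ (P x • φ x) (fderiv ℝ φ x e) =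
    -∫ x, inner ℝ (P x • fderiv ℝ φ x e + φ x) (φ x) := hibp
  have hsum : ∫ x, (inner ℝ (P x • φ x) (fderiv ℝ φ x e) +
      inner ℝ (P x • fderiv ℝ φ x e + φ x) (φ x)) = 0 := by
    rw [integral_add hi2 hi1, hibp, neg_add_cancel]
  have hi21 : Integrable fun x => inner ℝ (P x • φ x) (fderiv ℝ φ x e) +
      inner ℝ (P x • fderiv ℝ φ x e + φ x) (φ x) := hi2.add hi1
  have hi45 : Integrable fun x => ‖φ x‖ ^ 2 / 2 + 2 * R ^ 2 * ‖fderiv ℝ φ x e‖ ^ 2 :=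
    (hi4.div_const 2).add (hi5.const_mul _)
  -- The first bracket equals `2 x_j ⟨φ, ∂_j φ⟩ + |φ|²` and has integral zero. What is left to prove
  -- pointwise is Young's inequality `2R st ≤ s²/2 + 2R² t²`, with `|x_j| ≤ R` on `D`.
  have hle : ∫ x, ‖φ x‖ ^ 2 ≤ ∫ x, ((inner ℝ (P x • φ x) (fderiv ℝ φ x e) +
      inner ℝ (P x • fderiv ℝ φ x e + φ x) (φ x)) +
      (‖φ x‖ ^ 2 / 2 + 2 * R ^ 2 * ‖fderiv ℝ φ x e‖ ^ 2)) := by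
    refine integral_mono hi4 (hi21.add hi45) fun x => ?_
    simp only [inner_add_left, real_inner_smul_left, real_inner_self_eq_norm_sq]
    rw [real_inner_comm (φ x) (fderiv ℝ φ x e)]
    by_cases hx : x ∈ D
    · have h1 := abs_real_inner_le_norm (φ x) (fderiv ℝ φ x e)
      have h2 : |P x| ≤ R := (PiLp.norm_apply_le x j).trans (hR x hx)
      have h3 : |P x * inner ℝ (φ x) (fderiv ℝ φ x e)| ≤
          R * (‖φ x‖ * ‖fderiv ℝ φ x e‖) := by
        rw [abs_mul]
        have := (abs_nonneg _).trans h2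
        gcongr
      have h4 := neg_abs_le (P x * inner ℝ (φ x) (fderiv ℝ φ x e))
      nlinarith [sq_nonneg (‖φ x‖ - 2 * R * ‖fderiv ℝ φ x e‖)]
    · rw [(hφ.fderiv_eq_zero hx).1, (hφ.fderiv_eq_zero hx).2]
      simp
  rw [integral_add hi21 hi45, hsum,
    integral_add (hi4.div_const 2) (hi5.const_mul _), integral_div, integral_const_mul] at hle
  linarith

/-- The Poincaré inequality. -/
theorem exists_poincare (hd : 0 < d) (hDbdd : Bornology.IsBounded D) :
    ∃ C : ℝ, 0 ≤ C ∧ ∀ v : H10 ℂ D, ‖toL2 v‖ ≤ C * ‖grad v‖ := by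
  obtain ⟨R, hR0, hR⟩ := hDbdd.exists_pos_norm_le
  refine ⟨2 * R, by positivity, fun v => ?_⟩
  have hcl : IsClosed {p : PairSpace ℂ D | ‖p.fst‖ ≤ 2 * R * ‖p.snd‖} :=
    isClosed_le (WithLp.fstL 2 ℂ _ _).continuous.norm
      (continuous_const.mul (WithLp.sndL 2 ℂ _ _).continuous.norm)
  refine closure_minimal ?_ hcl v.2
  rintro p ⟨φ, hφ, h1, h2⟩
  change ‖p.fst‖ ≤ 2 * R * ‖p.snd‖
  refine (le_abs_self _).trans (abs_le_of_sq_le_sq ?_ (by positivity))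
  have e1 : ‖p.fst‖ ^ 2 = ∫ x, ‖φ x‖ ^ 2 := by
    have h0 : ∫ x in D, ‖φ x‖ ^ 2 = ∫ x, ‖φ x‖ ^ 2 :=
      setIntegral_eq_integral_of_forall_compl_eq_zero fun x hx => by
        rw [(hφ.fderiv_eq_zero hx).1]; simp
    rw [Lp_norm_sq ℂ, ← h0]
    refine integral_congr_ae ?_
    filter_upwards [h1] with x hx
    rw [hx]
  have e2 : ∫ x, ‖fderiv ℝ φ x (EuclideanSpace.single ⟨0, hd⟩ 1)‖ ^ 2 ≤ ‖p.snd‖ ^ 2 := by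
    have h0 : ∫ x in D, ‖fderiv ℝ φ x (EuclideanSpace.single ⟨0, hd⟩ 1)‖ ^ 2 =
        ∫ x, ‖fderiv ℝ φ x (EuclideanSpace.single ⟨0, hd⟩ 1)‖ ^ 2 :=
      setIntegral_eq_integral_of_forall_compl_eq_zero fun x hx => by
        rw [(hφ.fderiv_eq_zero hx).2]; simp
    rw [Lp_norm_sq ℂ, ← h0]
    refine integral_mono_ae ?_ ((memLp_two_iff_integrable_sq_norm
      (Lp.aestronglyMeasurable _)).1 (Lp.memLp p.snd)) ?_
    · exact (((hφ.continuous_fderiv_apply _).norm.pow 2).integrable_of_hasCompactSupport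
        (hasCompactSupport_norm_sq (hφ.hasCompactSupport_fderiv_apply _))).restrict
    · filter_upwards [h2] with x hx
      rw [hx]
      have := PiLp.norm_apply_le (classicalGrad φ x) ⟨0, hd⟩
      gcongr
      exact this
  have := hφ.integral_norm_sq_le hR ⟨0, hd⟩
  rw [e1, mul_pow]
  refine this.trans ?_
  calc _ ≤ 4 * R ^ 2 * ‖p.snd‖ ^ 2 := by gcongr
    _ = _ := by ring

end Poincare

/-! ### The diffusion coefficient -/

section Coefficient

variable {d N : ℕ} {D : Set (EuclideanSpace ℝ (Fin d))} {α β : Fin N → ℝ}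
  {a₀ : EuclideanSpace ℝ (Fin d) → ℝ} {a : Fin N → EuclideanSpace ℝ (Fin d) → ℝ} {amin amax : ℝ}

/-- Each `a_n` is recovered from the coefficient at the corner `α` and at the adjacent corner with
`n`-th coordinate `β n`. Then `a₀` is bounded using the value at `α`. -/
theorem exists_coef_bound (hαβ : ∀ n, α n < β n) (hamin : 0 < amin)
    (hbound : ∀ y ∈ Set.Icc α β, ∀ᵐ x ∂(volume.restrict D),
      amin ≤ coef a₀ a y x ∧ coef a₀ a y x ≤ amax) :
    ∃ K : ℝ, 0 ≤ K ∧ (∀ᵐ x ∂(volume.restrict D), |a₀ x| ≤ K) ∧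
      ∀ n, ∀ᵐ x ∂(volume.restrict D), |a n x| ≤ K := by
  have hα : α ∈ Set.Icc α β := ⟨le_rfl, fun n => (hαβ n).le⟩
  have hn : ∀ n, ∀ᵐ x ∂(volume.restrict D), |a n x| ≤ 2 * |amax| / (β n - α n) := by
    intro n
    have hm : Function.update α n (β n) ∈ Set.Icc α β := update_mem_Icc hα ⟨(hαβ n).le, le_rfl⟩
    filter_upwards [hbound _ hα, hbound _ hm] with x h1 h2
    have hp : 0 < β n - α n := sub_pos.2 (hαβ n)
    have e : coef a₀ a (Function.update α n (β n)) x - coef a₀ a α x = a n x * (β n - α n) := by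
      rw [coef, coef, add_sub_add_left_eq_sub, ← Finset.sum_sub_distrib,
        Finset.sum_eq_single n]
      · rw [Function.update_self]; ring
      · intro l _ hl
        rw [Function.update_of_ne hl, sub_self]
      · exact fun h => absurd (Finset.mem_univ _) h
    rw [le_div_iff₀ hp]
    have e' : |a n x| * (β n - α n) = |a n x * (β n - α n)| := by rw [abs_mul, abs_of_pos hp]
    rw [e', ← e, abs_le]
    have := le_abs_self amax
    constructor <;> linarith [h1.1, h1.2, h2.1, h2.2]
  set S := ∑ n, 2 * |amax| / (β n - α n) with hS
  have hterm : ∀ n, 0 ≤ 2 * |amax| / (β n - α n) := fun n =>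
    div_nonneg (by positivity) (sub_nonneg.2 (hαβ n).le)
  set S₁ := ∑ n, 2 * |amax| / (β n - α n) * |α n| with hS₁
  have hS0 : 0 ≤ S := Finset.sum_nonneg fun n _ => hterm n
  have hS₁0 : 0 ≤ S₁ := Finset.sum_nonneg fun n _ => mul_nonneg (hterm n) (abs_nonneg _)
  refine ⟨S + S₁ + |amax|, by positivity, ?_, fun n => ?_⟩
  · filter_upwards [hbound _ hα, ae_all_iff.2 hn] with x h1 h2
    have h3 : |∑ n, a n x * α n| ≤ S₁ := by
      refine (Finset.abs_sum_le_sum_abs _ _).trans (Finset.sum_le_sum fun n _ => ?_)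
      rw [abs_mul]
      exact mul_le_mul_of_nonneg_right (h2 n) (abs_nonneg _)
    have h4 : a₀ x = coef a₀ a α x - ∑ n, a n x * α n := by rw [coef]; ring
    have h5 := abs_le.1 h3
    have := le_abs_self amax
    rw [h4, abs_le]
    constructor <;> linarith [h1.1, h1.2]
  · filter_upwards [hn n] with x hx
    have := Finset.single_le_sum (f := fun n => 2 * |amax| / (β n - α n))
      (fun n _ => hterm n) (Finset.mem_univ n)
    have h0 := abs_nonneg amax
    linarith

theorem coeFn_affine_op {X : Type*} [MeasurableSpace X] {μ : Measure X} {𝕜 F : Type*} [RCLike 𝕜]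
    [NormedAddCommGroup F] [NormedSpace 𝕜 F] {b₀ : X → 𝕜} {b : Fin N → X → 𝕜}
    {A₀ : Lp F 2 μ →L[𝕜] Lp F 2 μ} {A : Fin N → Lp F 2 μ →L[𝕜] Lp F 2 μ}
    (h₀ : ∀ g : Lp F 2 μ, A₀ g =ᵐ[μ] fun x => b₀ x • g x)
    (h : ∀ n, ∀ g : Lp F 2 μ, A n g =ᵐ[μ] fun x => b n x • g x) (z : Fin N → 𝕜) (g : Lp F 2 μ) :
    (A₀ g + ∑ n, z n • A n g : Lp F 2 μ) =ᵐ[μ] fun x => (b₀ x + ∑ n, b n x * z n) • g x := by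
  have hs : ∀ s : Finset (Fin N), (∑ n ∈ s, z n • A n g : Lp F 2 μ) =ᵐ[μ]
      fun x => (∑ n ∈ s, b n x * z n) • g x := by
    intro s
    induction s using Finset.induction_on with
    | empty =>
      filter_upwards [Lp.coeFn_zero F 2 μ] with x hx
      simpa using hx
    | insert n s hn ih =>
      rw [Finset.sum_insert hn]
      filter_upwards [ih, h n g, Lp.coeFn_add (z n • A n g) (∑ n ∈ s, z n • A n g),
        Lp.coeFn_smul (z n) (A n g)] with x h1 h2 h3 h4
      rw [h3, Pi.add_apply, h1, h4, Pi.smul_apply, h2, Finset.sum_insert hn, add_smul, smul_smul,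
        mul_comm]
  filter_upwards [hs Finset.univ, h₀ g, Lp.coeFn_add (A₀ g) (∑ n, z n • A n g)] with x h1 h2 h3
  rw [h3, Pi.add_apply, h1, h2, add_smul]

/-- In particular the default value in `mulField` is never taken, so the multiplication is linear in
the field and affine in `y`. -/
theorem mulField_eq {A₀ : L2 D (EuclideanSpace ℝ (Fin d)) →L[ℝ] L2 D (EuclideanSpace ℝ (Fin d))}
    {A : Fin N → L2 D (EuclideanSpace ℝ (Fin d)) →L[ℝ] L2 D (EuclideanSpace ℝ (Fin d))}
    (h₀ : ∀ g : L2 D (EuclideanSpace ℝ (Fin d)), A₀ g =ᵐ[volume.restrict D] fun x => a₀ x • g x)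
    (h : ∀ n, ∀ g : L2 D (EuclideanSpace ℝ (Fin d)),
      A n g =ᵐ[volume.restrict D] fun x => a n x • g x)
    (y : Fin N → ℝ) (g : L2 D (EuclideanSpace ℝ (Fin d))) :
    mulField (coef a₀ a y) g = A₀ g + ∑ n, y n • A n g := by
  have hc := coeFn_affine_op h₀ h y g
  have hm : MemLp (fun x => coef a₀ a y x • g x) 2 (volume.restrict D) :=
    (memLp_congr_ae hc).1 (Lp.memLp _)
  rw [mulField, dif_pos hm]
  exact Lp.ext (hm.coeFn_toLp.trans hc.symm)

end Coefficient

end SparseGrid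

namespace SparseGrid

/-! ### Holomorphic dependence on the parameters -/

/-- Lax-Milgram makes the operator invertible on `S`. It is affine in `z` and inversion is
holomorphic on units, so the solution is holomorphic. -/
theorem exists_holomorphic_solution {N : ℕ} {H : Type*} [NormedAddCommGroup H]
    [InnerProductSpace ℂ H] [CompleteSpace H] (B₀ : H →L[ℂ] H) (B : Fin N → H →L[ℂ] H) (F : H)
    {S : Set (Fin N → ℂ)} {c : ℝ} (hc : 0 < c)
    (hS : ∀ z ∈ S, ∀ v, ‖v‖ ^ 2 * c ≤ ‖inner ℂ ((B₀ + ∑ n, z n • B n) v) v‖) :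
    ∃ U : (Fin N → ℂ) → H, DifferentiableOn ℂ U S ∧ (∀ z ∈ S, ‖U z‖ ≤ ‖F‖ / c) ∧
      ∀ z ∈ S, ∀ v, (B₀ + ∑ n, z n • B n) v = F → U z = v := by
  have hu : ∀ z ∈ S, IsUnit (B₀ + ∑ n, z n • B n) := fun z hz =>
    ContinuousLinearMap.isUnit_of_forall_le_norm_inner_map (B₀ + ∑ n, z n • B n)
      (c := ⟨c, hc.le⟩) hc (hS z hz)
  have hsol : ∀ z ∈ S, (B₀ + ∑ n, z n • B n) (Ring.inverse (B₀ + ∑ n, z n • B n) F) = F := by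
    intro z hz
    have := Ring.mul_inverse_cancel _ (hu z hz)
    exact congrArg (fun T : H →L[ℂ] H => T F) this
  refine ⟨fun z => Ring.inverse (B₀ + ∑ n, z n • B n) F, fun z hz => ?_, fun z hz => ?_,
    fun z hz v hv => ?_⟩
  · obtain ⟨x, hx⟩ := hu z hz
    have h1 : DifferentiableAt ℂ (fun z : Fin N → ℂ => B₀ + ∑ n, z n • B n) z := by fun_prop
    have h2 : DifferentiableAt ℂ (fun z : Fin N → ℂ => Ring.inverse (B₀ + ∑ n, z n • B n)) z := by
      have h3 : DifferentiableAt ℂ (Ring.inverse : (H →L[ℂ] H) → _) (B₀ + ∑ n, z n • B n) := by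
        rw [← hx]
        exact differentiableAt_inverse x.isUnit
      exact h3.comp z h1
    exact (h2.clm_apply (differentiableAt_const F)).differentiableWithinAt
  · set w := Ring.inverse (B₀ + ∑ n, z n • B n) F with hw
    have h1 := hS z hz w
    rw [hw, hsol z hz, ← hw] at h1
    have h2 := norm_inner_le_norm (𝕜 := ℂ) F w
    rw [le_div_iff₀ hc]
    rcases (norm_nonneg w).eq_or_lt with h0 | h0
    · rw [← h0, zero_mul]; exact norm_nonneg _
    · refine le_of_mul_le_mul_right ?_ h0
      nlinarith
  · have h1 := Ring.inverse_mul_cancel _ (hu z hz)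
    rw [← hv]
    exact congrArg (fun T : H →L[ℂ] H => T v) h1

/-- The form `⟪A (G v), G w⟫` as an operator. -/
noncomputable def pullbackOp {H K : Type*} [NormedAddCommGroup H] [InnerProductSpace ℂ H]
    [CompleteSpace H] [NormedAddCommGroup K] [InnerProductSpace ℂ K] [CompleteSpace K]
    (G : H →L[ℂ] K) (A : K →L[ℂ] K) : H →L[ℂ] H :=
  (ContinuousLinearMap.adjoint G).comp (A.comp G)

theorem inner_pullbackOp_affine {N : ℕ} {H K : Type*} [NormedAddCommGroup H]
    [InnerProductSpace ℂ H] [CompleteSpace H] [NormedAddCommGroup K] [InnerProductSpace ℂ K]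
    [CompleteSpace K] (G : H →L[ℂ] K) (A₀ : K →L[ℂ] K) (A : Fin N → K →L[ℂ] K) (z : Fin N → ℂ)
    (v w : H) : inner ℂ ((pullbackOp G A₀ + ∑ n, z n • pullbackOp G (A n)) v) w =
      inner ℂ (A₀ (G v) + ∑ n, z n • A n (G v)) (G w) := by
  rw [← ContinuousLinearMap.adjoint_inner_left]
  simp [pullbackOp, map_sum, inner_add_left, sum_inner, inner_smul_left, mul_comm]

/-- The solutions of a parametric variational problem that is coercive for the parameters in `S`
depend holomorphically on the parameters. -/
theorem exists_holomorphic_variational {N : ℕ} {H K L : Type*} [NormedAddCommGroup H]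
    [InnerProductSpace ℂ H] [CompleteSpace H] [NormedAddCommGroup K] [InnerProductSpace ℂ K]
    [CompleteSpace K] [NormedAddCommGroup L] [InnerProductSpace ℂ L] [CompleteSpace L]
    (G : H →L[ℂ] K) (T : H →L[ℂ] L) (A₀ : K →L[ℂ] K) (A : Fin N → K →L[ℂ] K) (F : L)
    {S : Set (Fin N → ℂ)} {c : ℝ} (hc : 0 < c)
    (hS : ∀ z ∈ S, ∀ v, ‖v‖ ^ 2 * c ≤ ‖inner ℂ (A₀ (G v) + ∑ n, z n • A n (G v)) (G v)‖) :
    ∃ U : (Fin N → ℂ) → H, DifferentiableOn ℂ U S ∧ (∃ M : ℝ, ∀ z ∈ S, ‖G (U z)‖ ≤ M) ∧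
      ∀ z ∈ S, ∀ v,
        (∀ w, inner ℂ (A₀ (G v) + ∑ n, z n • A n (G v)) (G w) = inner ℂ F (T w)) → U z = v := by
  obtain ⟨U, hU1, hU2, hU3⟩ := exists_holomorphic_solution (pullbackOp G A₀)
    (fun n => pullbackOp G (A n)) (ContinuousLinearMap.adjoint T F) (S := S) hc fun z hz v => by
      rw [inner_pullbackOp_affine]
      exact hS z hz v
  refine ⟨U, hU1, ⟨‖G‖ * (‖ContinuousLinearMap.adjoint T F‖ / c), fun z hz => ?_⟩,
    fun z hz v hv => hU3 z hz v (ext_inner_right ℂ fun w => ?_)⟩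
  · exact (G.le_opNorm _).trans (mul_le_mul_of_nonneg_left (hU2 z hz) (norm_nonneg _))
  · rw [inner_pullbackOp_affine, hv, ContinuousLinearMap.adjoint_inner_left]

section Extension

variable {d N : ℕ} {D : Set (EuclideanSpace ℝ (Fin d))} {α β : Fin N → ℝ}
  {a₀ : EuclideanSpace ℝ (Fin d) → ℝ} {a : Fin N → EuclideanSpace ℝ (Fin d) → ℝ} {amin amax : ℝ}

theorem exists_close_of_mem_complexNhd (hαβ : ∀ n, α n < β n) {τ : Fin N → ℝ} {z : Fin N → ℂ}
    (hz : z ∈ complexNhd α β τ) : ∃ y ∈ Set.Icc α β, ∀ n, ‖z n - (y n : ℂ)‖ ≤ τ n := by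
  have h : ∀ n, ∃ y : ℝ, y ∈ Set.Icc (α n) (β n) ∧ ‖z n - (y : ℂ)‖ ≤ τ n := by
    intro n
    have hK : IsCompact (Complex.ofReal '' Set.Icc (α n) (β n)) :=
      isCompact_Icc.image Complex.continuous_ofReal
    obtain ⟨w, ⟨y, hy, rfl⟩, h2⟩ := hK.exists_infDist_eq_dist
      ((Set.nonempty_Icc.2 (hαβ n).le).image _) (z n)
    refine ⟨y, hy, ?_⟩
    rw [← dist_eq_norm, ← h2]
    exact hz n
  choose y hy h' using h
  exact ⟨y, ⟨fun n => (hy n).1, fun n => (hy n).2⟩, h'⟩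

theorem mem_complexNhd_of_mem_Icc {τ : Fin N → ℝ} (hτ : ∀ n, 0 < τ n) {y : Fin N → ℝ}
    (hy : y ∈ Set.Icc α β) : (fun n => (y n : ℂ)) ∈ complexNhd α β τ := by
  intro n
  have h : (y n : ℂ) ∈ Complex.ofReal '' Set.Icc (α n) (β n) :=
    Set.mem_image_of_mem _ ⟨hy.1 n, hy.2 n⟩
  exact (Metric.infDist_zero_of_mem h).trans_le (hτ n).le

theorem norm_sq_le_re_inner {A₀ : L2 D (EuclideanSpace ℂ (Fin d)) →L[ℂ] L2 D (EuclideanSpace ℂ (Fin d))}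
    {A : Fin N → L2 D (EuclideanSpace ℂ (Fin d)) →L[ℂ] L2 D (EuclideanSpace ℂ (Fin d))}
    (h₀ : ∀ g : L2 D (EuclideanSpace ℂ (Fin d)),
      A₀ g =ᵐ[volume.restrict D] fun x => (a₀ x : ℂ) • g x)
    (h : ∀ n, ∀ g : L2 D (EuclideanSpace ℂ (Fin d)),
      A n g =ᵐ[volume.restrict D] fun x => (a n x : ℂ) • g x)
    {y : Fin N → ℝ} (hy : ∀ᵐ x ∂(volume.restrict D), amin ≤ coef a₀ a y x)
    (g : L2 D (EuclideanSpace ℂ (Fin d))) :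
    amin * ‖g‖ ^ 2 ≤ (inner ℂ (A₀ g + ∑ n, (y n : ℂ) • A n g) g).re := by
  have hc := coeFn_affine_op h₀ h (fun n => (y n : ℂ)) g
  set w := A₀ g + ∑ n, (y n : ℂ) • A n g with hw
  have hint := L2.integrable_inner (𝕜 := ℂ) w g
  rw [L2.inner_def]
  have e : ∫ x in D, (inner ℂ (w x) (g x)).re = (∫ x in D, inner ℂ (w x) (g x)).re :=
    integral_re hint
  rw [← e, Lp_norm_sq ℂ, ← integral_const_mul]
  refine integral_mono_ae (((memLp_two_iff_integrable_sq_norm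
      (Lp.aestronglyMeasurable _)).1 (Lp.memLp g)).const_mul _) hint.re ?_
  filter_upwards [hc, hy] with x h1 h2
  have e1 : (a₀ x : ℂ) + ∑ n, (a n x : ℂ) * (y n : ℂ) = (coef a₀ a y x : ℝ) := by
    rw [coef]; push_cast; rfl
  change _ ≤ (inner ℂ (w x) (g x)).re
  rw [h1, e1, inner_smul_left, Complex.conj_ofReal, inner_self_eq_norm_sq_to_K]
  have e2 : (((coef a₀ a y x : ℝ) : ℂ) * ((‖g x‖ : ℝ) : ℂ) ^ 2).re = coef a₀ a y x * ‖g x‖ ^ 2 := by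
    rw [← Complex.ofReal_pow, ← Complex.ofReal_mul, Complex.ofReal_re]
  refine le_of_le_of_eq ?_ e2.symm
  gcongr

theorem inner_affine_ofRealField
    {A₀ : L2 D (EuclideanSpace ℂ (Fin d)) →L[ℂ] L2 D (EuclideanSpace ℂ (Fin d))}
    {A : Fin N → L2 D (EuclideanSpace ℂ (Fin d)) →L[ℂ] L2 D (EuclideanSpace ℂ (Fin d))}
    (h₀ : ∀ g : L2 D (EuclideanSpace ℂ (Fin d)),
      A₀ g =ᵐ[volume.restrict D] fun x => (a₀ x : ℂ) • g x)
    (h : ∀ n, ∀ g : L2 D (EuclideanSpace ℂ (Fin d)),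
      A n g =ᵐ[volume.restrict D] fun x => (a n x : ℂ) • g x)
    (y : Fin N → ℝ) (g k : L2 D (EuclideanSpace ℝ (Fin d))) :
    inner ℂ (A₀ (ofRealField D g) + ∑ n, (y n : ℂ) • A n (ofRealField D g)) (ofRealField D k) =
      ((∫ x in D, coef a₀ a y x * inner ℝ (g x) (k x) : ℝ) : ℂ) := by
  rw [L2.inner_def, ← integral_complex_ofReal]
  refine integral_congr_ae ?_
  filter_upwards [coeFn_affine_op h₀ h (fun n => (y n : ℂ)) (ofRealField D g),
    (ofRealVec d).coeFn_compLpL (p := 2) g, (ofRealVec d).coeFn_compLpL (p := 2) k]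
    with x h1 h2 h3
  have e1 : (a₀ x : ℂ) + ∑ n, (a n x : ℂ) * (y n : ℂ) = (coef a₀ a y x : ℝ) := by
    rw [coef]; push_cast; rfl
  rw [h1, h2, h3, e1, inner_smul_left, Complex.conj_ofReal, inner_ofRealVec]
  push_cast
  rfl

theorem inner_ofRealFun {f : EuclideanSpace ℝ (Fin d) → ℝ}
    {F : L2 D ℂ} (hF : F =ᵐ[volume.restrict D] fun x => ((f x : ℝ) : ℂ)) (k : L2 D ℝ) :
    inner ℂ F (ofRealFun D k) = ((∫ x in D, f x * k x : ℝ) : ℂ) := by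
  rw [L2.inner_def, ← integral_complex_ofReal]
  refine integral_congr_ae ?_
  filter_upwards [hF, Complex.ofRealCLM.coeFn_compLpL (p := 2) k] with x h1 h2
  rw [h1, h2, RCLike.inner_apply]
  simp [mul_comm]

/-- At the nearby real parameter `y` the real part of the form is at least `amin ‖g‖²`; moving from
`y` to `z` costs at most half of that. -/
theorem norm_sq_le_norm_inner
    {A₀ : L2 D (EuclideanSpace ℂ (Fin d)) →L[ℂ] L2 D (EuclideanSpace ℂ (Fin d))}
    {A : Fin N → L2 D (EuclideanSpace ℂ (Fin d)) →L[ℂ] L2 D (EuclideanSpace ℂ (Fin d))}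
    (h₀ : ∀ g : L2 D (EuclideanSpace ℂ (Fin d)),
      A₀ g =ᵐ[volume.restrict D] fun x => (a₀ x : ℂ) • g x)
    (h : ∀ n, ∀ g : L2 D (EuclideanSpace ℂ (Fin d)),
      A n g =ᵐ[volume.restrict D] fun x => (a n x : ℂ) • g x)
    {K t : ℝ} (hK : ∀ n g, ‖A n g‖ ≤ K * ‖g‖) (ht : 0 ≤ t) (htK : N * K * t ≤ amin / 2)
    {y : Fin N → ℝ} (hy : ∀ᵐ x ∂(volume.restrict D), amin ≤ coef a₀ a y x)
    {z : Fin N → ℂ} (hz : ∀ n, ‖z n - (y n : ℂ)‖ ≤ t)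
    (g : L2 D (EuclideanSpace ℂ (Fin d))) :
    amin / 2 * ‖g‖ ^ 2 ≤ ‖inner ℂ (A₀ g + ∑ n, z n • A n g) g‖ := by
  have h1 := norm_sq_le_re_inner h₀ h hy g
  have h2 : A₀ g + ∑ n, z n • A n g =
      (A₀ g + ∑ n, (y n : ℂ) • A n g) + ∑ n, (z n - (y n : ℂ)) • A n g := by
    rw [add_assoc, ← Finset.sum_add_distrib]
    simp only [← add_smul, add_sub_cancel]
  have h3 : ‖∑ n, (z n - (y n : ℂ)) • A n g‖ ≤ amin / 2 * ‖g‖ := by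
    calc _ ≤ ∑ n : Fin N, t * (K * ‖g‖) := by
          refine norm_sum_le_of_le _ fun n _ => ?_
          rw [norm_smul]
          exact mul_le_mul (hz n) (hK n g) (norm_nonneg _) ht
      _ = N * K * t * ‖g‖ := by
          rw [Finset.sum_const, Finset.card_univ, Fintype.card_fin, nsmul_eq_mul]; ring
      _ ≤ _ := by gcongr
  have h4 : |(inner ℂ (∑ n, (z n - (y n : ℂ)) • A n g) g).re| ≤ amin / 2 * ‖g‖ * ‖g‖ :=
    (Complex.abs_re_le_norm _).trans ((norm_inner_le_norm _ _).trans (by gcongr))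
  refine le_trans ?_ (Complex.re_le_norm _)
  rw [h2, inner_add_left, Complex.add_re]
  have := neg_abs_le (inner ℂ (∑ n, (z n - (y n : ℂ)) • A n g) g).re
  nlinarith

theorem norm_sq_le_of_poincare {C : ℝ} (hC : ∀ v : H10 ℂ D, ‖toL2 v‖ ≤ C * ‖grad v‖)
    (v : H10 ℂ D) : ‖v‖ ^ 2 ≤ (C ^ 2 + 1) * ‖grad v‖ ^ 2 := by
  have h6 : ‖v‖ ^ 2 = ‖toL2 v‖ ^ 2 + ‖grad v‖ ^ 2 := by
    exact WithLp.prod_norm_sq_eq_of_L2 v.1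
  have h7 : ‖toL2 v‖ ^ 2 ≤ C ^ 2 * ‖grad v‖ ^ 2 := by
    rw [← mul_pow]
    exact pow_le_pow_left₀ (norm_nonneg _) (hC v) 2
  rw [h6]
  linarith

instance completeSpace_H10 : CompleteSpace (H10 ℂ D) :=
  (testPairs ℂ D).isClosed_topologicalClosure.completeSpace_coe

theorem exists_mulOp_ofReal {b : EuclideanSpace ℝ (Fin d) → ℝ} {K : ℝ}
    (hb : AEStronglyMeasurable b (volume.restrict D))
    (hK : ∀ᵐ x ∂(volume.restrict D), |b x| ≤ K) :
    ∃ A : L2 D (EuclideanSpace ℂ (Fin d)) →L[ℂ] L2 D (EuclideanSpace ℂ (Fin d)),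
      (∀ g : L2 D (EuclideanSpace ℂ (Fin d)),
        A g =ᵐ[volume.restrict D] fun x => (b x : ℂ) • g x) ∧ ∀ g, ‖A g‖ ≤ K * ‖g‖ :=
  exists_mulOp (Complex.continuous_ofReal.comp_aestronglyMeasurable hb)
    (hK.mono fun x hx => by rwa [Complex.norm_real])

theorem inner_affine_eq_inner_load
    {A₀ : L2 D (EuclideanSpace ℂ (Fin d)) →L[ℂ] L2 D (EuclideanSpace ℂ (Fin d))}
    {A : Fin N → L2 D (EuclideanSpace ℂ (Fin d)) →L[ℂ] L2 D (EuclideanSpace ℂ (Fin d))}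
    (h₀ : ∀ g : L2 D (EuclideanSpace ℂ (Fin d)),
      A₀ g =ᵐ[volume.restrict D] fun x => (a₀ x : ℂ) • g x)
    (h : ∀ n, ∀ g : L2 D (EuclideanSpace ℂ (Fin d)),
      A n g =ᵐ[volume.restrict D] fun x => (a n x : ℂ) • g x)
    {f : EuclideanSpace ℝ (Fin d) → ℝ} {F : L2 D ℂ}
    (hF : F =ᵐ[volume.restrict D] fun x => ((f x : ℝ) : ℂ)) {y : Fin N → ℝ} {v : H10 ℝ D}
    (hv : IsWeakSolution (coef a₀ a y) f v) (k : H10 ℂ D) :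
    inner ℂ (A₀ (ofRealField D (grad v)) + ∑ n, (y n : ℂ) • A n (ofRealField D (grad v)))
      (grad k) = inner ℂ F (toL2 k) := by
  obtain ⟨v₁, v₂, hv1, hv2⟩ := exists_re_im k
  rw [hv1, hv2, inner_add_right, inner_add_right, inner_smul_right, inner_smul_right,
    inner_affine_ofRealField h₀ h, inner_affine_ofRealField h₀ h, inner_ofRealFun hF,
    inner_ofRealFun hF, hv v₁, hv v₂]

theorem exists_holomorphicExtension (hd : 0 < d) (hDbdd : Bornology.IsBounded D)
    (hαβ : ∀ n, α n < β n)
    (ha₀ : AEStronglyMeasurable a₀ (volume.restrict D))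
    (ha : ∀ n, AEStronglyMeasurable (a n) (volume.restrict D)) (hamin : 0 < amin)
    (hbound : ∀ y ∈ Set.Icc α β, ∀ᵐ x ∂(volume.restrict D),
      amin ≤ coef a₀ a y x ∧ coef a₀ a y x ≤ amax)
    {f : EuclideanSpace ℝ (Fin d) → ℝ} (hf : MemLp f 2 (volume.restrict D))
    {u : (Fin N → ℝ) → H10 ℝ D}
    (hu : ∀ y ∈ Set.Icc α β, IsWeakSolution (coef a₀ a y) f (u y)) :
    ∃ τ : Fin N → ℝ, (∀ n, 0 < τ n) ∧ HasHolomorphicExtension α β τ u := by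
  obtain ⟨K, hK0, hKa₀, hKa⟩ := exists_coef_bound hαβ hamin hbound
  obtain ⟨C, hC0, hC⟩ := exists_poincare (D := D) hd hDbdd
  obtain ⟨A₀, hA₀, -⟩ := exists_mulOp_ofReal ha₀ hKa₀
  choose A hA hAK using fun n => exists_mulOp_ofReal (ha n) (hKa n)
  have hFm : MemLp (fun x => ((f x : ℝ) : ℂ)) 2 (volume.restrict D) := hf.ofReal
  -- The added `1` in the denominator keeps the choice meaningful when `K = 0`.
  obtain ⟨t, ht0, ht⟩ : ∃ t : ℝ, 0 < t ∧ N * K * t ≤ amin / 2 := by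
    refine ⟨amin / (2 * (N * K + 1)), by positivity, ?_⟩
    rw [mul_div_assoc', div_le_iff₀ (by positivity)]
    nlinarith
  obtain ⟨c, hc0, hc⟩ : ∃ c : ℝ, 0 < c ∧ c * (C ^ 2 + 1) = amin / 2 :=
    ⟨amin / (2 * (C ^ 2 + 1)), by positivity, by field_simp⟩
  obtain ⟨U, hU1, hU2, hU3⟩ := exists_holomorphic_variational (gradL ℂ D) (toL2L ℂ D) A₀ A
    (hFm.toLp _) (S := complexNhd α β fun _ => t) hc0 fun z hz v => by
      obtain ⟨y, hy, hzy⟩ := exists_close_of_mem_complexNhd hαβ hz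
      refine le_trans ?_ (norm_sq_le_norm_inner hA₀ hA hAK ht0.le ht
        ((hbound y hy).mono fun x hx => hx.1) hzy (gradL ℂ D v))
      rw [← hc, mul_assoc, mul_comm]
      exact mul_le_mul_of_nonneg_left (norm_sq_le_of_poincare hC v) hc0.le
  refine ⟨fun _ => t, fun _ => ht0, U, hU1, hU2, fun y hy => ?_⟩
  obtain ⟨w, hw1, hw2⟩ := exists_complexification (u y)
  have hy' : (fun n => (y n : ℂ)) ∈ complexNhd α β fun _ => t :=
    mem_complexNhd_of_mem_Icc (fun _ => ht0) hy
  have hin := inner_affine_eq_inner_load hA₀ hA hFm.coeFn_toLp (hu y hy)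
  rw [← hw2] at hin
  have hUw := hU3 _ hy' w hin
  rw [hUw, hw1]
  filter_upwards [Complex.ofRealCLM.coeFn_compLpL (p := 2) (toL2 (u y))] with x hx
  rw [hx]
  rfl

end Extension

end SparseGrid

namespace SparseGrid

/-! ### The error and the margin -/

section AffineField

variable {N : ℕ} {E : Type*} [NormedAddCommGroup E] [InnerProductSpace ℝ E] {α β : Fin N → ℝ}
  {A₀ : E →L[ℝ] E} {A : Fin N → E →L[ℝ] E} {I : Finset (Fin N → ℕ)}

/-- The function `y ↦ (A₀ + ∑ₙ yₙ Aₙ) g(y)`. -/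
def affineField (A₀ : E →L[ℝ] E) (A : Fin N → E →L[ℝ] E) (g : (Fin N → ℝ) → E)
    (y : Fin N → ℝ) : E :=
  A₀ (g y) + ∑ n, y n • A n (g y)

theorem affineField_eq (g : (Fin N → ℝ) → E) :
    affineField A₀ A g = (fun y => A₀ (g y)) + ∑ n, fun y => A n (mulCoord n g y) := by
  funext y
  simp [affineField, mulCoord_apply, Finset.sum_apply]

theorem affineField_sub (g k : (Fin N → ℝ) → E) :
    affineField A₀ A (g - k) = affineField A₀ A g - affineField A₀ A k := by
  funext y
  simp only [affineField, Pi.sub_apply, map_sub, smul_sub, Finset.sum_sub_distrib]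
  abel

theorem surplus_affineField (j : Fin N → ℕ) (g : (Fin N → ℝ) → E) (y : Fin N → ℝ) :
    surplus α β j (affineField A₀ A g) y =
      A₀ (surplus α β j g y) + ∑ n, A n (surplus α β j (mulCoord n g) y) := by
  have h₀ := surplus_map (α := α) (β := β) (A₀ : E →ₗ[ℝ] E) j g
  have h := fun n => surplus_map (α := α) (β := β) (A n : E →ₗ[ℝ] E) j (mulCoord n g)
  simp only [ContinuousLinearMap.coe_coe] at h₀ h
  rw [affineField_eq, map_add, map_sum, h₀, Pi.add_apply, Finset.sum_apply]
  simp only [h]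

theorem sparseInterp_affineField (I : Finset (Fin N → ℕ)) (g : (Fin N → ℝ) → E)
    (y : Fin N → ℝ) :
    sparseInterp α β I (affineField A₀ A g) y =
      A₀ (sparseInterp α β I g y) + ∑ n, A n (sparseInterp α β I (mulCoord n g) y) := by
  have h₀ := sparseInterp_map (α := α) (β := β) (A₀ : E →ₗ[ℝ] E) I g
  have h := fun n => sparseInterp_map (α := α) (β := β) (A n : E →ₗ[ℝ] E) I (mulCoord n g)
  simp only [ContinuousLinearMap.coe_coe] at h₀ h
  rw [affineField_eq, map_add, map_sum, h₀, Pi.add_apply, Finset.sum_apply]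
  simp only [h]

/-- By the row form of the bidiagonal structure, `S_I y_n` factors through `S_I`, so replacing `g`
by its interpolant changes nothing. -/
theorem sparseInterp_affineField_sparseInterp (h : ∀ n, α n < β n) (hpos : IsPositive I)
    (hI : IsDownwardClosed I) (g : (Fin N → ℝ) → E) (y : Fin N → ℝ) :
    sparseInterp α β I (affineField A₀ A (sparseInterp α β I g)) y =
      sparseInterp α β I (affineField A₀ A g) y := by
  rw [sparseInterp_affineField, sparseInterp_affineField, ← Module.End.mul_apply,
    sparseInterp_mul_of_subset h hpos subset_rfl]
  have e := fun n => sparseInterp_mulCoord (E := E) h n hpos hI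
  simp only [← Module.End.mul_apply, ← mul_assoc, e]

/-- By the column form, multiplication by the coefficient moves each index by at most one forward
step, and the margin contains every such step that leaves `I`. -/
theorem affineField_sparseInterp_eq (h : ∀ n, α n < β n) (hpos : IsPositive I)
    (g : (Fin N → ℝ) → E) (y : Fin N → ℝ) :
    affineField A₀ A (sparseInterp α β I g) y =
      sparseInterp α β I (affineField A₀ A (sparseInterp α β I g)) y +
        ∑ j ∈ margin I, surplus α β j (affineField A₀ A (sparseInterp α β I g)) y := by
  have e1 : sparseInterp α β (I ∪ margin I) (affineField A₀ A (sparseInterp α β I g)) y =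
      affineField A₀ A (sparseInterp α β I g) y := by
    rw [sparseInterp_affineField, ← Module.End.mul_apply,
      sparseInterp_mul_of_subset h hpos Finset.subset_union_left, affineField]
    refine congrArg _ (Finset.sum_congr rfl fun n _ => ?_)
    have e := sparseInterp_mulCoord_sparseInterp (E := E) h n hpos
      (Finset.subset_union_left (s₂ := margin I)) fun i hi => add_single_mem_union_margin hpos hi n
    have e' := congrFun (congrArg (fun T : Module.End ℝ ((Fin N → ℝ) → E) => T g) e) y
    simp only [Module.End.mul_apply, mulCoord_apply] at e'
    rw [e', map_smul]
  rw [← e1, sparseInterp, Finset.sum_union (margin_disjoint I), LinearMap.add_apply, Pi.add_apply]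
  exact congrArg _ (by rw [LinearMap.sum_apply, Finset.sum_apply])

/-- The error of sparse grid interpolation of the solution of a parametric variational problem is
controlled by the surpluses in the margin. -/
theorem norm_sub_sparseInterp_le (h : ∀ n, α n < β n) (hpos : IsPositive I)
    (hI : IsDownwardClosed I) (h1 : (fun _ => 1) ∈ I) {G : (Fin N → ℝ) → E} {W : Set E}
    (hW : ∀ y, G y - sparseInterp α β I G y ∈ W)
    (hsol : ∀ w ∈ W, ∃ c : ℝ, ∀ y ∈ Set.Icc α β, inner ℝ (affineField A₀ A G y) w = c)
    {amin : ℝ} (hcoer : ∀ y ∈ Set.Icc α β, ∀ g,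
      amin * ‖g‖ ^ 2 ≤ inner ℝ (A₀ g + ∑ n, y n • A n g) g)
    {y : Fin N → ℝ} (hy : y ∈ Set.Icc α β) :
    amin * ‖G y - sparseInterp α β I G y‖ ≤
      ∑ j ∈ margin I, ‖surplus α β j (affineField A₀ A (sparseInterp α β I G)) y‖ := by
  set w := G y - sparseInterp α β I G y with hw
  obtain ⟨c, hc⟩ := hsol w (hW y)
  -- Here `w` is frozen, so the pairing commutes with interpolation. On `Γ` it is the constant `c`,
  -- and constants are reproduced.
  have hS : inner ℝ (sparseInterp α β I (affineField A₀ A G) y) w = c := by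
    have e1 := congrFun (sparseInterp_map (α := α) (β := β)
      ((innerSL ℝ w : E →L[ℝ] ℝ) : E →ₗ[ℝ] ℝ) I (affineField A₀ A G)) y
    have e2 : sparseInterp α β I (fun y => inner ℝ w (affineField A₀ A G y)) y = c := by
      have hb := supBound_sparseInterp (E := ℝ) h (I := I) (J := I.sup fun i => Finset.univ.sup i)
        fun i hi n => (Finset.le_sup (f := i) (Finset.mem_univ n)).trans
          (Finset.le_sup (f := fun i : Fin N → ℕ => Finset.univ.sup i) hi)
      rw [hb.congr (g' := fun _ => c) (fun y hy => by rw [real_inner_comm, hc y hy]) hy,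
        sparseInterp_const h h1]
    rw [real_inner_comm, ← e2]
    exact e1.symm
  have hdiff : affineField A₀ A G y - affineField A₀ A (sparseInterp α β I G) y =
      A₀ w + ∑ n, y n • A n w := by
    rw [← Pi.sub_apply, ← affineField_sub]
    rfl
  have key : amin * ‖w‖ ^ 2 ≤ -inner ℝ
      (∑ j ∈ margin I, surplus α β j (affineField A₀ A (sparseInterp α β I G)) y) w := by
    refine (hcoer y hy w).trans (le_of_eq ?_)
    rw [← hdiff, affineField_sparseInterp_eq h hpos,
      sparseInterp_affineField_sparseInterp h hpos hI, inner_sub_left, inner_add_left, hc y hy, hS]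
    ring
  have h2 := neg_le_of_abs_le (abs_real_inner_le_norm
    (∑ j ∈ margin I, surplus α β j (affineField A₀ A (sparseInterp α β I G)) y) w)
  have h3 := norm_sum_le (margin I)
    fun j => surplus α β j (affineField A₀ A (sparseInterp α β I G)) y
  rcases (norm_nonneg w).eq_or_lt with h0 | h0
  · rw [← h0, mul_zero]
    exact Finset.sum_nonneg fun _ _ => norm_nonneg _
  · refine le_trans (le_of_mul_le_mul_right ?_ h0) h3
    linarith [sq ‖w‖]

/-- An index with entry `J` cannot lie in `I`, and only the direction `n` can lead from `I` to it.
So a single block, from `j - e_n`, contributes, or none. -/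
theorem norm_surplus_affineField_le (h : ∀ n, α n < β n) {n : Fin N} {J : ℕ}
    (hI : ∀ i ∈ I, ∀ l, i l < J) {j : Fin N → ℕ} (hj : j n = J) {g : (Fin N → ℝ) → E} {K Z : ℝ}
    (hK0 : 0 ≤ K) (hK : ∀ v, ‖A n v‖ ≤ K * ‖v‖) (hZ0 : 0 ≤ Z) {y : Fin N → ℝ}
    (hZ : ∀ i ∈ I, j = i + Pi.single n 1 → ‖(surplus α β (i + Pi.single n 1) * mulCoord n * surplus α β i :
      Module.End ℝ ((Fin N → ℝ) → E)) g y‖ ≤ Z) :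
    ‖surplus α β j (affineField A₀ A (sparseInterp α β I g)) y‖ ≤ K * Z := by
  have hjI : ∀ i ∈ I, j ≠ i := fun i hi hji => by
    have := hI i hi n
    rw [← hji, hj] at this
    exact lt_irrefl _ this
  have e0 : (surplus α β j * sparseInterp α β I : Module.End ℝ ((Fin N → ℝ) → E)) = 0 := by
    rw [sparseInterp, Finset.mul_sum]
    exact Finset.sum_eq_zero fun i hi => surplus_mul_surplus_of_ne h (hjI i hi)
  have e1 : ∀ l, l ≠ n → (surplus α β j * mulCoord l * sparseInterp α β I :
      Module.End ℝ ((Fin N → ℝ) → E)) = 0 := fun l hl => by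
    rw [sparseInterp, Finset.mul_sum]
    refine Finset.sum_eq_zero fun i hi => surplus_mulCoord_surplus_eq_zero h l (hjI i hi) ?_
    rintro rfl
    have := hI i hi n
    rw [Pi.add_apply, Pi.single_eq_of_ne hl.symm, add_zero] at hj
    omega
  have e2 : surplus α β j (affineField A₀ A (sparseInterp α β I g)) y =
      A n ((surplus α β j * mulCoord n * sparseInterp α β I :
        Module.End ℝ ((Fin N → ℝ) → E)) g y) := by
    rw [surplus_affineField, ← Module.End.mul_apply, e0, LinearMap.zero_apply, Pi.zero_apply,
      map_zero, zero_add, Finset.sum_eq_single n]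
    · rfl
    · intro l _ hl
      have := congrFun (congrArg (fun T : Module.End ℝ ((Fin N → ℝ) → E) => T g) (e1 l hl)) y
      simp only [Module.End.mul_apply, LinearMap.zero_apply, Pi.zero_apply] at this
      rw [this, map_zero]
    · exact fun hn => absurd (Finset.mem_univ _) hn
  rw [e2]
  refine (hK _).trans (mul_le_mul_of_nonneg_left ?_ hK0)
  by_cases hex : ∃ i ∈ I, j = i + Pi.single n 1
  · obtain ⟨i, hi, rfl⟩ := hex
    refine le_of_eq_of_le ?_ (hZ i hi rfl)
    rw [sparseInterp, Finset.mul_sum, Finset.sum_eq_single i]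
    · intro i' hi' hne
      exact surplus_mulCoord_surplus_eq_zero h n (hjI i' hi') fun he =>
        hne (add_right_cancel he).symm
    · exact fun hn => absurd hi hn
  · push Not at hex
    rw [sparseInterp, Finset.mul_sum, Finset.sum_eq_zero fun i hi =>
      surplus_mulCoord_surplus_eq_zero h n (hjI i hi) (hex i hi), LinearMap.zero_apply,
      Pi.zero_apply, norm_zero]
    exact hZ0

end AffineField

/-! ### The essential supremum of continuous functions -/

section EssSup

variable {N : ℕ} {E : Type*} [NormedAddCommGroup E] {α β : Fin N → ℝ}

theorem Icc_subset_closure_interior (h : ∀ n, α n < β n) :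
    Set.Icc α β ⊆ closure (interior (Set.Icc α β)) := by
  rw [← Set.pi_univ_Icc, interior_pi_set Set.finite_univ, closure_pi_set]
  refine Set.pi_mono fun n _ => ?_
  rw [interior_Icc, closure_Ioo (h n).ne]

/-- The box is the closure of its interior, so for continuous functions an almost everywhere bound
holds everywhere. Reliability needs pointwise values, whereas the estimator is an essential
supremum. -/
theorem norm_le_toReal_eLpNorm_top (h : ∀ n, α n < β n) {g : (Fin N → ℝ) → E}
    (hg : ContinuousOn g (Set.Icc α β)) {y : Fin N → ℝ} (hy : y ∈ Set.Icc α β) :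
    ‖g y‖ ≤ (eLpNorm g ⊤ (volume.restrict (Set.Icc α β))).toReal := by
  obtain ⟨K, hK⟩ := isCompact_Icc.exists_bound_of_continuousOn hg
  set c := eLpNorm g ⊤ (volume.restrict (Set.Icc α β)) with hc
  have hfin : c ≠ ⊤ := by
    refine ne_top_of_le_ne_top ENNReal.ofReal_ne_top (b := ENNReal.ofReal K) ?_
    rw [hc, eLpNorm_exponent_top]
    exact eLpNormEssSup_le_of_ae_bound ((ae_restrict_iff' measurableSet_Icc).2
      (Filter.Eventually.of_forall fun y hy => hK y hy))
  have hae : (fun y => max ‖g y‖ c.toReal) =ᵐ[volume.restrict (Set.Icc α β)]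
      fun _ => c.toReal := by
    filter_upwards [ae_le_eLpNormEssSup (f := g) (μ := volume.restrict (Set.Icc α β))] with y hy
    rw [← eLpNorm_exponent_top, ← hc] at hy
    refine max_eq_right ?_
    rw [← toReal_enorm]
    exact ENNReal.toReal_mono hfin hy
  have := Measure.eqOn_of_ae_eq hae (hg.norm.sup continuousOn_const) continuousOn_const
    (Icc_subset_closure_interior h) hy
  exact max_eq_right_iff.1 this

end EssSup

end SparseGrid

namespace SparseGrid

/-! ### Consequences of the holomorphic extension -/

theorem sigma_pos {N : ℕ} (hN : 1 ≤ N) {α β τ : Fin N → ℝ} (hαβ : ∀ n, α n < β n)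
    (hτ : ∀ n, 0 < τ n) : 0 < sigma α β τ := by
  have : Nonempty (Fin N) := ⟨⟨0, hN⟩⟩
  obtain ⟨n, hn⟩ := exists_eq_ciInf_of_finite (f := fun n => Real.log (2 * τ n / (β n - α n) +
    √(1 + 4 * τ n ^ 2 / (β n - α n) ^ 2)))
  rw [sigma, ← hn]
  have hp := sub_pos.2 (hαβ n)
  have h1 : 0 < 2 * τ n / (β n - α n) := div_pos (mul_pos two_pos (hτ n)) hp
  have h2 : 1 ≤ √(1 + 4 * τ n ^ 2 / (β n - α n) ^ 2) :=
    Real.one_le_sqrt.2 (le_add_of_nonneg_right (by positivity))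
  exact Real.log_pos (by linarith)

theorem exp_sigma_le {N : ℕ} {α β τ : Fin N → ℝ} (hαβ : ∀ n, α n < β n)
    (hτ : ∀ n, 0 < τ n) (n : Fin N) :
    Real.exp (sigma α β τ) ≤ bernstein (2 * τ n / (β n - α n)) := by
  have hp := sub_pos.2 (hαβ n)
  have h1 := one_lt_bernstein (div_pos (mul_pos two_pos (hτ n)) hp)
  rw [← Real.le_log_iff_exp_le (by linarith)]
  refine (ciInf_le (Set.finite_range _).bddBelow n).trans (le_of_eq ?_)
  rw [bernstein, div_pow, mul_pow]
  norm_num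

section Extension

variable {d N : ℕ} {D : Set (EuclideanSpace ℝ (Fin d))} {α β τ : Fin N → ℝ}
  {u : (Fin N → ℝ) → H10 ℝ D}

/-- Complexification of fields is isometric, so continuity can be read off from the holomorphic
extension. -/
theorem continuousOn_grad (hDopen : IsOpen D) (hDbdd : Bornology.IsBounded D)
    (hτ : ∀ n, 0 < τ n) (hext : HasHolomorphicExtension α β τ u) :
    ContinuousOn (fun y => grad (u y)) (Set.Icc α β) := by
  obtain ⟨U, hU, -, hUu⟩ := hext
  have hiso : Isometry (ofRealField D) :=
    AddMonoidHomClass.isometry_of_norm (ofRealField D) norm_ofRealField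
  rw [hiso.isEmbedding.isInducing.continuousOn_iff]
  have h1 : ContinuousOn (fun y : Fin N → ℝ => gradL ℂ D (U fun n => (y n : ℂ)))
      (Set.Icc α β) :=
    (gradL ℂ D).continuous.comp_continuousOn (hU.continuousOn.comp
      (Continuous.continuousOn (by fun_prop)) fun y hy => mem_complexNhd_of_mem_Icc hτ hy)
  exact h1.congr fun y hy => (grad_eq_ofRealField hDopen hDbdd (hUu y hy)).symm

theorem update_mem_complexNhd (hτ : ∀ n, 0 < τ n) {y : Fin N → ℝ} (hy : y ∈ Set.Icc α β)
    {n : Fin N} {z : ℂ}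
    (hz : Metric.infDist z (Complex.ofReal '' Set.Icc (α n) (β n)) ≤ τ n) :
    Function.update (fun l => (y l : ℂ)) n z ∈ complexNhd α β τ := by
  intro l
  by_cases hl : l = n
  · subst hl
    rwa [Function.update_self]
  · rw [Function.update_of_ne hl]
    exact mem_complexNhd_of_mem_Icc hτ hy l

theorem ofReal_update (y : Fin N → ℝ) (n : Fin N) (t : ℝ) :
    (fun l => ((Function.update y n t l : ℝ) : ℂ)) =
      Function.update (fun l => (y l : ℂ)) n (t : ℂ) := by
  funext l
  by_cases hl : l = n
  · subst hl
    rw [Function.update_self, Function.update_self]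
  · rw [Function.update_of_ne hl, Function.update_of_ne hl]

theorem differentiable_update_const (v : Fin N → ℂ) (n : Fin N) :
    Differentiable ℂ fun z : ℂ => Function.update v n z := by
  refine differentiable_pi.2 fun l => ?_
  by_cases hl : l = n
  · subst hl
    simp only [Function.update_self]
    exact differentiable_id
  · simp only [Function.update_of_ne hl]
    exact differentiable_const _

theorem ofRealField_smul_smul (b c : ℝ) (g : L2 D (EuclideanSpace ℝ (Fin d))) :
    ofRealField D (b • c • g) = ((b * c : ℝ) : ℂ) • ofRealField D g := by
  rw [smul_smul, map_smul]
  exact RCLike.real_smul_eq_coe_smul (K := ℂ) _ _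

theorem norm_commutator_le (hDopen : IsOpen D) (hDbdd : Bornology.IsBounded D)
    (hαβ : ∀ n, α n < β n) (hτ : ∀ n, 0 < τ n) {U : (Fin N → ℂ) → H10 ℂ D}
    (hU : DifferentiableOn ℂ U (complexNhd α β τ)) {M : ℝ}
    (hM : ∀ z ∈ complexNhd α β τ, ‖grad (U z)‖ ≤ M)
    (hUu : ∀ y ∈ Set.Icc α β,
      toL2 (U fun n => (y n : ℂ)) =ᵐ[volume.restrict D] fun x => ((toL2 (u y) x : ℝ) : ℂ))
    (n : Fin N) (i : ℕ) {y : Fin N → ℝ} (hy : y ∈ Set.Icc α β) :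
    ‖(mulCoord n * levelInterp α β n i - levelInterp α β n i * mulCoord n :
      Module.End ℝ ((Fin N → ℝ) → L2 D (EuclideanSpace ℝ (Fin d)))) (fun y => grad (u y)) y‖ ≤
    8 * i * ((β n - α n) * (2 * M * (bernstein (2 * τ n / (β n - α n)))⁻¹ ^ (m i - 1) /
        (1 - (bernstein (2 * τ n / (β n - α n)))⁻¹))) := by
  have hGd : DifferentiableOn ℂ
      (fun z : ℂ => gradL ℂ D (U (Function.update (fun l => (y l : ℂ)) n z)))
      {z | Metric.infDist z (Complex.ofReal '' Set.Icc (α n) (β n)) ≤ τ n} :=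
    (gradL ℂ D).differentiable.comp_differentiableOn (hU.comp
      (differentiable_update_const _ n).differentiableOn fun z hz =>
      update_mem_complexNhd hτ hy hz)
  have hbd := norm_sum_basis_sub_node_le (hαβ n) (hτ n) hGd
    (fun z hz => hM _ (update_mem_complexNhd hτ hy hz)) i (y := y n) ⟨hy.1 n, hy.2 n⟩
  refine le_of_eq_of_le ?_ hbd
  rw [mulCoord_levelInterp_sub_apply, ← norm_ofRealField, map_sum]
  refine congrArg _ (Finset.sum_congr rfl fun j _ => ?_)
  rw [ofRealField_smul_smul, ← grad_eq_ofRealField hDopen hDbdd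
    (hUu _ (update_mem_Icc hy (node_mem (hαβ n).le _ _))), ofReal_update]
  rfl

/-- Interpolation in one variable commutes with multiplication by the variable up to an
exponentially small error. -/
theorem exists_commutator_bound (hN : 1 ≤ N) (hDopen : IsOpen D) (hDbdd : Bornology.IsBounded D)
    (hαβ : ∀ n, α n < β n) (hτ : ∀ n, 0 < τ n) (hext : HasHolomorphicExtension α β τ u) :
    ∃ C : ℝ, 0 ≤ C ∧ ∀ n (i : ℕ), 1 ≤ i → ∀ y ∈ Set.Icc α β,
      ‖(mulCoord n * levelInterp α β n i - levelInterp α β n i * mulCoord n :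
        Module.End ℝ ((Fin N → ℝ) → L2 D (EuclideanSpace ℝ (Fin d)))) (fun y => grad (u y)) y‖ ≤
      C * i * Real.exp (-(sigma α β τ * m i)) := by
  obtain ⟨U, hU, ⟨M, hM⟩, hUu⟩ := hext
  have hα : α ∈ Set.Icc α β := ⟨le_rfl, fun n => (hαβ n).le⟩
  have hM0 : 0 ≤ M := (norm_nonneg _).trans (hM _ (mem_complexNhd_of_mem_Icc hτ hα))
  have hσ0 := sigma_pos hN hαβ hτ
  generalize hσ : sigma α β τ = σ at hσ0 ⊢
  obtain ⟨q, hq⟩ : ∃ q, q = Real.exp (-σ) := ⟨_, rfl⟩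
  have hq1 : 0 < 1 - q := by
    rw [hq, sub_pos]
    exact Real.exp_lt_one_iff.2 (by linarith)
  obtain ⟨S, hS⟩ : ∃ S, S = ∑ n, (β n - α n) := ⟨_, rfl⟩
  have hS0 : 0 ≤ S := hS ▸ Finset.sum_nonneg fun n _ => (sub_pos.2 (hαβ n)).le
  refine ⟨8 * (S * (2 * M / (1 - q))) * Real.exp σ, by positivity, fun n i hi y hy => ?_⟩
  refine (norm_commutator_le hDopen hDbdd hαβ hτ hU hM hUu n i hy).trans ?_
  have hρ := exp_sigma_le hαβ hτ n
  rw [hσ] at hρ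
  generalize bernstein (2 * τ n / (β n - α n)) = ρ at hρ ⊢
  have hρq : ρ⁻¹ ≤ q := by
    rw [hq, Real.exp_neg]
    exact inv_anti₀ (Real.exp_pos _) hρ
  have hρ0 : 0 ≤ ρ⁻¹ := inv_nonneg.2 ((Real.exp_pos _).le.trans hρ)
  -- The degree lost to the factor `y - X` costs one factor `exp σ`.
  have hpow : ρ⁻¹ ^ (m i - 1) ≤ Real.exp σ * Real.exp (-(σ * m i)) := by
    refine (pow_le_pow_left₀ hρ0 hρq _).trans (le_of_eq ?_)
    have hmi : 1 ≤ m i := m_mono.monotone hi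
    rw [hq, ← Real.exp_nat_mul, ← Real.exp_add, Nat.cast_sub hmi]
    congr 1
    push_cast
    ring
  have hSn : β n - α n ≤ S := hS ▸
    Finset.single_le_sum (f := fun n => β n - α n) (fun n _ => (sub_pos.2 (hαβ n)).le)
      (Finset.mem_univ n)
  have hfrac : 2 * M * ρ⁻¹ ^ (m i - 1) / (1 - ρ⁻¹) ≤
      2 * M * (Real.exp σ * Real.exp (-(σ * m i))) / (1 - q) :=
    div_le_div₀ (by positivity) (mul_le_mul_of_nonneg_left hpow (by positivity)) hq1
      (by linarith)
  have h1ρ : 0 < 1 - ρ⁻¹ := by linarith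
  calc _ ≤ 8 * (i : ℝ) * (S * (2 * M * (Real.exp σ * Real.exp (-(σ * m i))) / (1 - q))) := by
        refine mul_le_mul_of_nonneg_left (mul_le_mul hSn hfrac ?_ hS0) (by positivity)
        positivity
    _ = _ := by ring

end Extension

/-! ### The estimator -/

section Estimator

variable {d N : ℕ} {D : Set (EuclideanSpace ℝ (Fin d))} {α β : Fin N → ℝ}
  {a₀ : EuclideanSpace ℝ (Fin d) → ℝ} {a : Fin N → EuclideanSpace ℝ (Fin d) → ℝ} {amin amax : ℝ}
  {A₀ : L2 D (EuclideanSpace ℝ (Fin d)) →L[ℝ] L2 D (EuclideanSpace ℝ (Fin d))}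
  {A : Fin N → L2 D (EuclideanSpace ℝ (Fin d)) →L[ℝ] L2 D (EuclideanSpace ℝ (Fin d))}

theorem inner_affine_eq_integral
    (h₀ : ∀ g : L2 D (EuclideanSpace ℝ (Fin d)), A₀ g =ᵐ[volume.restrict D] fun x => a₀ x • g x)
    (h : ∀ n, ∀ g : L2 D (EuclideanSpace ℝ (Fin d)),
      A n g =ᵐ[volume.restrict D] fun x => a n x • g x)
    (y : Fin N → ℝ) (g k : L2 D (EuclideanSpace ℝ (Fin d))) :
    inner ℝ (A₀ g + ∑ n, y n • A n g) k = ∫ x in D, coef a₀ a y x * inner ℝ (g x) (k x) := by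
  rw [L2.inner_def]
  refine integral_congr_ae ?_
  filter_upwards [coeFn_affine_op h₀ h y g] with x h1
  rw [h1, real_inner_smul_left]
  rfl

theorem norm_sq_le_inner
    (h₀ : ∀ g : L2 D (EuclideanSpace ℝ (Fin d)), A₀ g =ᵐ[volume.restrict D] fun x => a₀ x • g x)
    (h : ∀ n, ∀ g : L2 D (EuclideanSpace ℝ (Fin d)),
      A n g =ᵐ[volume.restrict D] fun x => a n x • g x)
    {y : Fin N → ℝ} (hy : ∀ᵐ x ∂(volume.restrict D), amin ≤ coef a₀ a y x)
    (g : L2 D (EuclideanSpace ℝ (Fin d))) :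
    amin * ‖g‖ ^ 2 ≤ inner ℝ (A₀ g + ∑ n, y n • A n g) g := by
  have hint := L2.integrable_inner (𝕜 := ℝ) (A₀ g + ∑ n, y n • A n g) g
  rw [L2.inner_def, Lp_norm_sq ℝ, ← integral_const_mul]
  refine integral_mono_ae (((memLp_two_iff_integrable_sq_norm
      (Lp.aestronglyMeasurable _)).1 (Lp.memLp g)).const_mul _) hint ?_
  filter_upwards [coeFn_affine_op h₀ h y g, hy] with x h1 h2
  rw [h1, real_inner_smul_left, real_inner_self_eq_norm_sq]
  exact mul_le_mul_of_nonneg_right h2 (sq_nonneg _)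

theorem grad_sparseInterp (I : Finset (Fin N → ℕ)) (u : (Fin N → ℝ) → H10 ℝ D) (y : Fin N → ℝ) :
    grad (sparseInterp α β I u y) = sparseInterp α β I (fun y => grad (u y)) y :=
  (congrFun (sparseInterp_map (α := α) (β := β) (gradL ℝ D).toLinearMap I u) y).symm

theorem estimator_eq
    (h₀ : ∀ g : L2 D (EuclideanSpace ℝ (Fin d)), A₀ g =ᵐ[volume.restrict D] fun x => a₀ x • g x)
    (h : ∀ n, ∀ g : L2 D (EuclideanSpace ℝ (Fin d)),
      A n g =ᵐ[volume.restrict D] fun x => a n x • g x)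
    (u : (Fin N → ℝ) → H10 ℝ D) (I : Finset (Fin N → ℕ)) (i : Fin N → ℕ) :
    estimator α β a₀ a u I i = (eLpNorm (surplus α β i (affineField A₀ A
      (sparseInterp α β I fun y => grad (u y)))) ⊤ (volume.restrict (Set.Icc α β))).toReal := by
  have e : (fun y => mulField (coef a₀ a y) (grad (sparseInterp α β I u y))) =
      affineField A₀ A (sparseInterp α β I fun y => grad (u y)) := by
    funext y
    rw [mulField_eq h₀ h, grad_sparseInterp]
    rfl
  rw [estimator, e]

theorem continuousOn_affineField {E : Type*} [NormedAddCommGroup E] [InnerProductSpace ℝ E]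
    (A₀ : E →L[ℝ] E) (A : Fin N → E →L[ℝ] E) {g : (Fin N → ℝ) → E} {s : Set (Fin N → ℝ)}
    (hg : ContinuousOn g s) : ContinuousOn (affineField A₀ A g) s := by
  unfold affineField
  fun_prop

end Estimator

end SparseGrid

namespace SparseGrid

/-! ### The rate -/

/-- The decay is available at level `J - 1`, but the rate is stated at a level up to `J`; one
doubling separates them, and this halves `σ`. -/
theorem m_le_two_mul_add_one {J : ℕ} (hJ : 2 ≤ J) : m J ≤ 2 * m (J - 1) + 1 := by
  obtain ⟨k, rfl⟩ := Nat.exists_eq_add_of_le hJ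
  rcases k with _ | k
  · decide
  · have h1 : m (2 + (k + 1)) = 2 ^ (2 + k) + 1 := by simp [m]; omega
    have h2 : m (2 + (k + 1) - 1) = 2 ^ (1 + k) + 1 := by simp [m]; omega
    rw [h1, h2, show 2 + k = 1 + k + 1 by omega, pow_succ]
    omega

theorem mReal_le {x : ℝ} (hx : 1 < x) {J : ℕ} (hJ : x ≤ J) : mReal x ≤ m J := by
  rw [← mReal_natCast, mReal, mReal, if_neg (by linarith), if_neg (by linarith),
    if_neg (by linarith), if_neg (by linarith)]
  have := Real.rpow_le_rpow_of_exponent_le (x := 2) (by norm_num) (sub_le_sub_right hJ 1)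
  linarith

/-- The convergence rate. -/
noncomputable def rate (N : ℕ) (σ : ℝ) (ℓ : ℕ) : ℝ :=
  (ℓ : ℝ) ^ 5 * ((ℓ : ℝ) / N) ^ (4 * N) * 2 ^ ((ℓ : ℝ) * (1 - 1 / (N : ℝ))) *
    Real.exp (-(σ / 2) * mReal ((ℓ : ℝ) ^ (1 / (N : ℝ))))

theorem rate_pos {N : ℕ} (hN : 1 ≤ N) (σ : ℝ) {ℓ : ℕ} (hℓ : 1 ≤ ℓ) : 0 < rate N σ ℓ := by
  have h1 : (0 : ℝ) < N := by exact_mod_cast hN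
  have h2 : (0 : ℝ) < ℓ := by exact_mod_cast hℓ
  unfold rate
  positivity

theorem exists_level {N : ℕ} (hN : 1 ≤ N) {σ : ℝ} (hσ : 0 ≤ σ) :
    ∃ C : ℝ, 0 ≤ C ∧ ∀ ℓ : ℕ, 2 ≤ ℓ → ∃ J : ℕ, 2 ≤ J ∧ (J - 1) ^ N < ℓ ∧
      (ℓ : ℝ) ^ (2 * N) * ((J : ℝ) ^ (3 * N + 1) * (2 ^ (J - 1)) ^ (N - 1) *
        Real.exp (-(σ * m (J - 1)))) ≤ C * rate N σ ℓ := by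
  have hN0 : (0 : ℝ) < N := by exact_mod_cast hN
  have hN1 : (1 : ℝ) ≤ N := by exact_mod_cast hN
  refine ⟨2 ^ (4 * N) * N ^ (4 * N) * 2 ^ ((N : ℝ) - 1) * Real.exp (σ / 2), by positivity,
    fun ℓ hℓ => ?_⟩
  have hℓ1 : (1 : ℝ) < ℓ := by exact_mod_cast hℓ
  obtain ⟨x, hx⟩ : ∃ x, x = (ℓ : ℝ) ^ (1 / (N : ℝ)) := ⟨_, rfl⟩
  have hxN : x ^ N = ℓ := by
    rw [hx, one_div]
    exact Real.rpow_inv_natCast_pow (by linarith) (by omega)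
  have hx1 : 1 < x := hx ▸ Real.one_lt_rpow hℓ1 (by positivity)
  have hJx : x ≤ ⌈x⌉₊ := Nat.le_ceil x
  have hJx' : (⌈x⌉₊ : ℝ) < x + 1 := Nat.ceil_lt_add_one (by linarith)
  have hJ2 : 2 ≤ ⌈x⌉₊ := by
    have : (1 : ℝ) < (⌈x⌉₊ : ℕ) := hx1.trans_le hJx
    exact_mod_cast this
  generalize ⌈x⌉₊ = J at hJx hJx' hJ2
  have hJc : ((J - 1 : ℕ) : ℝ) = (J : ℝ) - 1 := by rw [Nat.cast_sub (by omega), Nat.cast_one]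
  refine ⟨J, hJ2, ?_, ?_⟩
  · have : ((J - 1 : ℕ) : ℝ) ^ N < ℓ := by
      rw [hJc, ← hxN]
      exact pow_lt_pow_left₀ (by linarith) (by linarith) (by omega)
    exact_mod_cast this
  have h1 : (J : ℝ) ^ (3 * N + 1) ≤ 2 ^ (4 * N) * (ℓ : ℝ) ^ 4 := by
    calc (J : ℝ) ^ (3 * N + 1) ≤ (2 * x) ^ (3 * N + 1) :=
          pow_le_pow_left₀ (by positivity) (by linarith) _
      _ ≤ (2 * x) ^ (4 * N) := pow_le_pow_right₀ (by linarith) (by omega)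
      _ = _ := by rw [mul_pow, mul_comm 4 N, pow_mul x, hxN]
  -- Bernoulli's inequality applied to `x^N = ℓ` gives `x ≤ ℓ/N + 1`, and `J - 1 < x`. The exponent
  -- `(ℓ/N)(N-1)` is the `ℓ(1 - 1/N)` of the rate.
  have h2 : ((2 : ℝ) ^ (J - 1)) ^ (N - 1) ≤
      2 ^ ((N : ℝ) - 1) * 2 ^ ((ℓ : ℝ) * (1 - 1 / (N : ℝ))) := by
    have hb := one_add_mul_le_pow (a := x - 1) (by linarith) N
    rw [add_sub_cancel, hxN] at hb
    have hxl : x ≤ ℓ / N + 1 := by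
      rw [← sub_le_iff_le_add, le_div_iff₀ hN0]
      linarith
    rw [← pow_mul, ← Real.rpow_natCast, ← Real.rpow_add two_pos]
    refine Real.rpow_le_rpow_of_exponent_le one_le_two ?_
    rw [Nat.cast_mul, hJc, Nat.cast_sub hN, Nat.cast_one]
    have e : (N : ℝ) - 1 + ℓ * (1 - 1 / (N : ℝ)) = (ℓ / N + 1) * (N - 1) := by
      field_simp
      ring
    rw [e]
    exact mul_le_mul_of_nonneg_right (by linarith) (by linarith)
  have h3 : Real.exp (-(σ * m (J - 1))) ≤ Real.exp (σ / 2) * Real.exp (-(σ / 2) * mReal x) := by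
    rw [← Real.exp_add, Real.exp_le_exp]
    have e1 := mReal_le hx1 hJx
    have e2 : (m J : ℝ) ≤ 2 * m (J - 1) + 1 := by exact_mod_cast m_le_two_mul_add_one hJ2
    nlinarith
  have h4 : (ℓ : ℝ) ^ (2 * N) * (ℓ : ℝ) ^ 4 ≤ N ^ (4 * N) * (ℓ ^ 5 * ((ℓ : ℝ) / N) ^ (4 * N)) := by
    have e : (N : ℝ) ^ (4 * N) * (ℓ ^ 5 * ((ℓ : ℝ) / N) ^ (4 * N)) = ℓ ^ (5 + 4 * N) := by
      rw [div_pow, pow_add]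
      field_simp
    rw [e, ← pow_add]
    exact pow_le_pow_right₀ hℓ1.le (by omega)
  rw [rate, ← hx]
  calc _ ≤ (ℓ : ℝ) ^ (2 * N) * ((2 ^ (4 * N) * (ℓ : ℝ) ^ 4) *
        (2 ^ ((N : ℝ) - 1) * 2 ^ ((ℓ : ℝ) * (1 - 1 / (N : ℝ)))) *
        (Real.exp (σ / 2) * Real.exp (-(σ / 2) * mReal x))) := by gcongr
    _ = ((ℓ : ℝ) ^ (2 * N) * (ℓ : ℝ) ^ 4) * (2 ^ (4 * N) *
        (2 ^ ((N : ℝ) - 1) * 2 ^ ((ℓ : ℝ) * (1 - 1 / (N : ℝ)))) *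
        (Real.exp (σ / 2) * Real.exp (-(σ / 2) * mReal x))) := by ring
    _ ≤ (N ^ (4 * N) * (ℓ ^ 5 * ((ℓ : ℝ) / N) ^ (4 * N))) * (2 ^ (4 * N) *
        (2 ^ ((N : ℝ) - 1) * 2 ^ ((ℓ : ℝ) * (1 - 1 / (N : ℝ)))) *
        (Real.exp (σ / 2) * Real.exp (-(σ / 2) * mReal x))) := by gcongr
    _ = _ := by ring

/-! ### Convergence of the adaptive algorithm -/

section Convergence

variable {d N : ℕ} {D : Set (EuclideanSpace ℝ (Fin d))} {α β τ : Fin N → ℝ}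
  {a₀ : EuclideanSpace ℝ (Fin d) → ℝ} {a : Fin N → EuclideanSpace ℝ (Fin d) → ℝ} {amin amax : ℝ}
  {f : EuclideanSpace ℝ (Fin d) → ℝ} {u : (Fin N → ℝ) → H10 ℝ D} {I : Finset (Fin N → ℕ)}
  {A₀ : L2 D (EuclideanSpace ℝ (Fin d)) →L[ℝ] L2 D (EuclideanSpace ℝ (Fin d))}
  {A : Fin N → L2 D (EuclideanSpace ℝ (Fin d)) →L[ℝ] L2 D (EuclideanSpace ℝ (Fin d))}

theorem grad_sub_sparseInterp (I : Finset (Fin N → ℕ)) (y : Fin N → ℝ) :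
    grad (u y - sparseInterp α β I u y) =
      grad (u y) - sparseInterp α β I (fun y => grad (u y)) y := by
  rw [← grad_sparseInterp]
  exact map_sub (gradL ℝ D) _ _

theorem estimator_nonneg (I : Finset (Fin N → ℕ)) (i : Fin N → ℕ) :
    0 ≤ estimator α β a₀ a u I i := ENNReal.toReal_nonneg

theorem norm_grad_error_le (hαβ : ∀ n, α n < β n)
    (h₀ : ∀ g : L2 D (EuclideanSpace ℝ (Fin d)), A₀ g =ᵐ[volume.restrict D] fun x => a₀ x • g x)
    (h : ∀ n, ∀ g : L2 D (EuclideanSpace ℝ (Fin d)),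
      A n g =ᵐ[volume.restrict D] fun x => a n x • g x)
    (hbound : ∀ y ∈ Set.Icc α β, ∀ᵐ x ∂(volume.restrict D),
      amin ≤ coef a₀ a y x ∧ coef a₀ a y x ≤ amax)
    (hu : ∀ y ∈ Set.Icc α β, IsWeakSolution (coef a₀ a y) f (u y))
    (hcont : ContinuousOn (fun y => grad (u y)) (Set.Icc α β)) (hpos : IsPositive I)
    (hI : IsDownwardClosed I) (h1 : (fun _ => 1) ∈ I) {y : Fin N → ℝ} (hy : y ∈ Set.Icc α β) :
    amin * ‖grad (u y - sparseInterp α β I u y)‖ ≤ ∑ j ∈ margin I, estimator α β a₀ a u I j := by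
  rw [grad_sub_sparseInterp]
  refine (norm_sub_sparseInterp_le (A₀ := A₀) (A := A) hαβ hpos hI h1 (W := Set.range (gradL ℝ D))
    (fun y => ⟨u y - sparseInterp α β I u y, grad_sub_sparseInterp I y⟩) ?_ (fun y hy => norm_sq_le_inner h₀ h
      ((hbound y hy).mono fun x hx => hx.1)) hy).trans (Finset.sum_le_sum fun j _ => ?_)
  · rintro _ ⟨w, rfl⟩
    refine ⟨∫ x in D, f x * toL2 w x, fun y hy => ?_⟩
    rw [affineField, inner_affine_eq_integral h₀ h]
    exact hu y hy w
  · rw [estimator_eq h₀ h]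
    exact norm_le_toReal_eLpNorm_top hαβ (continuousOn_surplus hαβ j
      (continuousOn_affineField A₀ A (continuousOn_sparseInterp hαβ I hcont))) hy

/-- The one block feeding `j` starts at level `J - 1` in the variable `n`, hence `m (J - 1)` in the
exponent. -/
theorem estimator_le (hαβ : ∀ n, α n < β n)
    (h₀ : ∀ g : L2 D (EuclideanSpace ℝ (Fin d)), A₀ g =ᵐ[volume.restrict D] fun x => a₀ x • g x)
    (h : ∀ n, ∀ g : L2 D (EuclideanSpace ℝ (Fin d)),
      A n g =ᵐ[volume.restrict D] fun x => a n x • g x) {K : ℝ} (hK0 : 0 ≤ K)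
    (hK : ∀ n g, ‖A n g‖ ≤ K * ‖g‖) {C σ : ℝ} (hC0 : 0 ≤ C)
    (hC : ∀ n (i : ℕ), 1 ≤ i → ∀ y ∈ Set.Icc α β,
      ‖(mulCoord n * levelInterp α β n i - levelInterp α β n i * mulCoord n :
        Module.End ℝ ((Fin N → ℝ) → L2 D (EuclideanSpace ℝ (Fin d)))) (fun y => grad (u y)) y‖ ≤
      C * i * Real.exp (-(σ * m i)))
    (hpos : IsPositive I) {J : ℕ} (hJ : 2 ≤ J) (hI : ∀ i ∈ I, ∀ n, i n < J) {j : Fin N → ℕ}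
    {n : Fin N} (hj : j n = J) :
    estimator α β a₀ a u I j ≤
      K * ((16 * J) ^ N * (C * J * Real.exp (-(σ * m (J - 1))))) := by
  rw [estimator_eq h₀ h]
  have hb : ∀ y ∈ Set.Icc α β, ‖surplus α β j (affineField A₀ A
      (sparseInterp α β I fun y => grad (u y))) y‖ ≤
      K * ((16 * J) ^ N * (C * J * Real.exp (-(σ * m (J - 1))))) := by
    intro y hy
    refine norm_surplus_affineField_le hαβ hI hj hK0 (hK n) (by positivity) fun i hi hji => ?_
    have hin : i n = J - 1 := by
      have := congrFun hji n
      rw [hj, Pi.add_apply, Pi.single_eq_same] at this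
      omega
    refine norm_surplus_mulCoord_surplus_le hαβ n (by omega) (hpos i hi)
      (fun l => (hI i hi l).le) (fun y hy => ?_) y hy
    refine (hC n (i n) (hpos i hi n) y hy).trans ?_
    rw [hin]
    have : ((J - 1 : ℕ) : ℝ) ≤ J := by exact_mod_cast Nat.sub_le J 1
    gcongr
  refine ENNReal.toReal_le_of_le_ofReal (by positivity) ?_
  rw [eLpNorm_exponent_top]
  exact eLpNormEssSup_le_of_ae_bound ((ae_restrict_iff' measurableSet_Icc).2
    (Filter.Eventually.of_forall hb))

/-- The error at the step `ℓ` is controlled by the error at any earlier step. -/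
theorem norm_grad_error_le_of_subset (hαβ : ∀ n, α n < β n) {I' : Finset (Fin N → ℕ)}
    (hpos : IsPositive I) (hI : I ⊆ I') {c K : ℝ} (hc : SupBound α β (sparseInterp α β I' :
      Module.End ℝ ((Fin N → ℝ) → L2 D (EuclideanSpace ℝ (Fin d)))) c)
    (hK : ∀ y ∈ Set.Icc α β, ‖grad (u y - sparseInterp α β I u y)‖ ≤ K)
    {y : Fin N → ℝ} (hy : y ∈ Set.Icc α β) :
    ‖grad (u y - sparseInterp α β I' u y)‖ ≤ (1 + c) * K := by
  have e : (1 - sparseInterp α β I' : Module.End ℝ ((Fin N → ℝ) → L2 D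
      (EuclideanSpace ℝ (Fin d)))) ((fun y => grad (u y)) - sparseInterp α β I fun y => grad (u y))
      y = grad (u y - sparseInterp α β I' u y) := by
    rw [grad_sub_sparseInterp, map_sub, ← Module.End.mul_apply, sub_mul,
      sparseInterp_mul_of_subset hαβ hpos hI, one_mul, sub_self, LinearMap.zero_apply, sub_zero,
      LinearMap.sub_apply]
    rfl
  rw [← e]
  refine (supBound_one.sub hc) _ K (fun y hy => ?_) y hy
  rw [Pi.sub_apply, ← grad_sub_sparseInterp]
  exact hK y hy

theorem supBound_indexSet (hN : 1 ≤ N) (hαβ : ∀ n, α n < β n)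
    (P : Finset (Fin N → ℕ) → (Fin N → ℕ) → ℝ) {ℓ : ℕ} (hℓ : 1 ≤ ℓ) :
    SupBound α β (sparseInterp α β (indexSet P ℓ) :
      Module.End ℝ ((Fin N → ℝ) → L2 D (EuclideanSpace ℝ (Fin d)))) (16 ^ N * ℓ ^ (2 * N)) := by
  obtain ⟨k, rfl⟩ := Nat.exists_eq_add_of_le' hℓ
  obtain ⟨-, hpos, -, hk, -⟩ := indexSet_spec (P := P) hN k
  refine (supBound_sparseInterp hαβ hk).mono hαβ ?_
  have hc : ((indexSet P (k + 1)).card : ℝ) ≤ ((k + 1 : ℕ) : ℝ) ^ N := by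
    exact_mod_cast card_le_pow hpos hk
  calc _ ≤ ((k + 1 : ℕ) : ℝ) ^ N * (16 * ((k + 1 : ℕ) : ℝ)) ^ N := by gcongr
    _ = _ := by rw [mul_pow, two_mul, pow_add]; ring

theorem exists_error_le (hN : 1 ≤ N) (hαβ : ∀ n, α n < β n) (hamin : 0 < amin)
    (h₀ : ∀ g : L2 D (EuclideanSpace ℝ (Fin d)), A₀ g =ᵐ[volume.restrict D] fun x => a₀ x • g x)
    (h : ∀ n, ∀ g : L2 D (EuclideanSpace ℝ (Fin d)),
      A n g =ᵐ[volume.restrict D] fun x => a n x • g x) {K : ℝ} (hK0 : 0 ≤ K)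
    (hK : ∀ n g, ‖A n g‖ ≤ K * ‖g‖)
    (hbound : ∀ y ∈ Set.Icc α β, ∀ᵐ x ∂(volume.restrict D),
      amin ≤ coef a₀ a y x ∧ coef a₀ a y x ≤ amax)
    (hu : ∀ y ∈ Set.Icc α β, IsWeakSolution (coef a₀ a y) f (u y))
    (hcont : ContinuousOn (fun y => grad (u y)) (Set.Icc α β)) {C σ : ℝ} (hC0 : 0 ≤ C)
    (hC : ∀ n (i : ℕ), 1 ≤ i → ∀ y ∈ Set.Icc α β,
      ‖(mulCoord n * levelInterp α β n i - levelInterp α β n i * mulCoord n :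
        Module.End ℝ ((Fin N → ℝ) → L2 D (EuclideanSpace ℝ (Fin d)))) (fun y => grad (u y)) y‖ ≤
      C * i * Real.exp (-(σ * m i))) :
    ∃ c : ℝ, 0 ≤ c ∧ ∀ ℓ J : ℕ, 1 ≤ ℓ → 2 ≤ J → (J - 1) ^ N < ℓ → ∀ y ∈ Set.Icc α β,
      ‖grad (u y - adaptiveApprox α β a₀ a u ℓ y)‖ ≤ c * ((ℓ : ℝ) ^ (2 * N) *
        ((J : ℝ) ^ (3 * N + 1) * (2 ^ (J - 1)) ^ (N - 1) * Real.exp (-(σ * m (J - 1))))) := by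
  refine ⟨2 * 16 ^ N * (2 * (K * (16 ^ N * C)) / amin), by positivity, fun ℓ J hℓ hJ hJℓ y hy => ?_⟩
  obtain ⟨l, rfl⟩ := Nat.exists_eq_add_of_le' hℓ
  set P := profitWithWork (estimator α β a₀ a u) with hP
  obtain ⟨-, hposl, -, -, hcard⟩ := indexSet_spec (P := P) hN l
  -- Pigeonhole: at most `(J-1)^N` positive indices have all entries below `J`, fewer than the index
  -- set contains.
  have hex : ∃ j ∈ indexSet P (l + 1), ∃ n, J ≤ j n := by
    by_contra! hcon
    have := card_le_pow hposl (J := J - 1) fun i hi n => Nat.le_sub_one_of_lt (hcon i hi n)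
    omega
  obtain ⟨k, hkl, hkJ, i, hi, n, hn⟩ := exists_first_step hN hJ hex
  obtain ⟨h1, hpos, hdc, -, -⟩ := indexSet_spec (P := P) hN k
  have hsum := sum_margin_le (ζ := estimator α β a₀ a u) (fun i => estimator_nonneg _ i) hpos hkJ
    hi hn (Z := K * ((16 * J) ^ N * (C * J * Real.exp (-(σ * m (J - 1)))))) fun j hj =>
      estimator_le hαβ h₀ h hK0 hK hC0 hC hpos hJ hkJ (hn j hj)
  have hℓ1 : (1 : ℝ) ≤ ((l + 1 : ℕ) : ℝ) := by exact_mod_cast hℓ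
  refine (norm_grad_error_le_of_subset hαβ hpos (indexSet_mono hN hkl)
    (supBound_indexSet hN hαβ P hℓ) (fun y hy => ?_) hy (K := 2 * (K * (16 ^ N * C)) / amin *
      ((J : ℝ) ^ (3 * N + 1) * (2 ^ (J - 1)) ^ (N - 1) * Real.exp (-(σ * m (J - 1)))))).trans ?_
  · rw [div_mul_eq_mul_div, le_div_iff₀ hamin, mul_comm]
    refine (norm_grad_error_le hαβ h₀ h hbound hu hcont hpos hdc h1 hy).trans
      (hsum.trans (le_of_eq ?_))
    -- Of the power `J^(3N+1)`, one `J^N` counts the margin, one counts an added set, and `J^N · J`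
    -- comes from the estimator. The work of the maximizer cancels one of the `N` factors `2^(J-1)`.
    have e1 : (2 : ℝ) ^ J = 2 * 2 ^ (J - 1) := by rw [← pow_succ', Nat.sub_add_cancel (by omega)]
    have e2 : ((2 : ℝ) ^ (J - 1)) ^ N = (2 ^ (J - 1)) ^ (N - 1) * 2 ^ (J - 1) := by
      rw [← pow_succ, Nat.sub_add_cancel hN]
    have e3 : (J : ℝ) ^ (3 * N + 1) = J ^ N * J ^ N * J ^ N * J := by ring
    rw [e1, e2, e3, mul_pow]
    field_simp
    ring
  · have : 1 + 16 ^ N * ((l + 1 : ℕ) : ℝ) ^ (2 * N) ≤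
        2 * 16 ^ N * ((l + 1 : ℕ) : ℝ) ^ (2 * N) := by
      have h2 : (1 : ℝ) ≤ 16 ^ N := one_le_pow₀ (by norm_num)
      have h3 : (1 : ℝ) ≤ ((l + 1 : ℕ) : ℝ) ^ (2 * N) := one_le_pow₀ hℓ1
      nlinarith
    calc _ ≤ (2 * 16 ^ N * ((l + 1 : ℕ) : ℝ) ^ (2 * N)) * (2 * (K * (16 ^ N * C)) / amin *
          ((J : ℝ) ^ (3 * N + 1) * (2 ^ (J - 1)) ^ (N - 1) *
            Real.exp (-(σ * m (J - 1))))) := by gcongr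
      _ = _ := by ring

theorem exists_error_le_rate (hN : 1 ≤ N) (hDopen : IsOpen D) (hDbdd : Bornology.IsBounded D)
    (hαβ : ∀ n, α n < β n)
    (ha₀ : AEStronglyMeasurable a₀ (volume.restrict D))
    (ha : ∀ n, AEStronglyMeasurable (a n) (volume.restrict D)) (hamin : 0 < amin)
    (hbound : ∀ y ∈ Set.Icc α β, ∀ᵐ x ∂(volume.restrict D),
      amin ≤ coef a₀ a y x ∧ coef a₀ a y x ≤ amax)
    (hu : ∀ y ∈ Set.Icc α β, IsWeakSolution (coef a₀ a y) f (u y))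
    (hτ : ∀ n, 0 < τ n) (hext : HasHolomorphicExtension α β τ u) :
    ∃ C : ℝ, 0 < C ∧ ∀ ℓ : ℕ, 1 ≤ ℓ → ∀ y ∈ Set.Icc α β,
      ‖grad (u y - adaptiveApprox α β a₀ a u ℓ y)‖ ≤ C * rate N (sigma α β τ) ℓ := by
  obtain ⟨K, hK0, hKa₀, hKa⟩ := exists_coef_bound hαβ hamin hbound
  obtain ⟨A₀, hA₀, -⟩ := exists_mulOp (F := EuclideanSpace ℝ (Fin d)) ha₀ hKa₀
  choose A hA hAK using fun n => exists_mulOp (F := EuclideanSpace ℝ (Fin d)) (ha n) (hKa n)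
  have hcont := continuousOn_grad hDopen hDbdd hτ hext
  obtain ⟨C₁, hC₁, hcomm⟩ := exists_commutator_bound hN hDopen hDbdd hαβ hτ hext
  obtain ⟨c, hc0, hc⟩ := exists_error_le hN hαβ hamin hA₀ hA hK0 hAK hbound hu hcont hC₁ hcomm
  obtain ⟨C₂, hC₂, hlevel⟩ := exists_level hN (sigma_pos hN hαβ hτ).le
  obtain ⟨B, hB⟩ := isCompact_Icc.exists_bound_of_continuousOn hcont
  have hα : α ∈ Set.Icc α β := ⟨le_rfl, fun n => (hαβ n).le⟩
  have hB0 : 0 ≤ B := (norm_nonneg _).trans (hB α hα)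
  have hr1 := rate_pos hN (sigma α β τ) (le_refl 1)
  refine ⟨c * C₂ + (1 + 16 ^ N) * B / rate N (sigma α β τ) 1 + 1, by positivity,
    fun ℓ hℓ y hy => ?_⟩
  have hr := rate_pos hN (sigma α β τ) hℓ
  rcases hℓ.eq_or_lt with rfl | hℓ2
  -- For `ℓ = 1` no `J ≥ 2` satisfies `(J-1)^N < ℓ`. Comparison with the empty index set bounds the
  -- error by a multiple of the supremum of the gradient of `u`, and this is absorbed into the
  -- constant.
  · have hsup := supBound_indexSet (D := D) hN hαβ (profitWithWork (estimator α β a₀ a u))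
      (le_refl 1)
    have := norm_grad_error_le_of_subset (u := u) hαβ (I := ∅) (fun i hi => by simp at hi)
      (Finset.empty_subset _) hsup (K := B) (fun y hy => by simpa [sparseInterp] using hB y hy) hy
    refine this.trans ?_
    rw [Nat.cast_one, one_pow, mul_one]
    have e : (1 + 16 ^ N) * B = (1 + 16 ^ N) * B / rate N (sigma α β τ) 1 *
      rate N (sigma α β τ) 1 := by field_simp
    refine e.le.trans (mul_le_mul_of_nonneg_right ?_ hr.le)
    have : 0 ≤ c * C₂ := by positivity
    linarith
  · obtain ⟨J, hJ, hJℓ, hle⟩ := hlevel ℓ hℓ2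
    refine (hc ℓ J hℓ hJ hJℓ y hy).trans ((mul_le_mul_of_nonneg_left hle hc0).trans ?_)
    rw [← mul_assoc]
    refine mul_le_mul_of_nonneg_right ?_ hr.le
    have : 0 ≤ (1 + 16 ^ N) * B / rate N (sigma α β τ) 1 := by positivity
    linarith

end Convergence

end SparseGrid

/-! ### The main theorem. -/

theorem mainTheorem5 {d N : ℕ} (hd : 2 ≤ d) (hN : 1 ≤ N)
    (D : Set (EuclideanSpace ℝ (Fin d))) (hDopen : IsOpen D) (hDbdd : Bornology.IsBounded D)
    (α β : Fin N → ℝ) (hαβ : ∀ n, α n < β n)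
    (a₀ : EuclideanSpace ℝ (Fin d) → ℝ) (a : Fin N → EuclideanSpace ℝ (Fin d) → ℝ)
    (ha₀ : AEStronglyMeasurable a₀ (volume.restrict D))
    (ha : ∀ n, AEStronglyMeasurable (a n) (volume.restrict D))
    (amin amax : ℝ) (hamin : 0 < amin)
    (hbound : ∀ y ∈ Set.Icc α β, ∀ᵐ x ∂(volume.restrict D),
      amin ≤ coef a₀ a y x ∧ coef a₀ a y x ≤ amax)
    (f : EuclideanSpace ℝ (Fin d) → ℝ) (hf : MemLp f 2 (volume.restrict D))
    (u : (Fin N → ℝ) → H10 ℝ D)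
    (hu : ∀ y ∈ Set.Icc α β, IsWeakSolution (coef a₀ a y) f (u y)) :
    (∃ τ : Fin N → ℝ, (∀ n, 0 < τ n) ∧ HasHolomorphicExtension α β τ u) ∧
    ∀ τ : Fin N → ℝ, (∀ n, 0 < τ n) → HasHolomorphicExtension α β τ u →
      ∃ C : ℝ, 0 < C ∧ ∀ ℓ : ℕ, 0 < ℓ →
        eLpNorm (fun y => grad (u y - adaptiveApprox α β a₀ a u ℓ y)) ⊤
            (volume.restrict (Set.Icc α β)) ≤
          ENNReal.ofReal (C * ((ℓ : ℝ) ^ 5 * ((ℓ : ℝ) / N) ^ (4 * N) *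
            2 ^ ((ℓ : ℝ) * (1 - 1 / (N : ℝ))) *
            Real.exp (-(sigma α β τ / 2) * mReal ((ℓ : ℝ) ^ (1 / (N : ℝ)))))) := by
  refine ⟨exists_holomorphicExtension (by omega) hDbdd hαβ ha₀ ha hamin hbound hf hu,
    fun τ hτ hext => ?_⟩
  obtain ⟨C, hC, h⟩ :=
    exists_error_le_rate hN hDopen hDbdd hαβ ha₀ ha hamin hbound hu hτ hext
  refine ⟨C, hC, fun ℓ hℓ => ?_⟩
  rw [eLpNorm_exponent_top]
  exact eLpNormEssSup_le_of_ae_bound ((ae_restrict_iff' measurableSet_Icc).2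
    (Filter.Eventually.of_forall fun y hy => h ℓ hℓ y hy))
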